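/- **Theorem.** Let $k$ be an algebraically closed field of characteristic $2$, let $G$ be the simple algebraic group of type $E_8$ over $k$, and let $\mathfrak g=\mathrm{Lie}(G)$, with root vectors $e_\alpha$ of a Chevalley basis. Let $\mathcal O(A_1^4)$ be the $G$-orbit (adjoint action) of $e_{\alpha_2}+e_{\alpha_3}+e_{\alpha_5}+e_{\alpha_7}$ (simple roots in Bourbaki's numbering). Let $e\in\mathcal O(A_1^4)$, let $\mathfrak n_e=\{x\in\mathfrak g:[x,e]\in ke\}$, and let $\mathfrak n_e^{(3)}$ be the third derived subalgebra of $\mathfrak n_e$. Let $\mathcal O(8;\underline 1)=k[x_1,\dots,x_8]/(x_1^2,\dots,x_8^2)$ with partial derivatives $\partial_i$, and put $j'=j+4$ for $j\le 4$ and $j'=j-4$ for $j\ge5$. Let $W(8;\underline 1)=\mathrm{Der}\,\mathcal O(8;\underline 1)$, let $$H(8;\underline 1)=\Big\{\sum_i f_i\partial_i\in W(8;\underline 1):\ \partial_i(f_{j'})=\partial_j(f_{i'})\text{ for all }i,j\Big\},$$ let $H(8;\underline1)^{(1)}$ be its derived subalgebra, and let $D_H(f)=\sum_{j=1}^8\partial_j(f)\,\partial_{j'}$.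 Let $\mathcal H(8;\underline 1)$ be the Lie subalgebra of $W(8;\underline 1)$ generated by $\partial_1,\dots,\partial_8$ and the elements $$v_i=D_H\Big(x_i\sum_{\{a,b\}}x_ax_{a'}x_bx_{b'}\Big),\qquad 1\le i\le 8,$$ where the sum is over the three two-element subsets $\{a,b\}\subset\{1,2,3,4\}$ containing neither $i$ nor $i'$. Then: 1. $\dim\mathfrak n_e=129$ and $\mathfrak n_e$ is a maximal subalgebra of $\mathfrak g$. 2. $\mathcal H(8;\underline 1)$ is a simple Lie algebra of dimension $118$ contained in $H(8;\underline 1)^{(1)}$. 3. $e\in\mathfrak n_e^{(3)}$, and $\mathfrak n_e^{(3)}/ke\cong\mathcal H(8;\underline 1)$ as Lie algebras. -/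

import Mathlib

open scoped Matrix

noncomputable section

namespace E8Char2

/-! ### The root lattice of type `E₈` -/

/-- The `E₈` root lattice, in coordinates with respect to the simple roots (Bourbaki numbering,
shifted so that the simple roots are indexed by `0, …, 7`). -/
abbrev RootLattice : Type := Fin 8 → ℤ

/-- The invariant form on the root lattice, given by the Cartan matrix. -/
def form (v w : RootLattice) : ℤ := v ⬝ᵥ (CartanMatrix.E₈ *ᵥ w)

/-- The unitriangular matrix `U` with `U + Uᵀ` the Cartan matrix. -/
def cocycleMatrix : Matrix (Fin 8) (Fin 8) ℤ :=
  Matrix.of fun i j => if i = j then 1 else if i < j then CartanMatrix.E₈ i j else 0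

/-- A bilinear form with `B v w + B w v = (v, w)`. -/
def cocycleForm (v w : RootLattice) : ℤ := v ⬝ᵥ (cocycleMatrix *ᵥ w)

/-- The bimultiplicative sign `ε(v, w) = (-1) ^ B(v, w)`. -/
def sgn (v w : RootLattice) : ℤ := ((cocycleForm v w).negOnePow : ℤ)

/-- The roots of `E₈`: the lattice vectors of norm `2`. -/
abbrev Root : Type := {v : RootLattice // form v v = 2}

/-- The simple roots. -/
def simpleRoot (i : Fin 8) : Root :=
  ⟨Pi.single i 1, by revert i; unfold form; decide⟩

theorem form_add_left (u v w : RootLattice) : form (u + v) w = form u w + form v w := by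
  simp [form, add_dotProduct]

theorem form_add_right (u v w : RootLattice) : form u (v + w) = form u v + form u w := by
  simp [form, Matrix.mulVec_add, dotProduct_add]

theorem form_neg_left (v w : RootLattice) : form (-v) w = -form v w := by
  simp [form]

theorem form_neg_right (v w : RootLattice) : form v (-w) = -form v w := by
  simp [form, Matrix.mulVec_neg]

theorem form_comm (v w : RootLattice) : form v w = form w v := by
  unfold form
  rw [Matrix.dotProduct_mulVec, ← Matrix.mulVec_transpose, CartanMatrix.E₈_transpose,
    dotProduct_comm]

theorem cocycleForm_add_left (u v w : RootLattice) :
    cocycleForm (u + v) w = cocycleForm u w + cocycleForm v w := by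
  simp [cocycleForm, add_dotProduct]

theorem cocycleForm_add_right (u v w : RootLattice) :
    cocycleForm u (v + w) = cocycleForm u v + cocycleForm u w := by
  simp [cocycleForm, Matrix.mulVec_add, dotProduct_add]

theorem cocycleForm_neg_left (v w : RootLattice) : cocycleForm (-v) w = -cocycleForm v w := by
  simp [cocycleForm]

theorem cocycleForm_neg_right (v w : RootLattice) : cocycleForm v (-w) = -cocycleForm v w := by
  simp [cocycleForm, Matrix.mulVec_neg]

theorem cocycleForm_add_swap (v w : RootLattice) :
    cocycleForm v w + cocycleForm w v = form v w := by
  have h : cocycleMatrix + cocycleMatrixᵀ = CartanMatrix.E₈ := by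
    unfold cocycleMatrix; decide
  unfold form
  rw [← h, Matrix.add_mulVec, dotProduct_add, Matrix.mulVec_transpose]
  unfold cocycleForm
  rw [Matrix.dotProduct_mulVec w, dotProduct_comm v (Matrix.vecMul w cocycleMatrix)]

theorem cocycleForm_self (v : Root) : cocycleForm v.1 v.1 = 1 := by
  have h := cocycleForm_add_swap v.1 v.1
  rw [v.2] at h
  omega

theorem form_sq (v : RootLattice) : 60 * form v v =
    30 * (2 * v 1 - v 3) ^ 2 + 30 * (2 * v 0 - v 2) ^ 2 + 10 * (3 * v 2 - 2 * v 3) ^ 2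
    + 30 * (2 * v 7 - v 6) ^ 2 + 10 * (3 * v 6 - 2 * v 5) ^ 2 + 5 * (4 * v 5 - 3 * v 4) ^ 2
    + 3 * (5 * v 4 - 4 * v 3) ^ 2 + 2 * v 3 ^ 2 := by
  simp [form, CartanMatrix.E₈, dotProduct, Matrix.mulVec, Fin.sum_univ_eight]
  ring

theorem form_nonneg (v : RootLattice) : 0 ≤ form v v := by
  have h := form_sq v
  have : 0 ≤ 60 * form v v := by rw [h]; positivity
  omega

theorem eq_zero_of_form (v : RootLattice) (hv : form v v = 0) : v = 0 := by
  have h := form_sq v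
  rw [hv] at h
  have h3 : v 3 = 0 := by
    refine pow_eq_zero_iff (two_ne_zero) |>.1 (le_antisymm ?_ (sq_nonneg _))
    nlinarith [sq_nonneg (2 * v 1 - v 3), sq_nonneg (2 * v 0 - v 2),
      sq_nonneg (3 * v 2 - 2 * v 3), sq_nonneg (2 * v 7 - v 6), sq_nonneg (3 * v 6 - 2 * v 5),
      sq_nonneg (4 * v 5 - 3 * v 4), sq_nonneg (5 * v 4 - 4 * v 3)]
  have key : ∀ x : ℤ, x ^ 2 ≤ 0 → x = 0 := fun x hx =>
    pow_eq_zero_iff (two_ne_zero) |>.1 (le_antisymm hx (sq_nonneg _))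
  have s1 := sq_nonneg (2 * v 1 - v 3)
  have s2 := sq_nonneg (2 * v 0 - v 2)
  have s3 := sq_nonneg (3 * v 2 - 2 * v 3)
  have s4 := sq_nonneg (2 * v 7 - v 6)
  have s5 := sq_nonneg (3 * v 6 - 2 * v 5)
  have s6 := sq_nonneg (4 * v 5 - 3 * v 4)
  have s7 := sq_nonneg (5 * v 4 - 4 * v 3)
  have s8 := sq_nonneg (v 3)
  have t1 := key (2 * v 1 - v 3) (by linarith)
  have t2 := key (2 * v 0 - v 2) (by linarith)
  have t3 := key (3 * v 2 - 2 * v 3) (by linarith)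
  have t4 := key (2 * v 7 - v 6) (by linarith)
  have t5 := key (3 * v 6 - 2 * v 5) (by linarith)
  have t6 := key (4 * v 5 - 3 * v 4) (by linarith)
  have t7 := key (5 * v 4 - 4 * v 3) (by linarith)
  funext i
  fin_cases i <;> simp <;> omega

theorem form_add_self (v w : RootLattice) :
    form (v + w) (v + w) = form v v + 2 * form v w + form w w := by
  rw [form_add_left, form_add_right, form_add_right, form_comm w v]; ring

theorem root_add_iff (v w : Root) : form (v.1 + w.1) (v.1 + w.1) = 2 ↔ form v.1 w.1 = -1 := by
  rw [form_add_self, v.2, w.2]; omega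

theorem root_add_eq_zero_iff (v w : Root) : v.1 + w.1 = 0 ↔ form v.1 w.1 = -2 := by
  constructor
  · intro h
    rw [eq_neg_of_add_eq_zero_right h, form_neg_right, v.2]
  · intro h
    apply eq_zero_of_form
    rw [form_add_self, v.2, w.2, h]; norm_num

theorem root_form_ge (v w : Root) : -2 ≤ form v.1 w.1 := by
  have h := form_nonneg (v.1 + w.1)
  rw [form_add_self, v.2, w.2] at h
  omega

/-! ### The split Lie algebra of type `E₈` -/

/-- The underlying module of the split Lie algebra of type `E₈` over `R`: it is free on the
coroots `hᵢ` of the simple roots (`Sum.inl i`) and root vectors `e_α` (`Sum.inr α`). -/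
def LieE8 (R : Type*) [CommRing R] : Type _ := (Fin 8 ⊕ Root) →₀ R

section Algebra

variable {R : Type*} [CommRing R]

instance : AddCommGroup (LieE8 R) := inferInstanceAs (AddCommGroup ((Fin 8 ⊕ Root) →₀ R))

instance : Module R (LieE8 R) := inferInstanceAs (Module R ((Fin 8 ⊕ Root) →₀ R))

/-- The basis of `hᵢ` and `e_α`. -/
def stdBasis (R : Type*) [CommRing R] : Module.Basis (Fin 8 ⊕ Root) R (LieE8 R) :=
  Module.Basis.ofRepr (LinearEquiv.refl R ((Fin 8 ⊕ Root) →₀ R))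

/-- The coroot (identified with the root, all roots having norm `2`) attached to a lattice
vector. -/
def coroot (v : RootLattice) : LieE8 R := ∑ i, (v i : R) • stdBasis R (Sum.inl i)

open Classical in
/-- The root vector `e_v` if `v` is a root, and `0` otherwise. -/
def rootVec (v : RootLattice) : LieE8 R :=
  if h : form v v = 2 then stdBasis R (Sum.inr ⟨v, h⟩) else 0

open Classical in
/-- The bracket of two basis elements:
`[hᵢ, hⱼ] = 0`, `[hᵢ, e_β] = ⟨β, αᵢ^∨⟩ e_β`, `[e_α, e_{-α}] = -h_α`, and
`[e_α, e_β] = ε(α, β) e_{α+β}` (zero if `α + β` is not a root) for `β ≠ -α`.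
Up to replacing `e_{-α}` by `-e_{-α}` for positive `α` this is a Chevalley basis. -/
def basisBracket : Fin 8 ⊕ Root → Fin 8 ⊕ Root → LieE8 R
  | Sum.inl _, Sum.inl _ => 0
  | Sum.inl i, Sum.inr β => (form (simpleRoot i).1 β.1 : R) • rootVec β.1
  | Sum.inr α, Sum.inl j => -((form (simpleRoot j).1 α.1 : R) • rootVec α.1)
  | Sum.inr α, Sum.inr β =>
      if α.1 + β.1 = 0 then -coroot α.1 else (sgn α.1 β.1 : R) • rootVec (α.1 + β.1)

/-- The bracket as a bilinear map. -/
def bracketMap (R : Type*) [CommRing R] : LieE8 R →ₗ[R] LieE8 R →ₗ[R] LieE8 R :=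
  (stdBasis R).constr R fun a => (stdBasis R).constr R fun b => basisBracket a b

theorem rootVec_root (α : Root) : rootVec (R := R) α.1 = stdBasis R (Sum.inr α) := by
  rw [rootVec, dif_pos α.2]

theorem rootVec_of_ne {v : RootLattice} (h : form v v ≠ 2) : rootVec (R := R) v = 0 := by
  simp [rootVec, h]

theorem coroot_simple (i : Fin 8) : coroot (R := R) (simpleRoot i).1 = stdBasis R (Sum.inl i) := by
  simp [coroot, simpleRoot, Pi.single_apply]

theorem coroot_add (v w : RootLattice) : coroot (R := R) (v + w) = coroot v + coroot w := by
  simp [coroot, add_smul, Finset.sum_add_distrib]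

theorem coroot_neg (v : RootLattice) : coroot (R := R) (-v) = -coroot v := by
  simp [coroot]

theorem form_eq_sum (v w : RootLattice) : form v w = ∑ i, v i * form (simpleRoot i).1 w := by
  simp only [form, simpleRoot, single_dotProduct, one_mul]
  rfl

theorem bracketMap_basis (a b : Fin 8 ⊕ Root) :
    bracketMap R (stdBasis R a) (stdBasis R b) = basisBracket a b := by
  simp [bracketMap]

theorem bracketMap_coroot_coroot (v w : RootLattice) :
    bracketMap R (coroot v) (coroot w) = 0 := by
  simp [coroot, bracketMap_basis, basisBracket]

theorem bracketMap_coroot_rootVec (v w : RootLattice) :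
    bracketMap R (coroot v) (rootVec w) = (form v w : R) • rootVec w := by
  by_cases hw : form w w = 2
  · obtain ⟨β, rfl⟩ : ∃ β : Root, β.1 = w := ⟨⟨w, hw⟩, rfl⟩
    rw [rootVec_root, form_eq_sum]
    simp [coroot, bracketMap_basis, basisBracket, smul_smul, Finset.sum_smul, rootVec_root]
  · simp [rootVec_of_ne hw]

theorem bracketMap_rootVec_coroot (v w : RootLattice) :
    bracketMap R (rootVec w) (coroot v) = -((form v w : R) • rootVec w) := by
  by_cases hw : form w w = 2
  · obtain ⟨β, rfl⟩ : ∃ β : Root, β.1 = w := ⟨⟨w, hw⟩, rfl⟩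
    rw [rootVec_root, form_eq_sum]
    simp [coroot, bracketMap_basis, basisBracket, smul_smul, Finset.sum_smul, rootVec_root]
  · simp [rootVec_of_ne hw]

theorem bracketMap_rootVec_of_add_eq_zero (α β : Root) (h : α.1 + β.1 = 0) :
    bracketMap R (rootVec α.1) (rootVec β.1) = -coroot α.1 := by
  rw [rootVec_root, rootVec_root, bracketMap_basis]
  simp [basisBracket, h]

theorem bracketMap_rootVec_of_add_ne_zero (α β : Root) (h : α.1 + β.1 ≠ 0) :
    bracketMap R (rootVec α.1) (rootVec β.1)
      = (sgn α.1 β.1 : R) • rootVec (α.1 + β.1) := by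
  rw [rootVec_root, rootVec_root, bracketMap_basis]
  simp [basisBracket, h]

/-- Each basis element is a coroot or a root vector. -/
theorem basis_cases (a : Fin 8 ⊕ Root) :
    (∃ v, stdBasis R a = coroot v) ∨ (∃ α : Root, stdBasis R a = rootVec α.1) := by
  rcases a with i | α
  · exact Or.inl ⟨_, (coroot_simple i).symm⟩
  · exact Or.inr ⟨α, (rootVec_root α).symm⟩

theorem sgn_add_left (u v w : RootLattice) : sgn (u + v) w = sgn u w * sgn v w := by
  simp [sgn, cocycleForm_add_left, Int.negOnePow_add]

theorem sgn_add_right (u v w : RootLattice) : sgn u (v + w) = sgn u v * sgn u w := by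
  simp [sgn, cocycleForm_add_right, Int.negOnePow_add]

theorem sgn_neg_left (v w : RootLattice) : sgn (-v) w = sgn v w := by
  simp [sgn, cocycleForm_neg_left]

theorem sgn_neg_right (v w : RootLattice) : sgn v (-w) = sgn v w := by
  simp [sgn, cocycleForm_neg_right]

theorem sgn_self (α : Root) : sgn α.1 α.1 = -1 := by
  simp [sgn, cocycleForm_self]

theorem sgn_mul_self (v w : RootLattice) : sgn v w * sgn v w = 1 := by
  rcases Int.units_eq_one_or (cocycleForm v w).negOnePow with h | h <;> simp [sgn, h]

theorem sgn_mul_swap (v w : RootLattice) :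
    sgn v w * sgn w v = ((form v w).negOnePow : ℤ) := by
  rw [← cocycleForm_add_swap, Int.negOnePow_add]; simp [sgn]

theorem sgn_swap (v w : RootLattice) :
    sgn w v = ((form v w).negOnePow : ℤ) * sgn v w := by
  rw [← sgn_mul_swap, mul_right_comm, sgn_mul_self, one_mul]

theorem bracketMap_skew_rootVec (α β : Root) :
    bracketMap R (rootVec α.1) (rootVec β.1) = -bracketMap R (rootVec β.1) (rootVec α.1) := by
  by_cases h : α.1 + β.1 = 0
  · rw [bracketMap_rootVec_of_add_eq_zero α β h,
      bracketMap_rootVec_of_add_eq_zero β α (by rwa [add_comm]),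
      eq_neg_of_add_eq_zero_right h, coroot_neg, neg_neg]
  · rw [bracketMap_rootVec_of_add_ne_zero α β h,
      bracketMap_rootVec_of_add_ne_zero β α (by rwa [add_comm]), add_comm β.1]
    by_cases h2 : form α.1 β.1 = -1
    · rw [sgn_swap α.1 β.1, h2]
      simp
    · rw [rootVec_of_ne (by rwa [Ne, root_add_iff])]
      simp

theorem bracketMap_skew (x y : LieE8 R) : bracketMap R x y = -bracketMap R y x := by
  suffices h : bracketMap R = -(bracketMap R).flip by
    conv_lhs => rw [h]
    simp
  refine (stdBasis R).ext fun a => (stdBasis R).ext fun b => ?_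
  simp only [LinearMap.neg_apply, LinearMap.flip_apply]
  rcases basis_cases (R := R) a with ⟨v, hv⟩ | ⟨α, hα⟩ <;>
    rcases basis_cases (R := R) b with ⟨w, hw⟩ | ⟨β, hβ⟩
  · rw [hv, hw, bracketMap_coroot_coroot, bracketMap_coroot_coroot, neg_zero]
  · rw [hv, hβ, bracketMap_coroot_rootVec, bracketMap_rootVec_coroot, neg_neg]
  · rw [hα, hw, bracketMap_coroot_rootVec, bracketMap_rootVec_coroot]
  · rw [hα, hβ, bracketMap_skew_rootVec]

theorem basis_induction {P : LieE8 R → Prop} (hb : ∀ a, P (stdBasis R a))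
    (hadd : ∀ x y, P x → P y → P (x + y)) (hsmul : ∀ (r : R) x, P x → P (r • x)) (x : LieE8 R) :
    P x := by
  have hx : x ∈ Submodule.span R (Set.range (stdBasis R)) := by
    rw [(stdBasis R).span_eq]; trivial
  induction hx using Submodule.span_induction with
  | mem x h => obtain ⟨a, rfl⟩ := h; exact hb a
  | zero => simpa using hsmul 0 _ (hb (Sum.inl 0))
  | add x y _ _ hx hy => exact hadd x y hx hy
  | smul r x _ hx => exact hsmul r x hx

theorem bracketMap_self (x : LieE8 R) : bracketMap R x x = 0 := by
  induction x using basis_induction with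
  | hb a =>
    rcases basis_cases (R := R) a with ⟨v, hv⟩ | ⟨α, hα⟩
    · rw [hv, bracketMap_coroot_coroot]
    · have h : α.1 + α.1 ≠ 0 := by
        rw [Ne, root_add_eq_zero_iff, α.2]; norm_num
      rw [hα, bracketMap_rootVec_of_add_ne_zero α α h, rootVec_of_ne, smul_zero]
      rw [Ne, root_add_iff, α.2]; norm_num
  | hadd x y hx hy =>
    rw [map_add, LinearMap.map_add₂, LinearMap.map_add₂, hx, hy, bracketMap_skew x y]
    simp
  | hsmul r x hx => simp [hx]

/-- The Jacobi expression. -/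
def jac (x y z : LieE8 R) : LieE8 R :=
  bracketMap R x (bracketMap R y z) + bracketMap R y (bracketMap R z x)
    + bracketMap R z (bracketMap R x y)

theorem jac_rot (x y z : LieE8 R) : jac x y z = jac y z x := by
  unfold jac; abel

theorem jac_swap (x y z : LieE8 R) : jac x y z = -jac y x z := by
  unfold jac
  rw [bracketMap_skew x y, bracketMap_skew y z, bracketMap_skew z x]
  simp only [map_neg]
  abel

theorem jac_coroot_coroot (u v w : RootLattice) :
    jac (R := R) (coroot u) (coroot v) (rootVec w) = 0 := by
  simp only [jac, bracketMap_coroot_coroot, bracketMap_coroot_rootVec, bracketMap_rootVec_coroot,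
    map_smul, map_neg, smul_smul, map_zero, mul_comm (form u w : R)]
  simp

theorem jac_coroot_rootVec (v : RootLattice) (α β : Root) :
    jac (R := R) (coroot v) (rootVec α.1) (rootVec β.1) = 0 := by
  simp only [jac, bracketMap_coroot_rootVec, bracketMap_rootVec_coroot, map_smul, map_neg]
  rw [bracketMap_skew_rootVec β α]
  by_cases h : α.1 + β.1 = 0
  · rw [bracketMap_rootVec_of_add_eq_zero α β h, eq_neg_of_add_eq_zero_right h, form_neg_right]
    simp [bracketMap_coroot_coroot]
  · rw [bracketMap_rootVec_of_add_ne_zero α β h, map_smul, bracketMap_coroot_rootVec,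
      form_add_right]
    push_cast
    module

theorem jac_opposite (α γ : Root) :
    jac (R := R) (rootVec α.1) (rootVec γ.1) (rootVec (-γ.1)) = 0 := by
  have hn : form (-γ.1) (-γ.1) = 2 := by rw [form_neg_left, form_neg_right, γ.2]; norm_num
  obtain ⟨δ, hδ⟩ : ∃ δ : Root, δ.1 = -γ.1 := ⟨⟨_, hn⟩, rfl⟩
  unfold jac
  rw [← hδ, bracketMap_rootVec_of_add_eq_zero γ δ (by rw [hδ, add_neg_cancel])]
  have lo := root_form_ge α γ
  have hi := root_form_ge α δ
  rw [hδ, form_neg_right] at hi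
  have hδα : form δ.1 α.1 = -form α.1 γ.1 := by rw [hδ, form_neg_left, form_comm]
  have hga : form γ.1 α.1 = form α.1 γ.1 := form_comm _ _
  rw [map_neg, bracketMap_rootVec_coroot, neg_neg, hga]
  have hx : form α.1 γ.1 = -2 ∨ form α.1 γ.1 = -1 ∨ form α.1 γ.1 = 0 ∨ form α.1 γ.1 = 1 ∨
    form α.1 γ.1 = 2 := by omega
  rcases hx with hx | hx | hx | hx | hx
  · have h0 := (root_add_eq_zero_iff α γ).2 hx
    have hα : α.1 = -γ.1 := eq_neg_of_add_eq_zero_left h0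
    obtain rfl : δ = α := Subtype.ext (hδ.trans hα.symm)
    rw [bracketMap_rootVec_of_add_eq_zero δ γ h0, bracketMap_self, hx, map_neg,
      bracketMap_rootVec_coroot, δ.2]
    simp
  · have h0 : α.1 + γ.1 ≠ 0 := by rw [Ne, root_add_eq_zero_iff, hx]; norm_num
    have h1 : δ.1 + α.1 ≠ 0 := by rw [Ne, root_add_eq_zero_iff, hδα, hx]; norm_num
    have h2 : form (δ.1 + α.1) (δ.1 + α.1) ≠ 2 := by rw [Ne, root_add_iff, hδα, hx]; norm_num
    have h3 : form (α.1 + γ.1) (α.1 + γ.1) = 2 := (root_add_iff α γ).2 hx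
    have h4 : δ.1 + (α.1 + γ.1) = α.1 := by rw [hδ]; abel
    rw [bracketMap_rootVec_of_add_ne_zero δ α h1, rootVec_of_ne h2,
      bracketMap_rootVec_of_add_ne_zero α γ h0, (bracketMap R (rootVec δ.1)).map_smul,
      bracketMap_rootVec_of_add_ne_zero δ ⟨_, h3⟩ (by
        change δ.1 + (α.1 + γ.1) ≠ 0
        rw [h4]; intro h; have := α.2; rw [h] at this; simp [form] at this)]
    change _ + _ + (_ : R) • (sgn δ.1 (α.1 + γ.1) : R) • rootVec (δ.1 + (α.1 + γ.1)) = 0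
    rw [h4, hx, smul_smul, ← Int.cast_mul, hδ, sgn_add_right, sgn_neg_left, sgn_neg_left,
      sgn_self, sgn_swap α.1 γ.1, hx, mul_neg_one, mul_neg, mul_left_comm, sgn_mul_self]
    simp
  · have h0 : form (α.1 + γ.1) (α.1 + γ.1) ≠ 2 := by rw [Ne, root_add_iff, hx]; norm_num
    have h1 : form (δ.1 + α.1) (δ.1 + α.1) ≠ 2 := by rw [Ne, root_add_iff, hδα, hx]; norm_num
    rw [bracketMap_rootVec_of_add_ne_zero δ α (by rw [Ne, root_add_eq_zero_iff, hδα, hx]; norm_num),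
      bracketMap_rootVec_of_add_ne_zero α γ (by rw [Ne, root_add_eq_zero_iff, hx]; norm_num),
      rootVec_of_ne h0, rootVec_of_ne h1, hx]
    simp
  · have h0 : form (α.1 + γ.1) (α.1 + γ.1) ≠ 2 := by rw [Ne, root_add_iff, hx]; norm_num
    have h1 : δ.1 + α.1 ≠ 0 := by rw [Ne, root_add_eq_zero_iff, hδα, hx]; norm_num
    have h3 : form (δ.1 + α.1) (δ.1 + α.1) = 2 := (root_add_iff δ α).2 (by rw [hδα, hx])
    have h4 : γ.1 + (δ.1 + α.1) = α.1 := by rw [hδ]; abel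
    rw [bracketMap_rootVec_of_add_ne_zero α γ (by rw [Ne, root_add_eq_zero_iff, hx]; norm_num),
      rootVec_of_ne h0, bracketMap_rootVec_of_add_ne_zero δ α h1, map_smul,
      bracketMap_rootVec_of_add_ne_zero γ ⟨_, h3⟩ (by
        change γ.1 + (δ.1 + α.1) ≠ 0
        rw [h4]; intro h; have := α.2; rw [h] at this; simp [form] at this)]
    change _ + (_ : R) • (sgn γ.1 (δ.1 + α.1) : R) • rootVec (γ.1 + (δ.1 + α.1)) + _ = 0
    rw [h4, hx, smul_smul, ← Int.cast_mul, hδ, sgn_neg_left, sgn_add_right, sgn_neg_right, sgn_self,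
      mul_left_comm, sgn_mul_self]
    simp
  · have h0 : α.1 + δ.1 = 0 := by
      rw [root_add_eq_zero_iff, form_comm, hδα, hx]
    obtain rfl : α = γ := Subtype.ext (by rw [eq_neg_of_add_eq_zero_left h0, hδ, neg_neg])
    rw [bracketMap_rootVec_of_add_eq_zero δ α (by rwa [add_comm]), bracketMap_self, hx, map_neg,
      bracketMap_rootVec_coroot, hδ, form_neg_left, α.2]
    simp

theorem bracketMap_rootVec_double (α β γ : Root) (hβγ : β.1 + γ.1 ≠ 0)
    (h : α.1 + (β.1 + γ.1) ≠ 0) :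
    bracketMap R (rootVec α.1) (bracketMap R (rootVec β.1) (rootVec γ.1)) =
      if form β.1 γ.1 = -1 then
        ((sgn β.1 γ.1 * (sgn α.1 β.1 * sgn α.1 γ.1) : ℤ) : R) • rootVec (α.1 + β.1 + γ.1)
      else 0 := by
  rw [bracketMap_rootVec_of_add_ne_zero β γ hβγ]
  split_ifs with hf
  · have h3 := (root_add_iff β γ).2 hf
    rw [map_smul, bracketMap_rootVec_of_add_ne_zero α ⟨_, h3⟩ h]
    change (_ : R) • (sgn α.1 (β.1 + γ.1) : R) • rootVec (α.1 + (β.1 + γ.1)) = _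
    rw [smul_smul, ← Int.cast_mul, sgn_add_right, ← add_assoc]
  · rw [rootVec_of_ne (v := β.1 + γ.1) (by rwa [Ne, root_add_iff]), smul_zero, map_zero]

theorem jac_sum_zero (α β γ : Root) (h : α.1 + (β.1 + γ.1) = 0) :
    jac (R := R) (rootVec α.1) (rootVec β.1) (rootVec γ.1) = 0 := by
  have key : ∀ a b c : Root, a.1 + (b.1 + c.1) = 0 →
      bracketMap R (rootVec a.1) (bracketMap R (rootVec b.1) (rootVec c.1)) =
        -((sgn b.1 c.1 : R) • coroot a.1) := by
    intro a b c h
    have hbc : b.1 + c.1 = -a.1 := eq_neg_of_add_eq_zero_right h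
    have hn : form (b.1 + c.1) (b.1 + c.1) = 2 := by
      rw [hbc, form_neg_left, form_neg_right, a.2]; norm_num
    have h0 : b.1 + c.1 ≠ 0 := by
      intro h; rw [h] at hn; simp [form] at hn
    rw [bracketMap_rootVec_of_add_ne_zero b c h0, map_smul,
      bracketMap_rootVec_of_add_eq_zero a ⟨_, hn⟩ h, smul_neg]
  unfold jac
  rw [key α β γ h, key β γ α (by rw [← h]; abel), key γ α β (by rw [← h]; abel)]
  have hγ : γ.1 = -(α.1 + β.1) := by
    rw [eq_neg_iff_add_eq_zero, ← h]; abel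
  have s1 : sgn β.1 γ.1 = -sgn β.1 α.1 := by
    rw [hγ, sgn_neg_right, sgn_add_right, sgn_self, mul_neg_one]
  have s2 : sgn γ.1 α.1 = -sgn β.1 α.1 := by
    rw [hγ, sgn_neg_left, sgn_add_left, sgn_self, neg_one_mul]
  have hf : form β.1 α.1 = -1 := by
    have h2 := γ.2
    rw [hγ, form_neg_left, form_neg_right, neg_neg] at h2
    rw [form_comm]; exact (root_add_iff α β).1 h2
  have s3 : sgn α.1 β.1 = -sgn β.1 α.1 := by
    rw [sgn_swap β.1 α.1, hf]; simp
  rw [s1, s2, s3, hγ, coroot_neg, coroot_add]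
  push_cast
  module

theorem jac_rootVec (α β γ : Root) :
    jac (R := R) (rootVec α.1) (rootVec β.1) (rootVec γ.1) = 0 := by
  by_cases h1 : β.1 + γ.1 = 0
  · rw [eq_neg_of_add_eq_zero_right h1, jac_opposite]
  by_cases h2 : γ.1 + α.1 = 0
  · rw [jac_rot, eq_neg_of_add_eq_zero_right h2, jac_opposite]
  by_cases h3 : α.1 + β.1 = 0
  · rw [jac_rot, jac_rot, eq_neg_of_add_eq_zero_right h3, jac_opposite]
  by_cases h : α.1 + (β.1 + γ.1) = 0
  · exact jac_sum_zero α β γ h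
  have e2 : β.1 + γ.1 + α.1 = α.1 + β.1 + γ.1 := by abel
  have e3 : γ.1 + α.1 + β.1 = α.1 + β.1 + γ.1 := by abel
  unfold jac
  rw [bracketMap_rootVec_double α β γ h1 h,
    bracketMap_rootVec_double β γ α h2 (by rw [← add_assoc, e2, add_assoc]; exact h),
    bracketMap_rootVec_double γ α β h3 (by rw [← add_assoc, e3, add_assoc]; exact h), e2, e3]
  by_cases hr : form (α.1 + β.1 + γ.1) (α.1 + β.1 + γ.1) = 2
  swap
  · simp [rootVec_of_ne hr]
  rw [form_add_self, form_add_self, α.2, β.2, γ.2, form_add_left] at hr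
  have l1 := root_form_ge β γ
  have l2 := root_form_ge γ α
  have l3 := root_form_ge α β
  rw [root_add_eq_zero_iff] at h1 h2 h3
  rw [form_comm α.1 γ.1] at hr
  have hcase : (form β.1 γ.1 = -1 ∧ form γ.1 α.1 = -1 ∧ form α.1 β.1 = 0) ∨
      (form β.1 γ.1 = -1 ∧ form γ.1 α.1 = 0 ∧ form α.1 β.1 = -1) ∨
      (form β.1 γ.1 = 0 ∧ form γ.1 α.1 = -1 ∧ form α.1 β.1 = -1) := by omega
  rw [sgn_swap α.1 β.1, sgn_swap β.1 γ.1, sgn_swap γ.1 α.1]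
  rcases hcase with ⟨a1, a2, a3⟩ | ⟨a1, a2, a3⟩ | ⟨a1, a2, a3⟩ <;>
  · simp only [a1, a2, a3]
    simp
    try module

theorem jac_add (x x' y z : LieE8 R) : jac (x + x') y z = jac x y z + jac x' y z := by
  simp only [jac, map_add, LinearMap.add_apply]
  abel

theorem jac_smul (r : R) (x y z : LieE8 R) : jac (r • x) y z = r • jac x y z := by
  simp only [jac, map_smul, LinearMap.smul_apply, smul_add]

theorem jac_eq_zero (x y z : LieE8 R) : jac x y z = 0 := by
  induction x using basis_induction with
  | hadd x x' hx hx' => rw [jac_add, hx, hx', add_zero]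
  | hsmul r x hx => rw [jac_smul, hx, smul_zero]
  | hb a =>
  rw [jac_rot]
  induction y using basis_induction with
  | hadd x x' hx hx' => rw [jac_add, hx, hx', add_zero]
  | hsmul r x hx => rw [jac_smul, hx, smul_zero]
  | hb b =>
  rw [jac_rot]
  induction z using basis_induction with
  | hadd x x' hx hx' => rw [jac_add, hx, hx', add_zero]
  | hsmul r x hx => rw [jac_smul, hx, smul_zero]
  | hb c =>
  rw [jac_rot]
  rcases basis_cases (R := R) a with ⟨u, hu⟩ | ⟨α, hu⟩ <;>
    rcases basis_cases (R := R) b with ⟨v, hv⟩ | ⟨β, hv⟩ <;>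
    rcases basis_cases (R := R) c with ⟨w, hw⟩ | ⟨γ, hw⟩ <;>
    rw [hu, hv, hw]
  · simp [jac, bracketMap_coroot_coroot]
  · exact jac_coroot_coroot _ _ _
  · rw [jac_rot, jac_rot, jac_coroot_coroot]
  · exact jac_coroot_rootVec _ _ _
  · rw [jac_rot, jac_coroot_coroot]
  · rw [jac_rot, jac_coroot_rootVec]
  · rw [jac_rot, jac_rot, jac_coroot_rootVec]
  · exact jac_rootVec _ _ _

instance : LieRing (LieE8 R) where
  bracket x y := bracketMap R x y
  add_lie x y z := by change bracketMap R (x + y) z = _; rw [map_add]; rfl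
  lie_add x y z := by change bracketMap R x (y + z) = _; rw [map_add]
  lie_self x := bracketMap_self x
  leibniz_lie x y z := by
    change bracketMap R x (bracketMap R y z) =
      bracketMap R (bracketMap R x y) z + bracketMap R y (bracketMap R x z)
    have h := jac_eq_zero x y z
    rw [jac, bracketMap_skew z x, bracketMap_skew z (bracketMap R x y), map_neg] at h
    rw [← sub_eq_zero, ← h]
    abel

instance : LieAlgebra R (LieE8 R) where
  lie_smul r x y := by change bracketMap R x (r • y) = _; rw [map_smul]; rfl

/-- `½ (ad e_α)²`, which is defined over every base ring: it sends `e_{-α}` to `e_α` and kills all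
other basis elements. -/
def halfAdSq (α : Root) : LieE8 R →ₗ[R] LieE8 R :=
  ((stdBasis R).coord (Sum.inr ⟨-α.1, by rw [form_neg_left, form_neg_right, α.2]; norm_num⟩)).smulRight
    (rootVec α.1)

/-- The root element `x_α(t) = exp(t ad e_α) = 1 + t ad e_α + t² (ad e_α)² / 2`. -/
def rootMap (α : Root) (t : R) : LieE8 R →ₗ[R] LieE8 R :=
  LinearMap.id + t • bracketMap R (rootVec α.1) + t ^ 2 • halfAdSq α

theorem halfAdSq_basis_neg (α δ : Root) (h : δ.1 = -α.1) :
    halfAdSq (R := R) α (rootVec δ.1) = rootVec α.1 := by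
  have : δ = ⟨-α.1, by rw [form_neg_left, form_neg_right, α.2]; norm_num⟩ := Subtype.ext h
  rw [rootVec_root δ, this]
  simp [halfAdSq]

theorem halfAdSq_basis_ne (α δ : Root) (h : δ.1 ≠ -α.1) :
    halfAdSq (R := R) α (rootVec δ.1) = 0 := by
  have h2 : δ ≠ ⟨-α.1, by rw [form_neg_left, form_neg_right, α.2]; norm_num⟩ :=
    fun e => h (congrArg Subtype.val e)
  rw [rootVec_root δ]
  simp [halfAdSq, h2]

theorem halfAdSq_rootVec (α : Root) (v : RootLattice) (h : v ≠ -α.1) :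
    halfAdSq (R := R) α (rootVec v) = 0 := by
  by_cases hv : form v v = 2
  · exact halfAdSq_basis_ne α ⟨v, hv⟩ h
  · rw [rootVec_of_ne hv, map_zero]

theorem halfAdSq_coroot (α : Root) (v : RootLattice) : halfAdSq (R := R) α (coroot v) = 0 := by
  simp [halfAdSq, coroot]

theorem ne_neg_self (α : Root) : α.1 ≠ -α.1 := by
  intro h
  have h2 := congrArg (form α.1) h
  rw [form_neg_right, α.2] at h2
  omega

theorem halfAdSq_comp_self (α : Root) (x : LieE8 R) : halfAdSq α (halfAdSq α x) = 0 := by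
  have := halfAdSq_rootVec (R := R) α α.1 (ne_neg_self α)
  simp only [halfAdSq, LinearMap.smulRight_apply] at this ⊢
  rw [map_smul, smul_assoc, this, smul_zero]

theorem bracket_halfAdSq (α : Root) (x : LieE8 R) :
    bracketMap R (rootVec α.1) (halfAdSq α x) = 0 := by
  simp only [halfAdSq, LinearMap.smulRight_apply]
  rw [map_smul, bracketMap_self, smul_zero]

theorem halfAdSq_bracket (α : Root) (x : LieE8 R) :
    halfAdSq α (bracketMap R (rootVec α.1) x) = 0 := by
  induction x using basis_induction with
  | hadd x y hx hy => rw [map_add, map_add, hx, hy, add_zero]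
  | hsmul r x hx => rw [map_smul, map_smul, hx, smul_zero]
  | hb a =>
    rcases basis_cases (R := R) a with ⟨v, hv⟩ | ⟨β, hv⟩ <;> rw [hv]
    · rw [bracketMap_rootVec_coroot, map_neg, map_smul, halfAdSq_rootVec _ _ (ne_neg_self α),
        smul_zero, neg_zero]
    · by_cases h : α.1 + β.1 = 0
      · rw [bracketMap_rootVec_of_add_eq_zero α β h, map_neg, halfAdSq_coroot, neg_zero]
      · rw [bracketMap_rootVec_of_add_ne_zero α β h, map_smul]
        by_cases h2 : form α.1 β.1 = -1
        · rw [halfAdSq_rootVec, smul_zero]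
          intro h3
          have h4 := congrArg (form α.1) h3
          rw [form_add_right, form_neg_right, α.2, h2] at h4
          omega
        · rw [rootVec_of_ne (v := α.1 + β.1) (by rwa [Ne, root_add_iff]), map_zero, smul_zero]

theorem two_smul_halfAdSq (α : Root) (x : LieE8 R) :
    bracketMap R (rootVec α.1) (bracketMap R (rootVec α.1) x) = (2 : R) • halfAdSq α x := by
  induction x using basis_induction with
  | hadd x y hx hy => rw [map_add, map_add, hx, hy, map_add, smul_add]
  | hsmul r x hx => rw [map_smul, map_smul, hx, map_smul, smul_comm]
  | hb a =>
    rcases basis_cases (R := R) a with ⟨v, hv⟩ | ⟨β, hv⟩ <;> rw [hv]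
    · rw [bracketMap_rootVec_coroot, map_neg, map_smul, bracketMap_self, halfAdSq_coroot]
      simp
    · by_cases h : α.1 + β.1 = 0
      · rw [bracketMap_rootVec_of_add_eq_zero α β h, map_neg, bracketMap_rootVec_coroot, α.2,
          halfAdSq_basis_neg α β (eq_neg_of_add_eq_zero_right h)]
        simp
      · rw [halfAdSq_basis_ne α β (fun h2 => h (by rw [h2, add_neg_cancel])),
          bracketMap_rootVec_of_add_ne_zero α β h, map_smul, smul_zero]
        by_cases h2 : form α.1 β.1 = -1
        · have h3 := (root_add_iff α β).2 h2
          have h5 : form α.1 (α.1 + β.1) = 1 := by rw [form_add_right, α.2, h2]; norm_num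
          rw [bracketMap_rootVec_of_add_ne_zero α ⟨_, h3⟩
            (by rw [Ne, root_add_eq_zero_iff, h5]; norm_num),
            rootVec_of_ne (v := α.1 + (α.1 + β.1)) (by
              have := root_add_iff α ⟨_, h3⟩
              rw [Ne, this, h5]; norm_num), smul_zero, smul_zero]
        · rw [rootVec_of_ne (v := α.1 + β.1) (by rwa [Ne, root_add_iff]), map_zero, smul_zero]

theorem rootMap_neg_apply (α : Root) (t : R) (x : LieE8 R) :
    rootMap α t (rootMap α (-t) x) = x := by
  simp only [rootMap, LinearMap.add_apply, LinearMap.id_apply, LinearMap.smul_apply, map_add,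
    map_smul, halfAdSq_comp_self, bracket_halfAdSq, halfAdSq_bracket, two_smul_halfAdSq]
  module

/-- The root element `x_α(t)` as an invertible linear map, with inverse `x_α(-t)`. -/
def rootElement (α : Root) (t : R) : LieE8 R ≃ₗ[R] LieE8 R :=
  LinearEquiv.ofLinearMap (rootMap α t) (rootMap α (-t))
    (LinearMap.ext fun x => rootMap_neg_apply α t x)
    (LinearMap.ext fun x => by simpa using rootMap_neg_apply α (-t) x)

/-- The (image under the adjoint representation of the) Chevalley group of type `E₈`, generated by
the root elements. Over an algebraically closed field these are the points of the simple algebraic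
group of type `E₈`, which is both simply connected and of adjoint type. -/
def groupE8 (R : Type*) [CommRing R] : Subgroup (LieE8 R ≃ₗ[R] LieE8 R) :=
  Subgroup.closure (Set.range fun p : Root × R => rootElement p.1 p.2)

/-- The representative `e_{α₂} + e_{α₃} + e_{α₅} + e_{α₇}` (Bourbaki numbering) of the
nilpotent orbit with label `A₁⁴`. -/
def nilpotentRep (R : Type*) [CommRing R] : LieE8 R :=
  rootVec (simpleRoot 1).1 + rootVec (simpleRoot 2).1 + rootVec (simpleRoot 4).1
    + rootVec (simpleRoot 6).1

/-- The nilpotent orbit with label `A₁⁴`. -/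
def orbitA1pow4 (R : Type*) [CommRing R] : Set (LieE8 R) :=
  {e | ∃ g ∈ groupE8 R, e = g (nilpotentRep R)}

end Algebra

/-! ### Normalisers of lines -/

section Normaliser

variable {k L : Type*} [Field k] [LieRing L] [LieAlgebra k L]

/-- The normaliser of the line `k e` in `L`. -/
def normaliser (k : Type*) {L : Type*} [Field k] [LieRing L] [LieAlgebra k L] (e : L) :
    LieSubalgebra k L :=
  (LieSubalgebra.lieSpan k L {e}).normalizer

theorem mem_lieSpan_singleton (e y : L) :
    y ∈ LieSubalgebra.lieSpan k L {e} ↔ y ∈ Submodule.span k {e} := by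
  constructor
  · intro h
    let K : LieSubalgebra k L :=
      { Submodule.span k {e} with
        lie_mem' := by
          intro a b ha hb
          obtain ⟨r, rfl⟩ := Submodule.mem_span_singleton.1 ha
          obtain ⟨t, rfl⟩ := Submodule.mem_span_singleton.1 hb
          simp }
    exact (LieSubalgebra.lieSpan_le (K := K)).2
      (Set.singleton_subset_iff.2 (Submodule.mem_span_singleton_self e)) h
  · exact fun h => LieSubalgebra.submodule_span_le_lieSpan h

theorem mem_normaliser (e y : L) :
    y ∈ normaliser k e ↔ ⁅y, e⁆ ∈ Submodule.span k {e} := by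
  unfold normaliser
  rw [LieSubalgebra.mem_normalizer_iff]
  simp only [mem_lieSpan_singleton]
  constructor
  · exact fun h => h e (Submodule.mem_span_singleton_self e)
  · intro h z hz
    obtain ⟨r, rfl⟩ := Submodule.mem_span_singleton.1 hz
    rw [lie_smul]
    exact Submodule.smul_mem _ _ h

/-- The intersection of the line `k e` with an ideal `I` of its normaliser, as an ideal of `I`. -/
def lineIdeal (e : L) (I : LieIdeal k (normaliser k e)) : LieIdeal k I where
  carrier := {y | ((y : normaliser k e) : L) ∈ Submodule.span k {e}}
  add_mem' ha hb := Submodule.add_mem (Submodule.span k {e}) ha hb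
  zero_mem' := Submodule.zero_mem (Submodule.span k {e})
  smul_mem' r y (ha : ((y : normaliser k e) : L) ∈ Submodule.span k {e}) :=
    Submodule.smul_mem (Submodule.span k {e}) r ha
  lie_mem := by
    intro a b hb
    obtain ⟨r, hr⟩ := Submodule.mem_span_singleton.1 hb
    have ha := (mem_normaliser e _).1 (a : normaliser k e).2
    change ⁅((a : normaliser k e) : L), ((b : normaliser k e) : L)⁆ ∈ Submodule.span k {e}
    rw [← hr, lie_smul]
    exact Submodule.smul_mem _ _ ha

end Normaliser

/-! ### The Hamiltonian Lie algebra in characteristic two -/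

section Hamiltonian

/-- The ideal `(x₁², …, x₈²)`, with variables indexed by `0, …, 7`. -/
def truncIdeal (k : Type*) [Field k] : Ideal (MvPolynomial (Fin 8) k) :=
  Ideal.span (Set.range fun i : Fin 8 => MvPolynomial.X i ^ 2)

/-- The truncated polynomial ring `O(8; 1) = k[x₁, …, x₈] / (x₁², …, x₈²)`. -/
abbrev TruncPoly (k : Type*) [Field k] : Type _ := MvPolynomial (Fin 8) k ⧸ truncIdeal k

/-- The Witt algebra `W(8; 1)`: the Lie algebra of all derivations `∑ fᵢ ∂ᵢ` of `O(8; 1)`. -/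
abbrev Witt (k : Type*) [Field k] : Type _ := Derivation k (TruncPoly k) (TruncPoly k)

variable (k : Type*) [Field k]

/-- The variables of the truncated polynomial ring. -/
def var (i : Fin 8) : TruncPoly k := Ideal.Quotient.mk _ (MvPolynomial.X i)

theorem witt_ext {k : Type*} [Field k] {D E : Witt k} (h : ∀ i, D (var k i) = E (var k i)) : D = E := by
  ext f
  obtain ⟨f, rfl⟩ := Ideal.Quotient.mk_surjective f
  induction f using MvPolynomial.induction_on with
  | C a =>
    have : (Ideal.Quotient.mk (truncIdeal k)) (MvPolynomial.C a) =
      algebraMap k (TruncPoly k) a := rfl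
    rw [this, Derivation.map_algebraMap, Derivation.map_algebraMap]
  | add p q hp hq => rw [map_add, map_add, map_add, hp, hq]
  | mul_X p i hp =>
    have := h i
    unfold var at this
    rw [map_mul, Derivation.leibniz, Derivation.leibniz, hp, this]

theorem witt_sum_apply {k : Type*} [Field k] (F : Fin 8 → Witt k) (f : TruncPoly k) :
    (∑ i, F i) f = ∑ i, F i f := by
  have h := map_sum (Derivation.coeFnAddMonoidHom (R := k) (A := TruncPoly k)
    (M := TruncPoly k)) F Finset.univ
  have h2 := congrFun h f
  rw [Finset.sum_apply] at h2
  exact h2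

variable [CharP k 2]

theorem pderiv_mem (i : Fin 8) (f : MvPolynomial (Fin 8) k) (hf : f ∈ truncIdeal k) :
    MvPolynomial.pderiv i f ∈ truncIdeal k := by
  unfold truncIdeal at hf
  induction hf using Submodule.span_induction with
  | mem g h =>
    obtain ⟨j, rfl⟩ := h
    have h2 : (2 : MvPolynomial (Fin 8) k) = 0 := CharTwo.two_eq_zero
    simp [Derivation.leibniz_pow, h2]
  | zero => simp
  | add f g _ _ hf hg => rw [map_add]; exact Ideal.add_mem _ hf hg
  | smul r f hf hd =>
    rw [smul_eq_mul, Derivation.leibniz, smul_eq_mul, smul_eq_mul]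
    exact Ideal.add_mem _ (Ideal.mul_mem_left _ _ hd) (Ideal.mul_mem_right _ _ hf)

/-- The partial derivative `∂ᵢ`, well defined on `O(8; 1)` since `∂ᵢ xᵢ² = 2 xᵢ = 0`. -/
def partialD (i : Fin 8) : Witt k :=
  Derivation.liftOfSurjective (f := Ideal.Quotient.mkₐ k (truncIdeal k))
    (Ideal.Quotient.mkₐ_surjective k _) (d := MvPolynomial.pderiv i)
    (fun f hf => Ideal.Quotient.eq_zero_iff_mem.2
      (pderiv_mem k i f (Ideal.Quotient.eq_zero_iff_mem.1 hf)))

theorem partialD_mk (i : Fin 8) (f : MvPolynomial (Fin 8) k) :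
    partialD k i (Ideal.Quotient.mk _ f) = Ideal.Quotient.mk _ (MvPolynomial.pderiv i f) :=
  Derivation.liftOfSurjective_apply (f := Ideal.Quotient.mkₐ k (truncIdeal k))
    (Ideal.Quotient.mkₐ_surjective k _) (d := MvPolynomial.pderiv i)
    (fun f hf => Ideal.Quotient.eq_zero_iff_mem.2
      (pderiv_mem k i f (Ideal.Quotient.eq_zero_iff_mem.1 hf))) f

theorem partialD_var (i j : Fin 8) : partialD k i (var k j) = if i = j then 1 else 0 := by
  rw [var, partialD_mk, MvPolynomial.pderiv_X]
  by_cases h : i = j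
  · subst h; simp
  · simp [h, Ne.symm h]

variable {k}

/-- Every derivation of `O(8; 1)` is `∑ fᵢ ∂ᵢ` with `fᵢ = D(xᵢ)`. -/
theorem witt_eq_sum (D : Witt k) : D = ∑ i, D (var k i) • partialD k i := by
  refine witt_ext fun j => ?_
  simp [witt_sum_apply, Derivation.smul_apply, partialD_var]

theorem witt_apply (D : Witt k) (f : TruncPoly k) :
    D f = ∑ i, D (var k i) * partialD k i f := by
  conv_lhs => rw [witt_eq_sum D, witt_sum_apply]
  simp

theorem partialD_comm (i j : Fin 8) (f : TruncPoly k) :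
    partialD k i (partialD k j f) = partialD k j (partialD k i f) := by
  have h : ⁅partialD k i, partialD k j⁆ = 0 := by
    refine witt_ext fun l => ?_
    rw [Derivation.commutator_apply, partialD_var, partialD_var]
    split_ifs <;> simp
  have h2 := congrArg (fun D : Witt k => D f) h
  simpa [Derivation.commutator_apply, sub_eq_zero] using h2

theorem partialD_witt (D : Witt k) (i : Fin 8) (f : TruncPoly k) :
    partialD k i (D f) = D (partialD k i f)
      + ∑ l, partialD k i (D (var k l)) * partialD k l f := by
  rw [witt_apply D f, map_sum, witt_apply D (partialD k i f), ← Finset.sum_add_distrib]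
  refine Finset.sum_congr rfl fun l _ => ?_
  rw [Derivation.leibniz, smul_eq_mul, smul_eq_mul, partialD_comm i l]
  ring

theorem truncPoly_neg (f : TruncPoly k) : -f = f := by
  have h2 : (2 : TruncPoly k) = 0 := by
    have := congrArg (algebraMap k (TruncPoly k)) (CharTwo.two_eq_zero (R := k))
    rwa [map_ofNat, map_zero] at this
  linear_combination (-f) * h2

/-- The Hamiltonian condition for `D = ∑ fᵢ ∂ᵢ`, i.e. `D ω_H = 0` where `ω_H = ∑ dxⱼ ∧ dx_{j'}`:
`∂ᵢ(f_{j'}) = ∂ⱼ(f_{i'})` for all `i, j`, where `j' = j + 4` modulo `8`.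
The usual signs are trivial in characteristic two. -/
def IsHamiltonian (D : Witt k) : Prop :=
  ∀ i j : Fin 8, partialD k i (D (var k (j + 4))) = partialD k j (D (var k (i + 4)))

variable (k)

/-- The Hamiltonian Lie algebra `H(8; 1)`. -/
def hamiltonian : LieSubalgebra k (Witt k) where
  carrier := {D | IsHamiltonian D}
  add_mem' ha hb i j := by
    rw [Derivation.add_apply, Derivation.add_apply, map_add, map_add, ha i j, hb i j]
  zero_mem' i j := by simp
  smul_mem' r D ha i j := by
    rw [Derivation.smul_apply, Derivation.smul_apply, Derivation.map_smul, Derivation.map_smul,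
      ha i j]
  lie_mem' := by
    intro D E hD hE i j
    have hshift : ∀ l : Fin 8, l + 4 + 4 = l := by decide
    have sumshift : ∀ F : Fin 8 → TruncPoly k, ∑ l, F (l + 4) = ∑ l, F l := fun F =>
      Equiv.sum_comp (Equiv.addRight (4 : Fin 8)) F
    have key : ∀ i j : Fin 8, ∀ A B : Witt k, IsHamiltonian B →
        ∑ l, partialD k i (A (var k l)) * partialD k l (B (var k (j + 4))) =
          ∑ l, partialD k i (A (var k l)) * partialD k j (B (var k (l + 4))) := by
      intro i j A B hB
      exact Finset.sum_congr rfl fun l _ => by rw [hB l j]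
    have swap : ∀ i j : Fin 8, ∀ A B : Witt k,
        ∑ l, partialD k i (A (var k l)) * partialD k j (B (var k (l + 4))) =
          ∑ l, partialD k j (B (var k l)) * partialD k i (A (var k (l + 4))) := by
      intro i j A B
      rw [← sumshift]
      exact Finset.sum_congr rfl fun l _ => by rw [hshift, mul_comm]
    rw [Derivation.commutator_apply, Derivation.commutator_apply, map_sub, map_sub,
      partialD_witt D i (E (var k (j + 4))), partialD_witt E i (D (var k (j + 4))),
      partialD_witt D j (E (var k (i + 4))), partialD_witt E j (D (var k (i + 4))),
      key i j D E hE, key i j E D hD, key j i D E hE, key j i E D hD,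
      swap i j D E, swap i j E D, hE i j, hD i j]
    set a := ∑ l, partialD k j (E (var k l)) * partialD k i (D (var k (l + 4)))
    set b := ∑ l, partialD k j (D (var k l)) * partialD k i (E (var k (l + 4)))
    have ha := truncPoly_neg a
    have hb := truncPoly_neg b
    linear_combination (-1 : TruncPoly k) * ha + hb

/-- The derived subalgebra `H(8; 1)^{(1)}`, as a subalgebra of `W(8; 1)`. -/
def hamiltonianDerived : LieSubalgebra k (Witt k) :=
  (LieAlgebra.derivedSeries k (hamiltonian k) 1).toLieSubalgebra.map (hamiltonian k).incl

variable {k}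

/-- `D_H(f) = ∑ⱼ ∂ⱼ(f) ∂_{j'}`; the usual signs are trivial in characteristic two. -/
def hamVec (f : TruncPoly k) : Witt k := ∑ j : Fin 8, partialD k j f • partialD k (j + 4)

variable (k)

/-- The degree five monomial `x_a x_b x_c x_d x_e`. -/
def monomial5 (a b c d e : Fin 8) : TruncPoly k :=
  var k a * var k b * var k c * var k d * var k e

/-- The Hamiltonian functions of the eight elements `v₁, …, v₈` of degree `3`; the variables
`x₁, …, x₈` have indices `0, …, 7`. The `i`-th function is `xᵢ` times the second elementary
symmetric function of the three products `xⱼ xⱼ'` not involving `xᵢ`. -/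
def quintic : Fin 8 → TruncPoly k :=
  ![monomial5 k 0 1 2 5 6 + monomial5 k 0 1 3 5 7 + monomial5 k 0 2 3 6 7,
    monomial5 k 1 0 2 4 6 + monomial5 k 1 0 3 4 7 + monomial5 k 1 2 3 6 7,
    monomial5 k 2 0 3 4 7 + monomial5 k 2 1 3 5 7 + monomial5 k 2 0 1 4 5,
    monomial5 k 3 0 1 4 5 + monomial5 k 3 1 2 5 6 + monomial5 k 3 0 2 4 6,
    monomial5 k 4 1 2 5 6 + monomial5 k 4 1 3 5 7 + monomial5 k 4 2 3 6 7,
    monomial5 k 5 0 2 4 6 + monomial5 k 5 0 3 4 7 + monomial5 k 5 2 3 6 7,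
    monomial5 k 6 0 3 4 7 + monomial5 k 6 1 3 5 7 + monomial5 k 6 0 1 4 5,
    monomial5 k 7 0 1 4 5 + monomial5 k 7 1 2 5 6 + monomial5 k 7 0 2 4 6]

/-- The subalgebra `𝓗(8; 1)` generated by `∂₁, …, ∂₈` and `vᵢ = D_H(fᵢ)`, where the
`fᵢ` are the eight quintics above. -/
def scriptH : LieSubalgebra k (Witt k) :=
  LieSubalgebra.lieSpan k (Witt k)
    (Set.range (partialD k) ∪ Set.range fun i => hamVec (quintic k i))

end Hamiltonian

end E8Char2

end

noncomputable section

namespace E8Char2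

/-! ### The root elements are automorphisms -/

section Automorphisms

/-! Root elements are Lie automorphisms, so every $e$ in the orbit is $\sigma(e_0)$ for the standard
representative $e_0$ and an automorphism $\sigma$. All statements are proved in the basis moved by
$\sigma$, where the structure constants are those of the prime field.

The four root vectors in $e_0$ commute, and in characteristic two each has square-zero adjoint
action. Hence $(\mathrm{ad}\,e)^2=0$ and $[e,\mathfrak g]$ lies in the centraliser of $e$. To an
element of $[e,\mathfrak g]$ is attached a truncated polynomial, and $D_H$ of it is a Hamiltonian
vector field (`field`). This map kills $e$. Composed with $\mathrm{ad}\,e$ it gives a linear map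
from $\mathfrak g$ to $W(8;\underline 1)$ (`symbol`) whose kernel is exactly $\mathfrak n_e$
(`mem_normaliser_iff`). Its image has dimension 119, by an explicit family `compl` and dual
functionals `complCoord`, so $\dim\mathfrak n_e=248-119$.

Sixteen elements $[e,x_i]$, $[e,y_i]$ have as functions the variables and the quintics. Let $S$ be
the subalgebra which they generate (`genAlgebra`). On $S$ the map `field` is compatible with
brackets, because the functions multiply by the Poisson bracket up to constants (`genAlgebra_spec`).
It maps $S$ onto $\mathcal H(8;\underline 1)$ with kernel $ke$. The algebra $\mathcal H(8;\underline
1)$ is graded by the degree of the function, with dimensions 8, 27, 48, 27, 8 in degrees 1 to 5, in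
total 118 (`toSubmodule_scriptH`).

The main fact about $\mathcal H(8;\underline 1)$ is that each nonzero subspace of $W(8;\underline
1)$ stable under it contains it (`scriptH_le_of_invariant`): differentiate down to a constant field,
move that to all $\partial_i$, and recover the quintics from the $\partial_i$. Simplicity is a
special case. Maximality of $\mathfrak n_e$ follows as well: the symbols of a larger subalgebra $M$
form such a subspace, so $M$ contains all elements with symbol in $\mathcal H(8;\underline 1)$, and
a bracket of two of these supplies the one missing dimension.

For the derived series, $[\mathfrak n_e,\mathfrak n_e]$ centralises $e$, brackets of the centraliser
lie in $[e,\mathfrak g]$, and brackets of $[e,\mathfrak g]$ lie in $S$. Since $S$ is perfect and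
contains $e$, the third derived subalgebra is $S$. The remaining facts are finite tables over the
field with two elements, evaluated on lists of basis numbers. -/

theorem lie_eq_bracketMap {R : Type*} [CommRing R] (x y : LieE8 R) :
    ⁅x, y⁆ = bracketMap R x y := rfl

variable {R S : Type*} [CommRing R] [CommRing S] (φ : S →+* R)

/-- The change of the coefficient ring. -/
def baseChange : LieE8 S →+ LieE8 R :=
  Finsupp.mapRange.addMonoidHom (ι := Fin 8 ⊕ Root) (φ : S →+ R)

theorem baseChange_smul (n : S) (x : LieE8 S) :
    baseChange φ (n • x) = φ n • baseChange φ x :=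
  Finsupp.ext fun i => map_mul φ n (Finsupp.toFun x i)

theorem baseChange_stdBasis (a : Fin 8 ⊕ Root) :
    baseChange φ (stdBasis S a) = stdBasis R a := by
  have h : Finsupp.mapRange φ (map_zero φ) (Finsupp.single a 1) = Finsupp.single a 1 := by
    rw [Finsupp.mapRange_single, map_one]
  exact h

theorem baseChange_rootVec (v : RootLattice) : baseChange φ (rootVec v) = rootVec v := by
  by_cases hv : form v v = 2
  · obtain ⟨β, rfl⟩ : ∃ β : Root, β.1 = v := ⟨⟨v, hv⟩, rfl⟩
    rw [rootVec_root, rootVec_root, baseChange_stdBasis]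
  · rw [rootVec_of_ne hv, rootVec_of_ne hv, map_zero]

theorem baseChange_coroot (v : RootLattice) : baseChange φ (coroot v) = coroot v := by
  simp only [coroot, map_sum, map_intCast, baseChange_smul, baseChange_stdBasis]

theorem baseChange_basisBracket (a b : Fin 8 ⊕ Root) :
    baseChange φ (basisBracket a b) = basisBracket a b := by
  rcases a with i | α <;> rcases b with j | β
  · exact map_zero _
  · simp only [basisBracket, map_intCast, baseChange_smul, baseChange_rootVec]
  · simp only [basisBracket, map_intCast, map_neg, baseChange_smul, baseChange_rootVec]
  · simp only [basisBracket]
    split_ifs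
    · rw [map_neg, baseChange_coroot]
    · rw [baseChange_smul, baseChange_rootVec, map_intCast]

theorem baseChange_lie (x y : LieE8 S) :
    baseChange φ ⁅x, y⁆ = ⁅baseChange φ x, baseChange φ y⁆ := by
  induction x using basis_induction with
  | hadd x x' hx hx' => simp only [add_lie, map_add, hx, hx']
  | hsmul r x hx => rw [smul_lie, baseChange_smul, hx, baseChange_smul, smul_lie]
  | hb a =>
  induction y using basis_induction with
  | hadd x x' hx hx' => simp only [lie_add, map_add, hx, hx']
  | hsmul r x hx => rw [lie_smul, baseChange_smul, hx, baseChange_smul, lie_smul]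
  | hb b =>
    rw [baseChange_stdBasis, baseChange_stdBasis, lie_eq_bracketMap, lie_eq_bracketMap,
      bracketMap_basis, bracketMap_basis, baseChange_basisBracket]

theorem baseChange_halfAdSq (α : Root) (x : LieE8 S) :
    baseChange φ (halfAdSq α x) = halfAdSq α (baseChange φ x) := by
  induction x using basis_induction with
  | hadd x x' hx hx' => simp only [map_add, hx, hx']
  | hsmul r x hx => rw [map_smul, baseChange_smul, hx, baseChange_smul, map_smul]
  | hb a =>
    rw [baseChange_stdBasis]
    simp only [halfAdSq, LinearMap.smulRight_apply, baseChange_smul, baseChange_rootVec,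
      Module.Basis.coord_apply, Module.Basis.repr_self, Finsupp.single_apply]
    split_ifs <;> simp

theorem smul_left_cancel_of_ne_zero [NoZeroDivisors S] {n : S} (hn : n ≠ 0) {x y : LieE8 S}
    (h : n • x = n • y) : x = y := by
  refine (stdBasis S).ext_elem fun i => ?_
  have h2 := congrArg (fun z => (stdBasis S).repr z i) h
  simp only [map_smul, Finsupp.smul_apply, smul_eq_mul] at h2
  rcases mul_eq_mul_left_iff.1 h2 with h3 | h3
  · exact h3
  · exact absurd h3 hn

/-- Twice this identity is the Leibniz rule for $(\mathrm{ad}\,e_\alpha)^2$, and 2 may be cancelled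
here. -/
theorem halfAdSq_lie_of_charZero [NoZeroDivisors S] [CharZero S] (α : Root) (x y : LieE8 S) :
    halfAdSq α ⁅x, y⁆ = ⁅halfAdSq α x, y⁆
      + ⁅⁅(rootVec α.1 : LieE8 S), x⁆, ⁅(rootVec α.1 : LieE8 S), y⁆⁆ + ⁅x, halfAdSq α y⁆ := by
  apply smul_left_cancel_of_ne_zero (two_ne_zero (α := S))
  have h : ∀ z : LieE8 S, (2 : S) • halfAdSq α z = ⁅(rootVec α.1 : LieE8 S), ⁅(rootVec α.1 : LieE8 S), z⁆⁆ :=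
    fun z => (two_smul_halfAdSq α z).symm
  rw [smul_add, smul_add, ← smul_lie, ← lie_smul (2 : S) x, h, h, h,
    leibniz_lie (rootVec α.1 : LieE8 S) x y, lie_add, leibniz_lie _ x, leibniz_lie _ _ y]
  module

/-- Applying $\mathrm{ad}\,e_\alpha$ to the preceding identity kills the left side, as
$(\mathrm{ad}\,e_\alpha)^3=0$, and leaves three times the cross term. -/
theorem halfAdSq_lie_cross_of_charZero [NoZeroDivisors S] [CharZero S] (α : Root) (x y : LieE8 S) :
    ⁅halfAdSq α x, ⁅(rootVec α.1 : LieE8 S), y⁆⁆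
      + ⁅⁅(rootVec α.1 : LieE8 S), x⁆, halfAdSq α y⁆ = 0 := by
  apply smul_left_cancel_of_ne_zero (n := (3 : S)) (by norm_num)
  have h : ∀ z : LieE8 S, ⁅(rootVec α.1 : LieE8 S), ⁅(rootVec α.1 : LieE8 S), z⁆⁆ = (2 : S) • halfAdSq α z :=
    fun z => two_smul_halfAdSq α z
  have h0 : ∀ z : LieE8 S, ⁅(rootVec α.1 : LieE8 S), halfAdSq α z⁆ = 0 := fun z => bracket_halfAdSq α z
  have key := congrArg (fun z => ⁅(rootVec α.1 : LieE8 S), z⁆) (halfAdSq_lie_of_charZero α x y)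
  simp only [lie_add, h0] at key
  rw [leibniz_lie _ (halfAdSq α x), leibniz_lie _ x, leibniz_lie _ (⁅(rootVec α.1 : LieE8 S), x⁆),
    h0, h0, h, h, zero_lie, lie_zero, smul_lie, lie_smul] at key
  rw [smul_zero, key]
  module

theorem halfAdSq_lie_halfAdSq (α : Root) (x y : LieE8 R) : ⁅halfAdSq α x, halfAdSq α y⁆ = 0 := by
  simp only [halfAdSq, LinearMap.smulRight_apply]
  rw [smul_lie, lie_smul, lie_self, smul_zero, smul_zero]

/-- Division by 2 is impossible over a general $R$. By bilinearity it suffices to treat basis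
vectors, whose identity holds over $\mathbb Z$ and survives base change. -/
theorem halfAdSq_lie (α : Root) (x y : LieE8 R) :
    halfAdSq α ⁅x, y⁆ = ⁅halfAdSq α x, y⁆ + ⁅⁅(rootVec α.1 : LieE8 R), x⁆, ⁅(rootVec α.1 : LieE8 R), y⁆⁆
      + ⁅x, halfAdSq α y⁆ := by
  induction x using basis_induction with
  | hadd x x' hx hx' => simp only [add_lie, lie_add, map_add, hx, hx']; abel
  | hsmul r x hx => simp only [smul_lie, lie_smul, map_smul, hx, smul_add]
  | hb a =>
  induction y using basis_induction with
  | hadd x x' hx hx' => simp only [lie_add, map_add, hx, hx']; abel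
  | hsmul r x hx => simp only [lie_smul, map_smul, hx, smul_add]
  | hb b =>
    have h := congrArg (baseChange (Int.castRingHom R)) (halfAdSq_lie_of_charZero α (stdBasis ℤ a) (stdBasis ℤ b))
    simpa only [map_add, baseChange_lie, baseChange_halfAdSq, baseChange_stdBasis,
      baseChange_rootVec] using h

theorem halfAdSq_lie_cross (α : Root) (x y : LieE8 R) :
    ⁅halfAdSq α x, ⁅(rootVec α.1 : LieE8 R), y⁆⁆ + ⁅⁅(rootVec α.1 : LieE8 R), x⁆, halfAdSq α y⁆ = 0 := by
  induction x using basis_induction with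
  | hadd x x' hx hx' =>
    simp only [add_lie, lie_add, map_add]
    rw [add_add_add_comm, hx, hx', add_zero]
  | hsmul r x hx => simp only [smul_lie, lie_smul, map_smul, ← smul_add, hx, smul_zero]
  | hb a =>
  induction y using basis_induction with
  | hadd x x' hx hx' =>
    simp only [lie_add, map_add]
    rw [add_add_add_comm, hx, hx', add_zero]
  | hsmul r x hx => simp only [lie_smul, map_smul, ← smul_add, hx, smul_zero]
  | hb b =>
    have h := congrArg (baseChange (Int.castRingHom R)) (halfAdSq_lie_cross_of_charZero α (stdBasis ℤ a) (stdBasis ℤ b))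
    simpa only [map_add, map_zero, baseChange_lie, baseChange_halfAdSq, baseChange_stdBasis,
      baseChange_rootVec] using h

/-- Comparison of powers of $t$: the Leibniz rule in degree 1, and the three identities for
`halfAdSq` in degrees 2, 3 and 4. -/
theorem rootMap_lie (α : Root) (t : R) (x y : LieE8 R) :
    rootMap α t ⁅x, y⁆ = ⁅rootMap α t x, rootMap α t y⁆ := by
  have h1 := halfAdSq_lie α x y
  have h2 := halfAdSq_lie_cross α x y
  have h3 := halfAdSq_lie_halfAdSq α x y
  simp only [rootMap, LinearMap.add_apply, LinearMap.id_apply, LinearMap.smul_apply,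
    ← lie_eq_bracketMap, add_lie, lie_add, smul_lie, lie_smul]
  rw [h1, h3, leibniz_lie _ x y, eq_neg_of_add_eq_zero_left h2]
  module

theorem groupE8_lie {g : LieE8 R ≃ₗ[R] LieE8 R} (hg : g ∈ groupE8 R) (x y : LieE8 R) :
    g ⁅x, y⁆ = ⁅g x, g y⁆ := by
  induction hg using Subgroup.closure_induction generalizing x y with
  | mem g h => obtain ⟨p, rfl⟩ := h; exact rootMap_lie p.1 p.2 x y
  | one => rfl
  | mul g h _ _ hg hh =>
    rw [LinearEquiv.mul_apply, LinearEquiv.mul_apply, LinearEquiv.mul_apply, hh, hg]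
  | inv g _ hg =>
    apply g.injective
    have e : ∀ z, g (g⁻¹ z) = z := g.apply_symm_apply
    rw [hg, e, e, e]

/-- The elements of the Chevalley group, as automorphisms of the Lie algebra. -/
def groupE8LieEquiv {R : Type*} [CommRing R] {g : LieE8 R ≃ₗ[R] LieE8 R} (hg : g ∈ groupE8 R) : LieE8 R ≃ₗ⁅R⁆ LieE8 R :=
  { g with map_lie' := fun {x y} => groupE8_lie hg x y }

end Automorphisms

/-! ### Sums of families over lists in characteristic two -/

section Comb

variable {V : Type*} [AddCommGroup V]

/-- The sum of the members of the family `b` listed in `l`. -/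
def comb (b : ℕ → V) (l : List ℕ) : V := (l.map b).sum

/-- The set of entries of `l` which occur an odd number of times, as a binary number. -/
def mask : List ℕ → ℕ
  | [] => 0
  | a :: l => Nat.xor (Nat.shiftLeft 1 a) (mask l)

@[simp] theorem comb_nil (b : ℕ → V) : comb b [] = 0 := rfl

@[simp] theorem comb_cons (b : ℕ → V) (a : ℕ) (l : List ℕ) : comb b (a :: l) = b a + comb b l := by
  simp [comb]

@[simp] theorem comb_append (b : ℕ → V) (l l' : List ℕ) :
    comb b (l ++ l') = comb b l + comb b l' := by
  simp [comb]

theorem comb_flatMap (b : ℕ → V) (f : ℕ → List ℕ) (l : List ℕ) :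
    comb b (l.flatMap f) = comb (fun i => comb b (f i)) l := by
  induction l with
  | nil => rfl
  | cons a l ih => simp [ih]

theorem comb_congr {b c : ℕ → V} {l : List ℕ} (h : ∀ a ∈ l, b a = c a) : comb b l = comb c l := by
  unfold comb
  rw [List.map_congr_left h]

theorem map_comb {W F : Type*} [AddCommGroup W] [FunLike F V W] [AddMonoidHomClass F V W] (f : F)
    (b : ℕ → V) (l : List ℕ) : f (comb b l) = comb (fun i => f (b i)) l := by
  simp [comb, map_list_sum, Function.comp_def]

theorem comb_mem {S : Type*} [SetLike S V] [AddSubmonoidClass S V] (s : S) (b : ℕ → V) (l : List ℕ)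
    (h : ∀ a ∈ l, b a ∈ s) : comb b l ∈ s :=
  list_sum_mem fun x hx => by
    obtain ⟨a, ha, rfl⟩ := List.mem_map.1 hx
    exact h a ha

theorem comb_eq_sum_mask (hV : ∀ x : V, x + x = 0) (b : ℕ → V) (N : ℕ) (l : List ℕ)
    (hl : ∀ a ∈ l, a < N) :
    comb b l = ∑ i ∈ Finset.range N, if (mask l).testBit i then b i else 0 := by
  induction l with
  | nil => simp [mask]
  | cons a l ih =>
    have ha : a ∈ Finset.range N := Finset.mem_range.2 (hl a List.mem_cons_self)
    have hb : ∀ i, (mask (a :: l)).testBit i = (decide (a = i) ^^ (mask l).testBit i) := by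
      intro i
      change (1 <<< a ^^^ mask l).testBit i = _
      rw [Nat.testBit_xor, Nat.one_shiftLeft, Nat.testBit_two_pow]
    rw [comb_cons, ih fun x hx => hl x (List.mem_cons_of_mem _ hx)]
    have hs : b a = ∑ i ∈ Finset.range N, if a = i then b i else 0 := by
      rw [Finset.sum_ite_eq, if_pos ha]
    rw [hs, ← Finset.sum_add_distrib]
    refine Finset.sum_congr rfl fun i _ => ?_
    rw [hb]
    by_cases h : a = i <;> cases (mask l).testBit i <;> simp [h, hV]

/-- In characteristic two only the parity of each multiplicity matters. This turns vector identities
into equalities of natural numbers which the kernel can evaluate. -/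
theorem comb_eq_of_mask (hV : ∀ x : V, x + x = 0) (b : ℕ → V) {l l' : List ℕ}
    (h : mask l = mask l') : comb b l = comb b l' := by
  have key : ∀ {a : ℕ} {l : List ℕ}, a ∈ l → a < l.sum + 1 := fun ha =>
    Nat.lt_succ_of_le (List.le_sum_of_mem ha)
  rw [comb_eq_sum_mask hV b (l.sum + l'.sum + 1) l, comb_eq_sum_mask hV b (l.sum + l'.sum + 1) l', h]
  · intro a ha; have := key ha; omega
  · intro a ha; have := key ha; omega

end Comb

/-! ### An enumeration of the roots

The roots are numbered injectively by their images under a linear map to `ℤ / 421`; the simple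
coroots get the numbers `421, …, 428`. -/

section Enumeration

/-- The codes of the roots: forty binary digits for each number below `421`, all of them zero if
no root has this number. -/
@[irreducible] def codeTable : ℕ :=
  0x7c2108421000000000000000000000842108c6110000000000842107c21083def7bdef7bdef7bdef0000000000842108461100000000008420f739ef83def73def7bdef73def00000000008420f7bdf083def7c1f07bdef7c1f07b9ad6b9ef8c6108421084610842108420f73df000000000000000000000000000000000000000000000000000841ef7bdef83dee6b9cf7bdee6b9cf7b9ac5b1ce00000000000000000000841ef73def7b9ac635cf00000000000000000000841ef7c1f0000000000000000000007b9ac5b5cf00000000008c6529ca51846529ca510000000000842329463100000000007b58b531ae7358b531ae841ee6b9cf842319463000000000000000000000000000000000000000000000000000842318c6300000000000000000000000000000008423194a31000000000000000000008ca529ca5100000000008c63294631846329463100000000007b98b531ae00000000008c6319463084631946308423084210842118c210000000000000000000008c6318c630846318c630000000000084211842108c63194a318463194a310000000000842118c611842108420f000000000000000000000000000000842108c610000000000000000000007b9cd6b9ef8c6308421084630842108421084610842107bdf000000000000000000000000000000000000000008420f7bdef000000000000000000000000000000000000000000000000008420f73def000000000000000000008ca74ace728420f7c1f083dcd6b9e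f7bdcd6b9ef00000000007b9ad635cf00000000008c653a4a5184653a4a5100000000007b9ac635ce000000000000000000008c6539ca51846539ca5100000000007b9ac5b5ce8c653a4e5284653a4e5200000000007b9ac639cf8423294630000000000000000000000000000000842329ca31000000000000000000008ca53a4a518c6529463184652946318423294a317b9ab531ae00000000008ca539ca5100000000000000000000842318c2108ca53a4e52000000000000000000008c632946308463294630842318421000000000008c6329ca31846329ca31842318c61183def7be107bdef7be108ca52946318c63294a318463294a310000000000000000000000000000007b9ce739ef8c6318c210846318c210842118c610000000000000000000007b9ce6b9ef8c63184210846318421000000000007b9ce73df08c6318c611846318c611841ef7be100000000000842107bdef00000000000000000000000000000084210841f083dce739ef7bdce739ef7b9cd635cf00000000000000000000842107c1f083dce6b9ef7bdce6b9ef00000000008ca74ace7183dce73df07bdce73df000000000008ca74b52727b9ad635ce0000000000000000000000000000007b9ad6b9cf8ca74ad2720000000000000000000083dcd635cf7bdcd635cf7b9ad639cf8ca73a4a518c653a4e5184653a4e51000000000000000000007b9ac5b1ae8ca739ca510000000000000000000000000000008ca73a4e527b9ac531ae00000000008c6529463084652946307b9ac5b5af00000000008c6529ca31846529ca31842108c2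30000000000000000000008ca53a4e518c65294a318465294a318421084230000000000000000000000000000000842108c6310000000000842318c61083def7be0f7bdef7be0f8ca5294630000000000083def842107bdef842108ca529ca31000000000000000000008420f7be1083def7c2107bdef7c2108ca5294a3100000000000000000000000000000083dee739ef7bdee739ef7b9ce73def8c6318c610846318c610841ef7be0f83dee6b9ef7bdee6b9ef0000000000841ef8421083dee73df07bdee73df0000000000000000000007b9cd635ce841ef7c210000000000000000000007b9cd6b9cf00000000008ca75b5272841ee739ef83dce73def7bdce73def7b9cd639cf00000000000000000000841ee6b9ef000000000000000000000000000000841ee73df08ca74a4a51000000000083dcd635ce7bdcd635ce8ca74ace52000000000083dcd6b9cf7bdcd6b9cf000000000000000000008ca74a4e52000000000083dcd639cf7bdcd639cf00000000008ca73a4e5100000000008c6539ca31846539ca31842118c2307b9ac5b5ae00000000000000000000842119463100000000000000000000000000000000000000000000000000842118c6310000000000000000000000000000000000000000842108c6308421083e1083df0842107bdf0842108ca539ca3100000000000000000000842107be1000000000000000000000000000000084210842118420f7be0f000000000083def739ef7bdef739ef8420f84210000000000083def7bdf07bdef7bdf0000000000000000000008420f7c210841f08421083def73df07bdef73df0000000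00008ca95b5272000000000083dee73def7bdee73def00000000007b9ce6b9cf00000000000000000000841ef739ef000000000000000000000000000000841ef7bdf000000000000000000000000000000000000000000000000000841ef73df0842329ca5194e95b52728ce95b52720000000000841ee73def000000000083dce6b9cf7bdce6b9cf00000000008ca74ace5100000000000000000000842318c230000000000000000000008ca74a4e518423194631000000000000000000008ca74ad2528c6329ca51846329ca51842318c63100000000000000000000000000000000000000000000000000842119463083e10842107be10842108ca739ca318c6318c230846318c230842118c63000000000008c6319463184631946318421194a3100000000008421083e0f00000000008c6318c631846318c631842108c2100000000000842107be0f000000000000000000008c210842100000000000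

/-- The code of the root with number `i`. -/
def code (i : ℕ) : ℕ := Nat.shiftRight codeTable (40 * i) % 1099511627776

/-- The lattice vector with a given code: its coordinates are the digits in base `32`, shifted by
`16`. -/
def decode (c : ℕ) : RootLattice := fun l => ((c / 32 ^ l.val % 32 : ℕ) : ℤ) - 16

/-- The code of a lattice vector. -/
def encode (v : RootLattice) : ℤ := ∑ l, (v l + 16) * 32 ^ l.val

/-- The linear form which numbers the roots modulo `421`. -/
def number (v : RootLattice) : ℤ :=
  85 * v 0 + 185 * v 1 + 326 * v 2 + 6 * v 3 + 341 * v 4 + 348 * v 5 + 400 * v 6 + v 7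

/-- The code of the zero vector. -/
def zeroCode : ℕ := 567489872400

theorem code_lt (i : ℕ) : code i < 1099511627776 := Nat.mod_lt _ (by norm_num)

theorem decode_bounds (c : ℕ) (l : Fin 8) : -16 ≤ decode c l ∧ decode c l ≤ 15 := by
  unfold decode
  omega

theorem encode_decode {c : ℕ} (hc : c < 1099511627776) : encode (decode c) = c := by
  simp only [encode, decode, Fin.sum_univ_eight, sub_add_cancel, Fin.coe_ofNat_eq_mod]
  norm_num
  omega

/-- The digits of $u-v-w$ have absolute value at most 30, less than the base 32, so there is no
carry and each digit vanishes in turn. -/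
theorem eq_of_encode_add {u v w : RootLattice} (hu : ∀ l, -16 ≤ u l ∧ u l ≤ 15)
    (hv : ∀ l, -7 ≤ v l ∧ v l ≤ 7) (hw : ∀ l, -7 ≤ w l ∧ w l ≤ 7)
    (h : encode u + zeroCode = encode v + encode w) : u = v + w := by
  simp only [encode, Fin.sum_univ_eight, zeroCode, Fin.coe_ofNat_eq_mod] at h
  norm_num at h
  have step : ∀ {a b : ℤ}, -30 ≤ a → a ≤ 30 → a + 32 * b = 0 → a = 0 ∧ b = 0 := by
    intro a b h1 h2 h3
    omega
  have hl : ∀ l, -30 ≤ u l - v l - w l ∧ u l - v l - w l ≤ 30 := by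
    intro l
    have := hu l; have := hv l; have := hw l
    omega
  obtain ⟨h0, h⟩ := step (a := u 0 - v 0 - w 0)
    (b := u 1 - v 1 - w 1 + 32 * (u 2 - v 2 - w 2 + 32 * (u 3 - v 3 - w 3 + 32 *
      (u 4 - v 4 - w 4 + 32 * (u 5 - v 5 - w 5 + 32 * (u 6 - v 6 - w 6 + 32 *
      (u 7 - v 7 - w 7))))))) (hl 0).1 (hl 0).2 (by linarith)
  obtain ⟨h1, h⟩ := step (hl 1).1 (hl 1).2 h
  obtain ⟨h2, h⟩ := step (hl 2).1 (hl 2).2 h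
  obtain ⟨h3, h⟩ := step (hl 3).1 (hl 3).2 h
  obtain ⟨h4, h⟩ := step (hl 4).1 (hl 4).2 h
  obtain ⟨h5, h⟩ := step (hl 5).1 (hl 5).2 h
  obtain ⟨h6, h7⟩ := step (hl 6).1 (hl 6).2 h
  funext l
  change u l = v l + w l
  fin_cases l <;> simp <;> linarith

theorem encode_zero : encode 0 = zeroCode := by
  simp [encode, Fin.sum_univ_eight, zeroCode]

theorem encode_add (v w : RootLattice) : encode (v + w) + zeroCode = encode v + encode w := by
  simp [encode, Fin.sum_univ_eight, zeroCode]
  ring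

theorem number_add (v w : RootLattice) : number (v + w) = number v + number w := by
  simp [number]
  ring

theorem form_self_eq (v : RootLattice) : form v v =
    2 * (v 0 ^ 2 + v 1 ^ 2 + v 2 ^ 2 + v 3 ^ 2 + v 4 ^ 2 + v 5 ^ 2 + v 6 ^ 2 + v 7 ^ 2
      - v 0 * v 2 - v 1 * v 3 - v 2 * v 3 - v 3 * v 4 - v 4 * v 5 - v 5 * v 6 - v 6 * v 7) := by
  simp [form, CartanMatrix.E₈, dotProduct, Matrix.mulVec, Fin.sum_univ_eight]
  ring

attribute [irreducible] code

/-- The norm is expanded as an integer polynomial, so that it can be evaluated without unfolding the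
Cartan matrix. -/
theorem codeTable_spec : ∀ i ∈ List.range 421, code i ≠ 0 →
    2 * ((decode (code i)) 0 ^ 2 + (decode (code i)) 1 ^ 2 + (decode (code i)) 2 ^ 2
      + (decode (code i)) 3 ^ 2 + (decode (code i)) 4 ^ 2 + (decode (code i)) 5 ^ 2
      + (decode (code i)) 6 ^ 2 + (decode (code i)) 7 ^ 2
      - (decode (code i)) 0 * (decode (code i)) 2 - (decode (code i)) 1 * (decode (code i)) 3
      - (decode (code i)) 2 * (decode (code i)) 3 - (decode (code i)) 3 * (decode (code i)) 4
      - (decode (code i)) 4 * (decode (code i)) 5 - (decode (code i)) 5 * (decode (code i)) 6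
      - (decode (code i)) 6 * (decode (code i)) 7) = 2 ∧
    number (decode (code i)) % 421 = i ∧
    ∀ l, -7 ≤ decode (code i) l ∧ decode (code i) l ≤ 7 := by
  decide +kernel

theorem form_code {i : ℕ} (hi : i < 421) (h : code i ≠ 0) :
    form (decode (code i)) (decode (code i)) = 2 := by
  rw [form_self_eq]
  exact (codeTable_spec i (List.mem_range.2 hi) h).1

theorem number_code {i : ℕ} (hi : i < 421) (h : code i ≠ 0) :
    number (decode (code i)) % 421 = i :=
  (codeTable_spec i (List.mem_range.2 hi) h).2.1

theorem code_bounds {i : ℕ} (hi : i < 421) (h : code i ≠ 0) (l : Fin 8) :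
    -7 ≤ decode (code i) l ∧ decode (code i) l ≤ 7 :=
  (codeTable_spec i (List.mem_range.2 hi) h).2.2 l

/-- The integers of absolute value at most `n`. -/
def intBall (n : ℕ) : List ℤ := (List.range (2 * n + 1)).map fun i : ℕ => (i : ℤ) - n

/-- The variables $a,\dots,h$ stand for the coordinates $v_3,v_4,v_5,v_6,v_7,v_2,v_0,v_1$. In this
order the partial sums of squares in `form_sq` prune the search: a root has total $60\cdot 2=120$.
-/
theorem codeTable_search : ∀ a ∈ intBall 7, ∀ b ∈ intBall 6,
    2 * a ^ 2 + 3 * (5 * b - 4 * a) ^ 2 ≤ 120 → ∀ c ∈ intBall 5,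
    2 * a ^ 2 + 3 * (5 * b - 4 * a) ^ 2 + 5 * (4 * c - 3 * b) ^ 2 ≤ 120 → ∀ d ∈ intBall 4,
    2 * a ^ 2 + 3 * (5 * b - 4 * a) ^ 2 + 5 * (4 * c - 3 * b) ^ 2 + 10 * (3 * d - 2 * c) ^ 2
      ≤ 120 → ∀ e ∈ intBall 3,
    2 * a ^ 2 + 3 * (5 * b - 4 * a) ^ 2 + 5 * (4 * c - 3 * b) ^ 2 + 10 * (3 * d - 2 * c) ^ 2
      + 30 * (2 * e - d) ^ 2 ≤ 120 → ∀ f ∈ intBall 5,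
    2 * a ^ 2 + 3 * (5 * b - 4 * a) ^ 2 + 5 * (4 * c - 3 * b) ^ 2 + 10 * (3 * d - 2 * c) ^ 2
      + 30 * (2 * e - d) ^ 2 + 10 * (3 * f - 2 * a) ^ 2 ≤ 120 → ∀ g ∈ intBall 3,
    2 * a ^ 2 + 3 * (5 * b - 4 * a) ^ 2 + 5 * (4 * c - 3 * b) ^ 2 + 10 * (3 * d - 2 * c) ^ 2
      + 30 * (2 * e - d) ^ 2 + 10 * (3 * f - 2 * a) ^ 2 + 30 * (2 * g - f) ^ 2 ≤ 120 →
    ∀ h ∈ intBall 4,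
    2 * a ^ 2 + 3 * (5 * b - 4 * a) ^ 2 + 5 * (4 * c - 3 * b) ^ 2 + 10 * (3 * d - 2 * c) ^ 2
      + 30 * (2 * e - d) ^ 2 + 10 * (3 * f - 2 * a) ^ 2 + 30 * (2 * g - f) ^ 2
      + 30 * (2 * h - a) ^ 2 = 120 →
    (code ((85 * g + 185 * h + 326 * f + 6 * a + 341 * b + 348 * c + 400 * d + e) % 421).toNat : ℤ)
      = (g + 16) + (h + 16) * 32 + (f + 16) * 1024 + (a + 16) * 32768 + (b + 16) * 1048576
        + (c + 16) * 33554432 + (d + 16) * 1073741824 + (e + 16) * 34359738368 := by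
  decide +kernel

theorem exists_code (v : RootLattice) (hv : form v v = 2) :
    ∃ i < 421, code i ≠ 0 ∧ decode (code i) = v := by
  have h := form_sq v
  rw [hv] at h
  have s1 := sq_nonneg (2 * v 1 - v 3)
  have s2 := sq_nonneg (2 * v 0 - v 2)
  have s3 := sq_nonneg (3 * v 2 - 2 * v 3)
  have s4 := sq_nonneg (2 * v 7 - v 6)
  have s5 := sq_nonneg (3 * v 6 - 2 * v 5)
  have s6 := sq_nonneg (4 * v 5 - 3 * v 4)
  have s7 := sq_nonneg (5 * v 4 - 4 * v 3)
  have s8 := sq_nonneg (v 3)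
  have key : ∀ {x : ℤ} (n : ℤ), 0 ≤ n → x ^ 2 < (n + 1) ^ 2 → -n ≤ x ∧ x ≤ n := by
    intro x n hn hx
    have h1 : |x| < |n + 1| := sq_lt_sq.1 hx
    rw [abs_of_nonneg (a := n + 1) (by positivity), abs_lt] at h1
    omega
  have yek : ∀ {x : ℤ} (n : ℕ), -(n : ℤ) ≤ x → x ≤ n → x ∈ intBall n := by
    intro x n h1 h2
    refine List.mem_map.2 ⟨(x + n).toNat, List.mem_range.2 ?_, ?_⟩ <;> omega
  -- The bounds come from the separate squares in `form_sq`; for instance $2v_3^2\le 120$ gives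
  -- $|v_3|\le 7$.
  have b3 := key (x := v 3) 7 (by norm_num) (by linarith)
  have b4 := key (x := 5 * v 4 - 4 * v 3) 6 (by norm_num) (by linarith)
  have b5 := key (x := 4 * v 5 - 3 * v 4) 4 (by norm_num) (by linarith)
  have b6 := key (x := 3 * v 6 - 2 * v 5) 3 (by norm_num) (by linarith)
  have b7 := key (x := 2 * v 7 - v 6) 2 (by norm_num) (by linarith)
  have b2 := key (x := 3 * v 2 - 2 * v 3) 3 (by norm_num) (by linarith)
  have b0 := key (x := 2 * v 0 - v 2) 2 (by norm_num) (by linarith)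
  have b1 := key (x := 2 * v 1 - v 3) 2 (by norm_num) (by linarith)
  have hb : ∀ l, -7 ≤ v l ∧ v l ≤ 7 := by
    clear h s1 s2 s3 s4 s5 s6 s7 s8 hv
    intro l
    match l with
    | 0 => omega
    | 1 => omega
    | 2 => omega
    | 3 => omega
    | 4 => omega
    | 5 => omega
    | 6 => omega
    | 7 => omega
  have hc := codeTable_search (v 3) (yek 7 (by omega) (by omega))
    (v 4) (yek 6 (by omega) (by omega)) (by linarith)
    (v 5) (yek 5 (by omega) (by omega)) (by linarith)
    (v 6) (yek 4 (by omega) (by omega)) (by linarith)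
    (v 7) (yek 3 (by omega) (by omega)) (by linarith)
    (v 2) (yek 5 (by omega) (by omega)) (by linarith)
    (v 0) (yek 3 (by omega) (by omega)) (by linarith)
    (v 1) (yek 4 (by omega) (by omega)) (by linarith)
  obtain ⟨i, hi⟩ : ∃ i, i = ((85 * v 0 + 185 * v 1 + 326 * v 2 + 6 * v 3 + 341 * v 4 + 348 * v 5 + 400 * v 6
    + v 7) % 421).toNat := ⟨_, rfl⟩
  rw [← hi] at hc
  clear h s1 s2 s3 s4 s5 s6 s7 s8 b0 b1 b2 b3 b4 b5 b6 b7
  have hlt : i < 421 := by omega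
  have hpos : code i ≠ 0 := by
    have := hb 0; have := hb 1; have := hb 2; have := hb 3
    have := hb 4; have := hb 5; have := hb 6; have := hb 7
    omega
  refine ⟨i, hlt, hpos, ?_⟩
  have h0 := eq_of_encode_add (u := decode (code i)) (v := v) (w := 0) (decode_bounds _)
    hb (by simp) (by
      rw [encode_decode (code_lt i), hc, encode_zero, add_left_inj]
      simp [encode, Fin.sum_univ_eight])
  simpa using h0

/-- The roots are in bijection with the numbers below `421` whose code does not vanish. -/
def rootEquiv : {i : Fin 421 // code i ≠ 0} ≃ Root :=
  Equiv.ofBijective (fun i => ⟨decode (code i.1), form_code i.1.2 i.2⟩) <| by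
    constructor
    · intro i j h
      have h1 := congrArg (fun v : Root => number v.1 % 421) h
      simp only [number_code i.1.2 i.2, number_code j.1.2 j.2] at h1
      exact Subtype.ext (Fin.ext (by exact_mod_cast h1))
    · intro v
      obtain ⟨i, hi, h0, h⟩ := exists_code v.1 v.2
      exact ⟨⟨⟨i, hi⟩, h0⟩, Subtype.ext h⟩

instance : Fintype Root := Fintype.ofEquiv _ rootEquiv

theorem card_root : Fintype.card Root = 240 := by
  rw [← Fintype.card_congr rootEquiv]
  decide +kernel

end Enumeration

/-! ### The Lie algebra of type `E₈` in characteristic two -/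

section CharTwoBracket

/-- The basis vector with number `i`: a root vector for `i < 421`, and the coroot of a simple root
for `421 ≤ i < 429`. -/
def numVec (k : Type*) [CommRing k] (i : ℕ) : LieE8 k :=
  if i < 421 then rootVec (decode (code i)) else coroot fun l => if l.val + 421 = i then 1 else 0

/-- The numbers of the coroots whose sum modulo two is the coroot of the root with code `c`. -/
def corootNums (c : ℕ) : List ℕ :=
  (List.range 8).flatMap fun l => bif c.testBit (5 * l) then [421 + l] else []

/-- The neighbours in the Dynkin diagram. -/
def neighbours : ℕ → List ℕ
  | 0 => [2]
  | 1 => [3]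
  | 2 => [0, 3]
  | 3 => [1, 2, 4]
  | 4 => [3, 5]
  | 5 => [4, 6]
  | 6 => [5, 7]
  | 7 => [6]
  | _ => []

/-- The pairing modulo two of the simple coroot `l` with the root with code `c`. -/
def parity (c l : ℕ) : Bool := (neighbours l).foldr (fun j b => c.testBit (5 * j) ^^ b) false

/-- The numbers of the basis vectors whose sum is the bracket modulo two of the basis vectors with
numbers `i` and `j`. -/
def numBracket (i j : ℕ) : List ℕ :=
  if i < 421 then
    if code i = 0 then [] else
    if j < 421 then
      if code j = 0 then [] else
      if code i + code j = 2 * zeroCode then corootNums (code i) else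
      if code ((i + j) % 421) + zeroCode = code i + code j then [(i + j) % 421] else []
    else if parity (code i) (j - 421) then [i] else []
  else
    if j < 421 then
      if code j = 0 then [] else
      if parity (code j) (i - 421) then [j] else []
    else []

/-- The bracket modulo two of two sums of basis vectors. -/
def listBracket (l l' : List ℕ) : List ℕ := l.flatMap fun i => l'.flatMap fun j => numBracket i j

variable {k : Type*} [Field k]

theorem numVec_of_lt {i : ℕ} (hi : i < 421) : numVec k i = rootVec (decode (code i)) := if_pos hi

theorem numVec_coroot (l : Fin 8) : numVec k (421 + l) = coroot (simpleRoot l).1 := by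
  rw [numVec, if_neg (by omega)]
  congr 1
  funext m
  by_cases h : m = l
  · simp [h, simpleRoot, add_comm]
  · rw [if_neg (by omega)]
    simp [simpleRoot, h]

theorem numVec_of_ge {i : ℕ} (hi : 429 ≤ i) : numVec k i = 0 := by
  rw [numVec, if_neg (by omega)]
  have : (fun l : Fin 8 => if l.val + 421 = i then (1 : ℤ) else 0) = 0 := by
    funext l
    exact if_neg (by omega)
  rw [this]
  simp [coroot]

/-- The code 0 decodes to the vector with all coordinates $-16$, which is not a root, so unused
numbers give the zero vector. -/
theorem numVec_of_code_eq_zero {i : ℕ} (hi : i < 421) (h : code i = 0) : numVec k i = 0 := by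
  rw [numVec_of_lt hi, h, rootVec_of_ne]
  rw [form_self_eq]
  simp [decode]

/-- The numbers of the members of the basis. -/
def basisNums : List ℕ := (List.range 429).filter fun i => decide (i < 421 → code i ≠ 0)

theorem mem_basisNums {i : ℕ} : i ∈ basisNums ↔ i < 429 ∧ (i < 421 → code i ≠ 0) := by
  rw [basisNums, List.mem_filter, List.mem_range, decide_eq_true_iff]

theorem exists_numVec (a : Fin 8 ⊕ Root) : ∃ i ∈ basisNums, numVec k i = stdBasis k a := by
  rcases a with l | α
  · exact ⟨421 + l, mem_basisNums.2 ⟨by omega, by omega⟩, by rw [numVec_coroot, coroot_simple]⟩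
  · obtain ⟨i, hi, hc, h⟩ := exists_code α.1 α.2
    exact ⟨i, mem_basisNums.2 ⟨by omega, fun _ => hc⟩, by rw [numVec_of_lt hi, h, rootVec_root]⟩

theorem numVec_eq_of_mem {i : ℕ} (h : i ∈ basisNums) :
    (∃ l : Fin 8, i = 421 + l ∧ numVec k i = stdBasis k (Sum.inl l)) ∨
      ∃ α : Root, i < 421 ∧ α.1 = decode (code i) ∧ number α.1 % 421 = i ∧
        numVec k i = stdBasis k (Sum.inr α) := by
  rw [mem_basisNums] at h
  by_cases hi : i < 421
  · exact Or.inr ⟨⟨_, form_code hi (h.2 hi)⟩, hi, rfl, number_code hi (h.2 hi), by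
      rw [numVec_of_lt hi, ← rootVec_root]⟩
  · obtain ⟨l, rfl⟩ : ∃ l : Fin 8, i = 421 + l :=
      ⟨⟨i - 421, by omega⟩, (Nat.add_sub_cancel' (not_lt.1 hi)).symm⟩
    exact Or.inl ⟨l, rfl, by rw [numVec_coroot, coroot_simple]⟩

variable [CharP k 2]

theorem lieE8_add_self (x : LieE8 k) : x + x = 0 := by
  rw [← two_smul k x, CharTwo.two_eq_zero, zero_smul]

theorem lieE8_neg (x : LieE8 k) : -x = x := neg_eq_of_add_eq_zero_left (lieE8_add_self x)

/-- The shift by 16 is even, so the parity of a coordinate is the lowest bit of its base 32 digit.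
-/
theorem cast_decode (c : ℕ) (j : Fin 8) :
    ((decode c j : ℤ) : k) = if c.testBit (5 * j) then 1 else 0 := by
  have h2 : c / 32 ^ j.val % 32 % 2 = c / 2 ^ (5 * j.val) % 2 := by
    rw [pow_mul, Nat.mod_mod_of_dvd _ (by norm_num : 2 ∣ 32)]
    norm_num
  have h16 : ((16 : ℤ) : k) = 0 := by
    have := congrArg (fun x : k => x * 8) (CharTwo.two_eq_zero (R := k))
    norm_num at this ⊢
    exact this
  rw [decode, Int.cast_sub, h16, sub_zero, Int.cast_natCast, CharP.cast_eq_mod k 2, h2,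
    Nat.testBit_eq_decide_div_mod_eq]
  rcases Nat.mod_two_eq_zero_or_one (c / 2 ^ (5 * j.val)) with h | h <;> simp [h]

theorem comb_corootNums (c : ℕ) : comb (numVec k) (corootNums c) = coroot (decode c) := by
  have h : ∀ l : Fin 8, comb (numVec k) (bif c.testBit (5 * l.val) then [421 + l.val] else []) =
      ((decode c l : ℤ) : k) • stdBasis k (Sum.inl l) := by
    intro l
    rw [cast_decode, ← coroot_simple, ← numVec_coroot]
    cases c.testBit (5 * l.val) <;> simp
  rw [coroot, Fin.sum_univ_eight, ← h, ← h, ← h, ← h, ← h, ← h, ← h, ← h]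
  simp only [corootNums, comb_flatMap]
  simp [List.range_succ, add_assoc]

theorem ite_parity (c l : ℕ) : (if parity c l then (1 : k) else 0) =
    ((neighbours l).map fun j => if c.testBit (5 * j) then (1 : k) else 0).sum := by
  unfold parity
  induction neighbours l with
  | nil => rfl
  | cons j t ih =>
    rw [List.map_cons, List.sum_cons, ← ih, List.foldr_cons]
    cases c.testBit (5 * j) <;>
      cases t.foldr (fun j b => c.testBit (5 * j) ^^ b) false <;> simp [CharTwo.add_self_eq_zero]

theorem cast_form_simpleRoot (l : Fin 8) (c : ℕ) :
    ((form (simpleRoot l).1 (decode c) : ℤ) : k) = if parity c l then 1 else 0 := by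
  have hd := fun j : Fin 8 => CharTwo.neg_eq ((decode c j : ℤ) : k)
  have h2 : (2 : k) = 0 := CharTwo.two_eq_zero
  have hc : ∀ j : Fin 8, (if c.testBit (5 * j) then (1 : k) else 0) = decode c j :=
    fun j => (cast_decode c j).symm
  rw [ite_parity]
  generalize decode c = v at *
  obtain ⟨g, hg⟩ : ∃ g : ℕ → k, g = fun j => if c.testBit (5 * j) then (1 : k) else 0 := ⟨_, rfl⟩
  have hgv : ∀ j : Fin 8, g j = v j := fun j => by rw [← hc, hg]
  rw [← hg]
  have e0 : g 0 = _ := hgv 0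
  have e1 : g 1 = _ := hgv 1
  have e2 : g 2 = _ := hgv 2
  have e3 : g 3 = _ := hgv 3
  have e4 : g 4 = _ := hgv 4
  have e5 : g 5 = _ := hgv 5
  have e6 : g 6 = _ := hgv 6
  have e7 : g 7 = _ := hgv 7
  have key : ((form (simpleRoot l).1 v : ℤ) : k) =
      ∑ j, ((CartanMatrix.E₈ l j : ℤ) : k) * (v j : k) := by
    rw [form, simpleRoot, single_dotProduct, one_mul, Matrix.mulVec, dotProduct]
    push_cast
    rfl
  rw [key, Fin.sum_univ_eight]
  fin_cases l <;> simp [CartanMatrix.E₈, neighbours, h2, hd, e0, e1, e2, e3, e4, e5, e6, e7, add_assoc]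

theorem lie_numVec_coroot (l : Fin 8) {j : ℕ} (hj : j < 421) :
    ⁅numVec k (421 + l), numVec k j⁆ =
      comb (numVec k) (if parity (code j) l then [j] else []) := by
  rw [numVec_coroot, numVec_of_lt hj, lie_eq_bracketMap, bracketMap_coroot_rootVec,
    cast_form_simpleRoot]
  cases parity (code j) l <;> simp [numVec_of_lt hj]

theorem parity_of_ge (c : ℕ) {l : ℕ} (hl : 8 ≤ l) : parity c l = false := by
  obtain ⟨m, rfl⟩ := Nat.exists_eq_add_of_le' hl
  rfl

theorem lie_numVec_of_ge {i j : ℕ} (hi : 421 ≤ i) (hj : j < 421) :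
    ⁅numVec k i, numVec k j⁆ =
      comb (numVec k) (if parity (code j) (i - 421) then [j] else []) := by
  by_cases h : i < 429
  · obtain ⟨l, rfl⟩ : ∃ l : Fin 8, i = 421 + l := ⟨⟨i - 421, by omega⟩, by simp; omega⟩
    rw [lie_numVec_coroot l hj, Nat.add_sub_cancel_left]
  · rw [numVec_of_ge (by omega), zero_lie, parity_of_ge _ (by omega)]
    rfl

theorem cast_sgn (v w : RootLattice) : ((sgn v w : ℤ) : k) = 1 := by
  rcases Int.units_eq_one_or (cocycleForm v w).negOnePow with h | h <;>
    simp [sgn, h, CharTwo.neg_eq]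

/-- All signs are 1 modulo two, and because the numbering is additive modulo 421 the only candidate
for the number of a sum of roots is `(i + j) % 421`. -/
theorem lie_numVec_root {i j : ℕ} (hi : i < 421) (hj : j < 421) (hci : code i ≠ 0)
    (hcj : code j ≠ 0) :
    ⁅numVec k i, numVec k j⁆ = comb (numVec k)
      (if code i + code j = 2 * zeroCode then corootNums (code i) else
        if code ((i + j) % 421) + zeroCode = code i + code j then [(i + j) % 421] else []) := by
  have hs : (i + j) % 421 < 421 := Nat.mod_lt _ (by norm_num)
  have ei := encode_decode (code_lt i)
  have ej := encode_decode (code_lt j)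
  obtain ⟨α, hα⟩ : ∃ α : Root, α.1 = decode (code i) := ⟨⟨_, form_code hi hci⟩, rfl⟩
  obtain ⟨β, hβ⟩ : ∃ β : Root, β.1 = decode (code j) := ⟨⟨_, form_code hj hcj⟩, rfl⟩
  rw [numVec_of_lt hi, numVec_of_lt hj, ← hα, ← hβ, lie_eq_bracketMap]
  by_cases h : α.1 + β.1 = 0
  · have hb : code i + code j = 2 * zeroCode := by
      have h1 := encode_add α.1 β.1
      rw [h, encode_zero, hα, hβ, ei, ej] at h1
      omega
    rw [if_pos hb, comb_corootNums, ← hα, bracketMap_rootVec_of_add_eq_zero α β h, lieE8_neg]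
  · have hb : code i + code j ≠ 2 * zeroCode := by
      intro h1
      refine h (eq_of_encode_add (u := 0) (by simp) (hα ▸ code_bounds hi hci)
        (hβ ▸ code_bounds hj hcj) ?_).symm
      rw [encode_zero, hα, hβ, ei, ej]
      omega
    rw [if_neg hb, bracketMap_rootVec_of_add_ne_zero α β h, cast_sgn, one_smul]
    by_cases h2 : code ((i + j) % 421) + zeroCode = code i + code j
    · have h3 : decode (code ((i + j) % 421)) = α.1 + β.1 := by
        refine eq_of_encode_add (decode_bounds _) (hα ▸ code_bounds hi hci)
          (hβ ▸ code_bounds hj hcj) ?_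
        rw [encode_decode (code_lt _), hα, hβ, ei, ej]
        exact_mod_cast h2
      rw [if_pos h2, comb_cons, comb_nil, add_zero, numVec_of_lt hs, h3]
    -- If the sum were a root, additivity would give it the number `(i + j) % 421`, and then its
    -- code would satisfy the equation excluded by `h2`.
    · rw [if_neg h2, comb_nil, rootVec_of_ne]
      intro hr
      obtain ⟨s, hs, hcs, h3⟩ := exists_code _ hr
      have h4 := number_code hs hcs
      have hni := number_code hi hci
      have hnj := number_code hj hcj
      rw [h3, number_add, hα, hβ] at h4
      have h5 : (i + j) % 421 = s := by omega
      have h6 := encode_add α.1 β.1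
      rw [← h3, encode_decode (code_lt s), hα, hβ, ei, ej] at h6
      rw [h5] at h2
      exact h2 (by exact_mod_cast h6)

theorem lie_numVec (i j : ℕ) : ⁅numVec k i, numVec k j⁆ = comb (numVec k) (numBracket i j) := by
  rw [numBracket]
  by_cases hi : i < 421
  · rw [if_pos hi]
    by_cases hci : code i = 0
    · rw [if_pos hci, numVec_of_code_eq_zero hi hci, zero_lie, comb_nil]
    rw [if_neg hci]
    by_cases hj : j < 421
    · rw [if_pos hj]
      by_cases hcj : code j = 0
      · rw [if_pos hcj, numVec_of_code_eq_zero hj hcj, lie_zero, comb_nil]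
      · rw [if_neg hcj, lie_numVec_root hi hj hci hcj]
    · rw [if_neg hj, ← lie_skew, lie_numVec_of_ge (not_lt.1 hj) hi, lieE8_neg]
  · rw [if_neg hi]
    by_cases hj : j < 421
    · rw [if_pos hj]
      by_cases hcj : code j = 0
      · rw [if_pos hcj, numVec_of_code_eq_zero hj hcj, lie_zero, comb_nil]
      · rw [if_neg hcj, lie_numVec_of_ge (not_lt.1 hi) hj]
    · rw [if_neg hj, numVec, numVec, if_neg hi, if_neg hj, comb_nil]
      exact bracketMap_coroot_coroot _ _

theorem lie_comb_numVec (l l' : List ℕ) :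
    ⁅comb (numVec k) l, comb (numVec k) l'⁆ = comb (numVec k) (listBracket l l') := by
  have h1 : ∀ x, ⁅comb (numVec k) l, x⁆ = comb (fun i => ⁅numVec k i, x⁆) l :=
    fun x => map_comb ((bracketMap k).flip x) (numVec k) l
  rw [h1, listBracket, comb_flatMap]
  refine comb_congr fun i _ => ?_
  have h2 : ⁅numVec k i, comb (numVec k) l'⁆ = comb (fun j => ⁅numVec k i, numVec k j⁆) l' :=
    map_comb (bracketMap k (numVec k i)) (numVec k) l'
  rw [h2, comb_flatMap]
  exact comb_congr fun j _ => lie_numVec i j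

end CharTwoBracket

/-! ### Truncated polynomials -/

section TruncatedPolynomials

variable (k : Type*) [Field k]

/-- The monomial whose variables are the binary digits of `S`. -/
def mono (S : ℕ) : TruncPoly k := ∏ i : Fin 8, if S.testBit i then var k i else 1

/-- The product of two monomials, as the list of its terms. -/
def mulNums (S T : ℕ) : List ℕ := if (S &&& T) % 256 = 0 then [S ||| T] else []

/-- The partial derivative of a monomial, as the list of its terms. -/
def derivNums (j S : ℕ) : List ℕ := if S.testBit j then [S ^^^ 2 ^ j] else []

/-- The partial derivative of a sum of monomials. -/
def derivList (j : ℕ) (l : List ℕ) : List ℕ := l.flatMap (derivNums j)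

/-- The Poisson bracket of two monomials, as the list of its terms. -/
def poissonNums (S T : ℕ) : List ℕ := (List.range 8).flatMap fun j =>
  if S.testBit j then if T.testBit ((j + 4) % 8) then
    mulNums (S ^^^ 2 ^ j) (T ^^^ 2 ^ ((j + 4) % 8)) else [] else []

/-- The Poisson bracket of two sums of monomials. -/
def poissonList (l l' : List ℕ) : List ℕ := l.flatMap fun S => l'.flatMap fun T => poissonNums S T

theorem var_mul_self (i : Fin 8) : var k i * var k i = 0 := by
  rw [var, ← map_mul, ← pow_two]
  exact Ideal.Quotient.eq_zero_iff_mem.2 (Ideal.subset_span ⟨i, rfl⟩)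

theorem mono_zero : mono k 0 = 1 := by simp [mono]

theorem mono_two_pow (i : Fin 8) : mono k (2 ^ i.val) = var k i := by
  rw [mono, Finset.prod_eq_single i]
  · simp
  · intro j _ hj
    rw [Nat.testBit_two_pow, if_neg]
    simpa using fun h => hj (Fin.ext h.symm)
  · simp

theorem mono_mul (S T : ℕ) : mono k S * mono k T = comb (mono k) (mulNums S T) := by
  unfold mulNums
  have hand : ∀ i : Fin 8, ((S &&& T) % 256).testBit i = (S.testBit i && T.testBit i) := by
    intro i
    rw [show 256 = 2 ^ 8 from rfl, Nat.testBit_mod_two_pow, Nat.testBit_and]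
    simp [i.2]
  split_ifs with h
  · rw [comb_cons, comb_nil, add_zero, mono, mono, mono, ← Finset.prod_mul_distrib]
    refine Finset.prod_congr rfl fun i _ => ?_
    have hi := hand i
    rw [h, Nat.zero_testBit] at hi
    rw [Nat.testBit_or]
    cases hS : S.testBit i <;> cases hT : T.testBit i <;> rw [hS, hT] at hi <;> simp at hi ⊢
  · obtain ⟨i, hi⟩ := Nat.exists_testBit_of_ne_zero h
    have hi8 : i < 8 := by
      by_contra h8
      rw [Nat.testBit_lt_two_pow (lt_of_lt_of_le (Nat.mod_lt _ (by norm_num))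
        (Nat.pow_le_pow_right (n := 2) (by norm_num) (not_lt.1 h8)))] at hi
      exact absurd hi (by simp)
    have h2 := hand ⟨i, hi8⟩
    simp only [hi, Bool.true_eq, Bool.and_eq_true] at h2
    rw [comb_nil, mono, mono, ← Finset.prod_mul_distrib]
    refine Finset.prod_eq_zero (Finset.mem_univ ⟨i, hi8⟩) ?_
    simp only [h2.1, h2.2, if_true]
    exact var_mul_self k _

variable [CharP k 2]

theorem truncPoly_add_self (f : TruncPoly k) : f + f = 0 :=
  eq_neg_iff_add_eq_zero.1 (truncPoly_neg f).symm

theorem witt_add_self (D : Witt k) : D + D = 0 := by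
  ext f
  exact truncPoly_add_self k _

theorem partialD_mono (j : Fin 8) (S : ℕ) :
    partialD k j (mono k S) = comb (mono k) (derivNums j S) := by
  -- The remaining factors do not involve $x_j$.
  have hz : partialD k j (∏ i ∈ Finset.univ.erase j, if S.testBit i then var k i else 1) = 0 := by
    refine Finset.prod_induction _ (fun f => partialD k j f = 0) ?_ ?_ ?_
    · intro f g hf hg
      rw [Derivation.leibniz, hf, hg, smul_zero, smul_zero, add_zero]
    · exact Derivation.map_one_eq_zero _
    · intro i hi
      split_ifs
      · rw [partialD_var, if_neg (Finset.ne_of_mem_erase hi).symm]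
      · exact Derivation.map_one_eq_zero _
  rw [mono, ← Finset.mul_prod_erase _ _ (Finset.mem_univ j), Derivation.leibniz, hz, smul_zero,
    zero_add, derivNums]
  split_ifs with h
  · rw [partialD_var, if_pos rfl, smul_eq_mul, mul_one, comb_cons, comb_nil, add_zero, mono,
      ← Finset.mul_prod_erase _ _ (Finset.mem_univ j), Nat.testBit_xor, h, Nat.testBit_two_pow_self]
    simp only [bne_self_eq_false, Bool.false_eq_true, if_false, one_mul]
    refine Finset.prod_congr rfl fun i hi => ?_
    rw [Nat.testBit_xor, Nat.testBit_two_pow_of_ne, Bool.xor_false]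
    exact fun h => Finset.ne_of_mem_erase hi (Fin.ext h.symm)
  · rw [Derivation.map_one_eq_zero, smul_zero, comb_nil]

theorem partialD_comb (j : Fin 8) (l : List ℕ) :
    partialD k j (comb (mono k) l) = comb (mono k) (derivList j l) := by
  rw [map_comb, derivList, comb_flatMap]
  exact comb_congr fun S _ => partialD_mono k j S

variable {k}

theorem hamVec_apply (f g : TruncPoly k) :
    hamVec f g = ∑ j, partialD k j f * partialD k (j + 4) g := by
  rw [hamVec, witt_sum_apply]
  rfl

theorem hamVec_apply_var (f : TruncPoly k) (i : Fin 8) :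
    hamVec f (var k (i + 4)) = partialD k i f := by
  rw [hamVec_apply, Finset.sum_eq_single i]
  · rw [partialD_var, if_pos rfl, mul_one]
  · intro j _ hj
    rw [partialD_var, if_neg (fun h => hj (add_right_cancel h)), mul_zero]
  · simp

theorem hamVec_comb_apply (l l' : List ℕ) :
    hamVec (comb (mono k) l) (comb (mono k) l') = comb (mono k) (poissonList l l') := by
  have h1 : ∀ j : Fin 8, ∀ S T : ℕ, partialD k j (mono k S) * partialD k (j + 4) (mono k T) =
      comb (mono k) (if S.testBit j then if T.testBit ((j.val + 4) % 8) then
        mulNums (S ^^^ 2 ^ j.val) (T ^^^ 2 ^ ((j.val + 4) % 8)) else [] else []) := by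
    intro j S T
    have hj : ((j + 4 : Fin 8) : ℕ) = (j.val + 4) % 8 := Fin.val_add j 4
    rw [partialD_mono, partialD_mono, derivNums, derivNums, hj]
    split_ifs <;> simp [mono_mul]
  have h2 : ∀ S T : ℕ, hamVec (mono k S) (mono k T) = comb (mono k) (poissonNums S T) := by
    intro S T
    rw [hamVec_apply, poissonNums, comb_flatMap, Fin.sum_univ_eight]
    simp only [h1]
    simp [List.range_succ, add_assoc]
  have h3 : ∀ g : TruncPoly k, hamVec (comb (mono k) l) g = comb (fun S => hamVec (mono k S) g) l := by
    intro g
    let φ : TruncPoly k →+ TruncPoly k :=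
      { toFun := fun f => hamVec f g
        map_zero' := by simp [hamVec_apply]
        map_add' := fun f f' => by simp [hamVec_apply, add_mul, Finset.sum_add_distrib] }
    exact map_comb φ (mono k) l
  rw [h3, poissonList, comb_flatMap]
  refine comb_congr fun S _ => ?_
  rw [map_comb, comb_flatMap]
  exact comb_congr fun T _ => h2 S T

variable (k) in
/-- The linear map `f ↦ D_H(f)`. -/
def hamMap : TruncPoly k →ₗ[k] Witt k where
  toFun := hamVec
  map_add' f g := by simp [hamVec, add_smul, Finset.sum_add_distrib]
  map_smul' r f := by simp [hamVec, Finset.smul_sum, smul_assoc]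

theorem hamMap_apply (f : TruncPoly k) : hamMap k f = hamVec f := rfl

/-- This brings the constant fields into the Poisson calculus: bracketing with them differentiates
the Hamiltonian function. -/
theorem hamVec_var (i : Fin 8) : hamVec (var k (i + 4)) = partialD k i := by
  have h8 : i + 4 + 4 = i := by
    revert i
    decide
  refine witt_ext fun j => ?_
  rw [hamVec_apply, Finset.sum_eq_single (i + 4)]
  · rw [partialD_var, if_pos rfl, one_mul, h8]
  · intro l _ hl
    rw [partialD_var, if_neg hl, zero_mul]
  · simp

/-- On a variable this is the product rule for a partial derivative of the Poisson bracket; the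
shift $j\mapsto j'$ matches the two sums and all signs disappear. -/
theorem lie_hamVec (f g : TruncPoly k) : ⁅hamVec f, hamVec g⁆ = hamVec (hamVec f g) := by
  have h8 : ∀ i : Fin 8, i + 4 + 4 = i := by decide
  refine witt_ext fun i => ?_
  rw [← h8 i, Derivation.commutator_apply, hamVec_apply_var, hamVec_apply_var, hamVec_apply_var,
    hamVec_apply f g, map_sum, sub_eq_add_neg, truncPoly_neg, hamVec_apply, hamVec_apply g,
    add_comm, ← Equiv.sum_comp (Equiv.addRight (4 : Fin 8)), ← Finset.sum_add_distrib]
  refine Finset.sum_congr rfl fun j _ => ?_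
  rw [Equiv.coe_addRight, h8, Derivation.leibniz, smul_eq_mul, smul_eq_mul,
    partialD_comm (i + 4) (j + 4), partialD_comm (i + 4) j]
  ring

theorem hamVec_mem_hamiltonian (f : TruncPoly k) : hamVec f ∈ hamiltonian k := by
  intro i j
  rw [hamVec_apply_var, hamVec_apply_var, partialD_comm]

theorem lie_mem_hamiltonianDerived {D E : Witt k} (hD : D ∈ hamiltonian k)
    (hE : E ∈ hamiltonian k) : ⁅D, E⁆ ∈ hamiltonianDerived k := by
  refine ⟨⁅(⟨D, hD⟩ : hamiltonian k), (⟨E, hE⟩ : hamiltonian k)⁆, ?_, rfl⟩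
  exact LieSubmodule.lie_mem_lie (LieSubmodule.mem_top _) (LieSubmodule.mem_top _)

/-! ### Coefficients -/

variable (k) in
/-- The value at the origin. -/
def originValue : TruncPoly k →ₐ[k] k :=
  Ideal.Quotient.liftₐ (truncIdeal k) (MvPolynomial.aeval fun _ => 0) fun f hf => by
    have h : truncIdeal k ≤ RingHom.ker (MvPolynomial.aeval (fun _ : Fin 8 => (0 : k))) := by
      refine Ideal.span_le.2 ?_
      rintro _ ⟨i, rfl⟩
      simp [RingHom.mem_ker]
    exact h hf

theorem originValue_var {k : Type*} [Field k] (i : Fin 8) : originValue k (var k i) = 0 := by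
  have : originValue k (var k i) = MvPolynomial.aeval (fun _ : Fin 8 => (0 : k)) (MvPolynomial.X i) := rfl
  rw [this, MvPolynomial.aeval_X]

variable (k) in
/-- The substitution `xᵢ = 0`. -/
def substZero (i : Fin 8) : TruncPoly k →ₐ[k] TruncPoly k :=
  AlgHom.ofLinearMap
    (LinearMap.id + (LinearMap.mulLeft k (var k i)).comp (partialD k i : TruncPoly k →ₗ[k] TruncPoly k))
    (by simp)
    (fun f g => by
      have h := var_mul_self k i
      simp only [LinearMap.add_apply, LinearMap.id_apply, LinearMap.comp_apply,
        LinearMap.mulLeft_apply, Derivation.coeFn_coe, Derivation.leibniz, smul_eq_mul]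
      linear_combination (-(partialD k i f * partialD k i g)) * h)

theorem substZero_apply (i : Fin 8) (f : TruncPoly k) :
    substZero k i f = f + var k i * partialD k i f := rfl

theorem substZero_var (i j : Fin 8) : substZero k i (var k j) = if i = j then 0 else var k j := by
  rw [substZero_apply, partialD_var]
  split_ifs with h
  · rw [h, mul_one, truncPoly_add_self]
  · rw [mul_zero, add_zero]

/-- In characteristic two the substitution $x_i=0$ is $1+x_i\partial_i$, so it fixes $f$. The
composite of all eight substitutions is evaluation at the origin. -/
theorem eq_algebraMap_of_partialD_eq_zero {f : TruncPoly k} (h : ∀ i, partialD k i f = 0) :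
    f = algebraMap k _ (originValue k f) := by
  have h1 : ((substZero k 0).comp ((substZero k 1).comp ((substZero k 2).comp ((substZero k 3).comp
      ((substZero k 4).comp ((substZero k 5).comp ((substZero k 6).comp (substZero k 7))))))))
      = (Algebra.ofId k (TruncPoly k)).comp (originValue k) := by
    refine Ideal.Quotient.algHom_ext _ (MvPolynomial.algHom_ext fun i => ?_)
    change substZero k 0 (substZero k 1 (substZero k 2 (substZero k 3 (substZero k 4 (substZero k 5
      (substZero k 6 (substZero k 7 (var k i)))))))) = algebraMap k _ (originValue k (var k i))
    rw [originValue_var, map_zero]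
    fin_cases i <;> simp [substZero_var]
  have h2 : ∀ i, substZero k i f = f := fun i => by
    rw [substZero_apply, h, mul_zero, add_zero]
  have h3 := congrArg (fun φ : TruncPoly k →ₐ[k] TruncPoly k => φ f) h1
  simpa [h2, Algebra.ofId_apply] using h3

theorem hamVec_eq_zero {f : TruncPoly k} (h : hamVec f = 0) :
    f = algebraMap k _ (originValue k f) :=
  eq_algebraMap_of_partialD_eq_zero fun i => by
    rw [← hamVec_apply_var, h]
    rfl

variable (k) in
/-- The coefficient of the monomial of degree eight. -/
def topCoeff : TruncPoly k →ₗ[k] k :=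
  (originValue k).toLinearMap ∘ₗ (partialD k 0 : TruncPoly k →ₗ[k] TruncPoly k) ∘ₗ
    (partialD k 1 : TruncPoly k →ₗ[k] TruncPoly k) ∘ₗ
    (partialD k 2 : TruncPoly k →ₗ[k] TruncPoly k) ∘ₗ
    (partialD k 3 : TruncPoly k →ₗ[k] TruncPoly k) ∘ₗ
    (partialD k 4 : TruncPoly k →ₗ[k] TruncPoly k) ∘ₗ
    (partialD k 5 : TruncPoly k →ₗ[k] TruncPoly k) ∘ₗ
    (partialD k 6 : TruncPoly k →ₗ[k] TruncPoly k) ∘ₗ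
    (partialD k 7 : TruncPoly k →ₗ[k] TruncPoly k)

theorem derivList_all : ∀ U ∈ List.range 256,
    derivList 0 (derivList 1 (derivList 2 (derivList 3 (derivList 4 (derivList 5 (derivList 6
      (derivList 7 [U]))))))) = if U = 255 then [0] else [] := by
  decide +kernel

theorem topCoeff_mono {U : ℕ} (hU : U < 256) :
    topCoeff k (mono k U) = if U = 255 then 1 else 0 := by
  have h : mono k U = comb (mono k) [U] := by rw [comb_cons, comb_nil, add_zero]
  have hd := derivList_all U (List.mem_range.2 hU)
  have e := partialD_comb k
  have e0 := e 0; have e1 := e 1; have e2 := e 2; have e3 := e 3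
  have e4 := e 4; have e5 := e 5; have e6 := e 6; have e7 := e 7
  change ∀ l, _ = comb (mono k) (derivList 0 l) at e0
  change ∀ l, _ = comb (mono k) (derivList 1 l) at e1
  change ∀ l, _ = comb (mono k) (derivList 2 l) at e2
  change ∀ l, _ = comb (mono k) (derivList 3 l) at e3
  change ∀ l, _ = comb (mono k) (derivList 4 l) at e4
  change ∀ l, _ = comb (mono k) (derivList 5 l) at e5
  change ∀ l, _ = comb (mono k) (derivList 6 l) at e6
  change ∀ l, _ = comb (mono k) (derivList 7 l) at e7
  change originValue k (partialD k 0 (partialD k 1 (partialD k 2 (partialD k 3 (partialD k 4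
    (partialD k 5 (partialD k 6 (partialD k 7 (mono k U))))))))) = _
  rw [h, e7, e6, e5, e4, e3, e2, e1, e0, hd]
  split_ifs
  · rw [comb_cons, comb_nil, add_zero, mono_zero, map_one]
  · rw [comb_nil, map_zero]

variable (k) in
/-- The coefficient of the monomial `S`. -/
def coefficient (S : ℕ) : TruncPoly k →ₗ[k] k :=
  topCoeff k ∘ₗ LinearMap.mulRight k (mono k (S ^^^ 255))

/-- The product of $x^T$ with the complementary monomial of $S$ has degree eight only for $T=S$;
otherwise it vanishes or misses a variable. -/
theorem coefficient_mono {S T : ℕ} (hS : S < 256) (hT : T < 256) :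
    coefficient k S (mono k T) = if T = S then 1 else 0 := by
  have h255 : ∀ i < 8, Nat.testBit 255 i = true := by decide
  have hlt : S ^^^ 255 < 2 ^ 8 := Nat.xor_lt_two_pow hS (by norm_num)
  have hbig : ∀ {U i : ℕ}, U < 256 → ¬ i < 8 → U.testBit i = false := fun hU hi =>
    Nat.testBit_lt_two_pow (lt_of_lt_of_le hU
      (Nat.pow_le_pow_right (n := 2) (by norm_num) (not_lt.1 hi)))
  change topCoeff k (mono k T * mono k (S ^^^ 255)) = _
  rw [mono_mul, mulNums]
  have hlt2 : T ||| (S ^^^ 255) < 2 ^ 8 := Nat.or_lt_two_pow hT hlt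
  have hmod : (T &&& (S ^^^ 255)) % 256 = T &&& (S ^^^ 255) :=
    Nat.mod_eq_of_lt (lt_of_le_of_lt Nat.and_le_left hT)
  rw [hmod]
  by_cases h : T = S
  · subst h
    have h1 : T &&& (T ^^^ 255) = 0 := Nat.eq_of_testBit_eq fun i => by
      rw [Nat.testBit_and, Nat.testBit_xor, Nat.zero_testBit]
      by_cases hi : i < 8
      · rw [h255 i hi]
        cases T.testBit i <;> rfl
      · rw [hbig hT hi]
        rfl
    have h2 : T ||| (T ^^^ 255) = 255 := Nat.eq_of_testBit_eq fun i => by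
      rw [Nat.testBit_or, Nat.testBit_xor]
      by_cases hi : i < 8
      · rw [h255 i hi]
        cases T.testBit i <;> rfl
      · rw [hbig hT hi, hbig (by norm_num) hi]
        rfl
    rw [if_pos h1, comb_cons, comb_nil, add_zero, h2, topCoeff_mono (by norm_num), if_pos rfl,
      if_pos rfl]
  · rw [if_neg h]
    split_ifs with h1
    · rw [comb_cons, comb_nil, add_zero, topCoeff_mono hlt2, if_neg]
      intro h2
      refine h (Nat.eq_of_testBit_eq fun i => ?_)
      have b1 := congrArg (fun n => Nat.testBit n i) h1
      have b2 := congrArg (fun n => Nat.testBit n i) h2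
      simp only [Nat.testBit_and, Nat.testBit_or, Nat.testBit_xor, Nat.zero_testBit] at b1 b2
      by_cases hi : i < 8
      · rw [h255 i hi] at b1 b2
        revert b1 b2
        cases T.testBit i <;> cases S.testBit i <;> simp
      · rw [hbig hT hi, hbig hS hi]
    · rw [comb_nil, map_zero]

theorem coefficient_algebraMap {S : ℕ} (hS : S < 256) (h0 : S ≠ 0) (c : k) :
    coefficient k S (algebraMap k _ c) = 0 := by
  rw [Algebra.algebraMap_eq_smul_one, map_smul, ← mono_zero, coefficient_mono hS (by norm_num),
    if_neg h0.symm, smul_zero]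

end TruncatedPolynomials

/-! ### The algebra `𝓗(8; 1)` -/

section ScriptH

/-- The terms of the quintics. -/
def quinticNums (i : ℕ) : List ℕ :=
  match i % 4 with
  | 0 => [2 ^ i ||| 2 ^ 1 ||| 2 ^ 2 ||| 2 ^ 5 ||| 2 ^ 6, 2 ^ i ||| 2 ^ 1 ||| 2 ^ 3 ||| 2 ^ 5 ||| 2 ^ 7,
      2 ^ i ||| 2 ^ 2 ||| 2 ^ 3 ||| 2 ^ 6 ||| 2 ^ 7]
  | 1 => [2 ^ i ||| 2 ^ 0 ||| 2 ^ 2 ||| 2 ^ 4 ||| 2 ^ 6, 2 ^ i ||| 2 ^ 0 ||| 2 ^ 3 ||| 2 ^ 4 ||| 2 ^ 7,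
      2 ^ i ||| 2 ^ 2 ||| 2 ^ 3 ||| 2 ^ 6 ||| 2 ^ 7]
  | 2 => [2 ^ i ||| 2 ^ 0 ||| 2 ^ 3 ||| 2 ^ 4 ||| 2 ^ 7, 2 ^ i ||| 2 ^ 1 ||| 2 ^ 3 ||| 2 ^ 5 ||| 2 ^ 7,
      2 ^ i ||| 2 ^ 0 ||| 2 ^ 1 ||| 2 ^ 4 ||| 2 ^ 5]
  | _ => [2 ^ i ||| 2 ^ 0 ||| 2 ^ 1 ||| 2 ^ 4 ||| 2 ^ 5, 2 ^ i ||| 2 ^ 1 ||| 2 ^ 2 ||| 2 ^ 5 ||| 2 ^ 6,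
      2 ^ i ||| 2 ^ 0 ||| 2 ^ 2 ||| 2 ^ 4 ||| 2 ^ 6]

variable {k : Type*} [Field k]

theorem mono_or_two_pow {S : ℕ} (i : Fin 8) (h : (S &&& 2 ^ i.val) % 256 = 0) :
    mono k (S ||| 2 ^ i.val) = mono k S * var k i := by
  rw [← mono_two_pow, mono_mul, mulNums, if_pos h, comb_cons, comb_nil, add_zero]

theorem monomial5_eq (a b c d e : Fin 8) (h : [a, b, c, d, e].Nodup) :
    monomial5 k a b c d e = mono k (2 ^ a.val ||| 2 ^ b.val ||| 2 ^ c.val ||| 2 ^ d.val ||| 2 ^ e.val) := by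
  have key : ∀ a b c d e : Fin 8, [a, b, c, d, e].Nodup →
      ((2 ^ a.val ||| 2 ^ b.val ||| 2 ^ c.val ||| 2 ^ d.val) &&& 2 ^ e.val) % 256 = 0 ∧
      ((2 ^ a.val ||| 2 ^ b.val ||| 2 ^ c.val) &&& 2 ^ d.val) % 256 = 0 ∧
      ((2 ^ a.val ||| 2 ^ b.val) &&& 2 ^ c.val) % 256 = 0 ∧
      (2 ^ a.val &&& 2 ^ b.val) % 256 = 0 := by
    have hp : ∀ i j : Fin 8, i ≠ j → (2 ^ i.val &&& 2 ^ j.val) % 256 = 0 := by decide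
    have hp' : ∀ i j : Fin 8, i ≠ j → 2 ^ i.val &&& 2 ^ j.val = 0 := by decide
    intro a b c d e h
    simp only [List.nodup_cons, List.mem_cons, List.not_mem_nil, or_false, not_or] at h
    obtain ⟨⟨h1, h2, h3, h4⟩, ⟨h5, h6, h7⟩, ⟨h8, h9⟩, h10, -⟩ := h
    simp only [Nat.and_or_distrib_right, hp' _ _ h1, hp' _ _ h2, hp' _ _ h3, hp' _ _ h4,
      hp' _ _ h5, hp' _ _ h6, hp' _ _ h7, hp' _ _ h8, hp' _ _ h9, hp' _ _ h10]
    decide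
  obtain ⟨h1, h2, h3, h4⟩ := key a b c d e h
  rw [mono_or_two_pow _ h1, mono_or_two_pow _ h2, mono_or_two_pow _ h3, mono_or_two_pow _ h4,
    mono_two_pow]
  rfl

theorem quintic_eq (i : Fin 8) : quintic k i = comb (mono k) (quinticNums i) := by
  have h3 : ∀ a b c : ℕ, comb (mono k) [a, b, c] = mono k a + mono k b + mono k c := by
    intro a b c
    simp [add_assoc]
  match i with
  | 0 =>
    change monomial5 k 0 1 2 5 6 + monomial5 k 0 1 3 5 7 + monomial5 k 0 2 3 6 7 = _
    rw [monomial5_eq _ _ _ _ _ (by decide), monomial5_eq _ _ _ _ _ (by decide), monomial5_eq _ _ _ _ _ (by decide)]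
    exact (h3 _ _ _).symm
  | 1 =>
    change monomial5 k 1 0 2 4 6 + monomial5 k 1 0 3 4 7 + monomial5 k 1 2 3 6 7 = _
    rw [monomial5_eq _ _ _ _ _ (by decide), monomial5_eq _ _ _ _ _ (by decide), monomial5_eq _ _ _ _ _ (by decide)]
    exact (h3 _ _ _).symm
  | 2 =>
    change monomial5 k 2 0 3 4 7 + monomial5 k 2 1 3 5 7 + monomial5 k 2 0 1 4 5 = _
    rw [monomial5_eq _ _ _ _ _ (by decide), monomial5_eq _ _ _ _ _ (by decide), monomial5_eq _ _ _ _ _ (by decide)]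
    exact (h3 _ _ _).symm
  | 3 =>
    change monomial5 k 3 0 1 4 5 + monomial5 k 3 1 2 5 6 + monomial5 k 3 0 2 4 6 = _
    rw [monomial5_eq _ _ _ _ _ (by decide), monomial5_eq _ _ _ _ _ (by decide), monomial5_eq _ _ _ _ _ (by decide)]
    exact (h3 _ _ _).symm
  | 4 =>
    change monomial5 k 4 1 2 5 6 + monomial5 k 4 1 3 5 7 + monomial5 k 4 2 3 6 7 = _
    rw [monomial5_eq _ _ _ _ _ (by decide), monomial5_eq _ _ _ _ _ (by decide), monomial5_eq _ _ _ _ _ (by decide)]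
    exact (h3 _ _ _).symm
  | 5 =>
    change monomial5 k 5 0 2 4 6 + monomial5 k 5 0 3 4 7 + monomial5 k 5 2 3 6 7 = _
    rw [monomial5_eq _ _ _ _ _ (by decide), monomial5_eq _ _ _ _ _ (by decide), monomial5_eq _ _ _ _ _ (by decide)]
    exact (h3 _ _ _).symm
  | 6 =>
    change monomial5 k 6 0 3 4 7 + monomial5 k 6 1 3 5 7 + monomial5 k 6 0 1 4 5 = _
    rw [monomial5_eq _ _ _ _ _ (by decide), monomial5_eq _ _ _ _ _ (by decide), monomial5_eq _ _ _ _ _ (by decide)]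
    exact (h3 _ _ _).symm
  | 7 =>
    change monomial5 k 7 0 1 4 5 + monomial5 k 7 1 2 5 6 + monomial5 k 7 0 2 4 6 = _
    rw [monomial5_eq _ _ _ _ _ (by decide), monomial5_eq _ _ _ _ _ (by decide), monomial5_eq _ _ _ _ _ (by decide)]
    exact (h3 _ _ _).symm

variable [CharP k 2]

variable (k) in
/-- The Hamiltonian vector field of a sum of monomials. -/
def hamList (l : List ℕ) : Witt k := hamVec (comb (mono k) l)

theorem hamList_eq_of_mask {l l' : List ℕ} (h : mask l = mask l') : hamList k l = hamList k l' := by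
  rw [hamList, hamList, comb_eq_of_mask (truncPoly_add_self k) _ h]

theorem lie_hamList (l l' : List ℕ) : ⁅hamList k l, hamList k l'⁆ = hamList k (poissonList l l') := by
  rw [hamList, hamList, lie_hamVec, hamVec_comb_apply]
  rfl

theorem hamList_two_pow (i : Fin 8) : hamList k [2 ^ ((i + 4 : Fin 8) : ℕ)] = partialD k i := by
  rw [hamList, comb_cons, comb_nil, add_zero, mono_two_pow, hamVec_var]

theorem lie_partialD_hamVec (i : Fin 8) (f : TruncPoly k) :
    ⁅partialD k i, hamVec f⁆ = hamVec (partialD k i f) := by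
  rw [← hamVec_var, lie_hamVec]

theorem lie_partialD_hamList (i : Fin 8) (l : List ℕ) :
    ⁅partialD k i, hamList k l⁆ = hamList k (derivList i l) := by
  rw [hamList, lie_partialD_hamVec, partialD_comb]
  rfl

theorem partialD_mem_scriptH (i : Fin 8) : partialD k i ∈ scriptH k :=
  LieSubalgebra.subset_lieSpan (Or.inl ⟨i, rfl⟩)

theorem hamList_quintic_mem_scriptH (i : Fin 8) : hamList k (quinticNums i) ∈ scriptH k := by
  rw [hamList, ← quintic_eq]
  exact LieSubalgebra.subset_lieSpan (Or.inr ⟨i, rfl⟩)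

theorem scriptH_le_iff (K : LieSubalgebra k (Witt k)) : scriptH k ≤ K ↔
    (∀ i, partialD k i ∈ K) ∧ ∀ i : Fin 8, hamList k (quinticNums i) ∈ K := by
  rw [scriptH, LieSubalgebra.lieSpan_le, Set.union_subset_iff, Set.range_subset_iff,
    Set.range_subset_iff]
  simp only [hamList, quintic_eq]
  rfl

theorem derivList_mem_scriptH {l : List ℕ} (i : Fin 8) (h : hamList k l ∈ scriptH k) :
    hamList k (derivList i l) ∈ scriptH k := by
  rw [← lie_partialD_hamList]
  exact (scriptH k).lie_mem (partialD_mem_scriptH i) h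

/-- The Hamiltonian field of $x_ix_{i'}$ fixes both $\partial_i$ and $v_i$ under the bracket, so
every generator is a commutator in $H(8;\underline 1)$. -/
theorem scriptH_le_hamiltonianDerived : scriptH k ≤ hamiltonianDerived k := by
  have h1 : ∀ i : Fin 8, mask (poissonList [2 ^ (i + 4 : Fin 8).val ||| 2 ^ i.val]
      [2 ^ (i + 4 : Fin 8).val]) = mask [2 ^ (i + 4 : Fin 8).val] := by decide +kernel
  have h2 : ∀ i : Fin 8, mask (poissonList [2 ^ (i + 4 : Fin 8).val ||| 2 ^ i.val]
      (quinticNums i)) = mask (quinticNums i) := by decide +kernel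
  refine (scriptH_le_iff _).2 ⟨fun i => ?_, fun i => ?_⟩
  · rw [← hamList_two_pow, ← hamList_eq_of_mask (h1 i), ← lie_hamList]
    exact lie_mem_hamiltonianDerived (hamVec_mem_hamiltonian _) (hamVec_mem_hamiltonian _)
  · rw [← hamList_eq_of_mask (h2 i), ← lie_hamList]
    exact lie_mem_hamiltonianDerived (hamVec_mem_hamiltonian _) (hamVec_mem_hamiltonian _)

/-- Applying $\partial_{b'}$ to the quintic $f_a$ leaves $x_ax_b$ times the sum of the two other
products $x_cx_{c'}$; then $\partial_c\partial_{c'}$ removes that factor. -/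
theorem quadratic_mem_scriptH (a b : Fin 8) (h : a.val % 4 ≠ b.val % 4) :
    hamList k [2 ^ a.val ||| 2 ^ b.val] ∈ scriptH k := by
  have key : ∀ a b : Fin 8, a.val % 4 ≠ b.val % 4 → ∃ c : Fin 8,
      mask (derivList (c + 4 : Fin 8) (derivList c (derivList (b + 4 : Fin 8) (quinticNums a)))) =
        mask [2 ^ a.val ||| 2 ^ b.val] := by decide +kernel
  obtain ⟨c, hc⟩ := key a b h
  rw [← hamList_eq_of_mask hc]
  exact derivList_mem_scriptH _ (derivList_mem_scriptH _ (derivList_mem_scriptH _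
    (hamList_quintic_mem_scriptH a)))

theorem witt_neg (D : Witt k) : -D = D := by
  ext f
  rw [Derivation.neg_apply, truncPoly_neg]

theorem witt_lie_zero {k : Type*} [Field k] (D : Witt k) : ⁅D, (0 : Witt k)⁆ = 0 :=
  map_zero (LieAlgebra.ad k (Witt k) D)

theorem witt_lie_smul {k : Type*} [Field k] (c : k) (D E : Witt k) : ⁅D, c • E⁆ = c • ⁅D, E⁆ :=
  map_smul (LieAlgebra.ad k (Witt k) D) c E

theorem witt_lie_comm (D E : Witt k) : ⁅D, E⁆ = ⁅E, D⁆ := by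
  rw [← witt_neg ⁅E, D⁆]
  ext f
  rw [Derivation.neg_apply, Derivation.commutator_apply, Derivation.commutator_apply, neg_sub]

/-- The bracket of a quadratic function with a constant vector field. -/
theorem lie_quadratic_constant (a b : Fin 8) (h : a ≠ b) (c : Fin 8 → k) :
    ⁅hamList k [2 ^ a.val ||| 2 ^ b.val], ∑ i, c i • partialD k i⁆ =
      c a • partialD k (b + 4) + c b • partialD k (a + 4) := by
  have h8 : ∀ i : Fin 8, i + 4 + 4 = i := by decide
  have key : ∀ a b i : Fin 8, a ≠ b → derivList i [2 ^ a.val ||| 2 ^ b.val] =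
      if i = a then [2 ^ b.val] else if i = b then [2 ^ a.val] else [] := by decide +kernel
  have hd : ∀ b : Fin 8, partialD k (b + 4) = hamList k [2 ^ b.val] := fun b => by
    rw [← hamList_two_pow, h8]
  have hi : ∀ i, ⁅hamList k [2 ^ a.val ||| 2 ^ b.val], c i • partialD k i⁆ =
      (if i = a then c i • partialD k (b + 4) else 0)
        + if i = b then c i • partialD k (a + 4) else 0 := by
    intro i
    rw [witt_lie_smul, witt_lie_comm, lie_partialD_hamList, key a b i h, hd, hd]
    by_cases h1 : i = a
    · have h2 : i ≠ b := fun h2 => h (h1.symm.trans h2)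
      rw [if_pos h1, if_pos h1, if_neg h2, add_zero]
    · by_cases h2 : i = b
      · rw [if_neg h1, if_pos h2, if_neg h1, if_pos h2, zero_add]
      · rw [if_neg h1, if_neg h2, if_neg h1, if_neg h2, add_zero, hamList, comb_nil, ← hamMap_apply,
          map_zero, smul_zero]
  have hs : ⁅hamList k [2 ^ a.val ||| 2 ^ b.val], ∑ i, c i • partialD k i⁆ =
      ∑ i, ⁅hamList k [2 ^ a.val ||| 2 ^ b.val], c i • partialD k i⁆ :=
    map_sum (LieAlgebra.ad k (Witt k) (hamList k [2 ^ a.val ||| 2 ^ b.val])) _ _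
  rw [hs]
  simp only [hi, Finset.sum_add_distrib, Finset.sum_ite_eq', Finset.mem_univ, if_true]

theorem lie_partialD_apply_var (i j : Fin 8) (D : Witt k) :
    ⁅partialD k i, D⁆ (var k j) = partialD k i (D (var k j)) := by
  rw [Derivation.commutator_apply, partialD_var]
  split_ifs <;> simp

/-- The square of a derivation is again a derivation in characteristic two, and this one kills the
variables. -/
theorem partialD_partialD (i : Fin 8) (f : TruncPoly k) : partialD k i (partialD k i f) = 0 := by
  let D : Witt k := Derivation.mk'
    ((partialD k i : TruncPoly k →ₗ[k] TruncPoly k) ∘ₗ (partialD k i : TruncPoly k →ₗ[k] TruncPoly k))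
    fun f g => by
      have h := truncPoly_add_self k (partialD k i f * partialD k i g)
      simp only [LinearMap.comp_apply, Derivation.coeFn_coe, Derivation.leibniz, smul_eq_mul, map_add]
      linear_combination h
  have hD : D = 0 := witt_ext fun j => by
    change partialD k i (partialD k i (var k j)) = 0
    rw [partialD_var]
    split_ifs <;> simp
  exact congrArg (fun E : Witt k => E f) hD

theorem lie_partialD_lie_partialD (i : Fin 8) (D : Witt k) :
    ⁅partialD k i, ⁅partialD k i, D⁆⁆ = 0 :=
  witt_ext fun j => by
    rw [lie_partialD_apply_var, lie_partialD_apply_var, partialD_partialD]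
    rfl

theorem lie_partialD_comm (i j : Fin 8) (D : Witt k) :
    ⁅partialD k i, ⁅partialD k j, D⁆⁆ = ⁅partialD k j, ⁅partialD k i, D⁆⁆ :=
  witt_ext fun l => by
    simp only [lie_partialD_apply_var]
    rw [partialD_comm]

/-- A nonzero subspace of `W(8; 1)` which is stable under the constant vector fields contains a
nonzero constant vector field. -/
theorem exists_constant_mem (V : Submodule k (Witt k))
    (hV : ∀ i, ∀ E ∈ V, ⁅partialD k i, E⁆ ∈ V) (hne : V ≠ ⊥) :
    ∃ c : Fin 8 → k, c ≠ 0 ∧ ∑ i, c i • partialD k i ∈ V := by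
  have key : ∀ s : Finset (Fin 8), ∃ D ∈ V, D ≠ 0 ∧ ∀ i ∈ s, ⁅partialD k i, D⁆ = 0 := by
    intro s
    induction s using Finset.induction_on with
    | empty =>
      obtain ⟨D, hD, h0⟩ := V.ne_bot_iff.1 hne
      exact ⟨D, hD, h0, by simp⟩
    | insert i s _ ih =>
      obtain ⟨D, hD, h0, hs⟩ := ih
      by_cases h : ⁅partialD k i, D⁆ = 0
      · exact ⟨D, hD, h0, (Finset.forall_mem_insert _ _ _).2 ⟨h, hs⟩⟩
      -- Replace $D$ by $[\partial_i,D]$: it is killed by $\partial_i$, because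
      -- $(\mathrm{ad}\,\partial_i)^2=0$, and still by the earlier ones, because they commute with
      -- $\partial_i$.
      · refine ⟨_, hV i D hD, h, (Finset.forall_mem_insert _ _ _).2
          ⟨lie_partialD_lie_partialD i D, fun j hj => ?_⟩⟩
        rw [lie_partialD_comm, hs j hj, witt_lie_zero]
  obtain ⟨D, hD, h0, h⟩ := key Finset.univ
  have hc : ∀ j, D (var k j) = algebraMap k _ (originValue k (D (var k j))) := fun j =>
    eq_algebraMap_of_partialD_eq_zero fun i => by
      rw [← lie_partialD_apply_var, h i (Finset.mem_univ i)]
      rfl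
  have hsum : D = ∑ i, originValue k (D (var k i)) • partialD k i := by
    conv_lhs => rw [witt_eq_sum D]
    refine Finset.sum_congr rfl fun i _ => ?_
    conv_lhs => rw [hc i]
    exact algebraMap_smul _ _ _
  refine ⟨fun i => originValue k (D (var k i)), fun hz => h0 ?_, hsum ▸ hD⟩
  rw [hsum]
  exact Finset.sum_eq_zero fun i _ => by rw [congrFun hz i, Pi.zero_apply, zero_smul]

theorem partialD_mem_of_invariant (V : Submodule k (Witt k))
    (hV : ∀ D ∈ scriptH k, ∀ E ∈ V, ⁅D, E⁆ ∈ V) (hne : V ≠ ⊥) (i : Fin 8) : partialD k i ∈ V := by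
  obtain ⟨c, hc, hcV⟩ := exists_constant_mem V (fun i => hV _ (partialD_mem_scriptH i)) hne
  obtain ⟨p, hp⟩ := Function.ne_iff.1 hc
  have hsingle : ∀ (a : Fin 8) (r : k), ∑ i, (Pi.single a r : Fin 8 → k) i • partialD k i =
      r • partialD k a := by
    intro a r
    rw [Finset.sum_eq_single a]
    · rw [Pi.single_eq_same]
    · intro j _ hj
      rw [Pi.single_eq_of_ne hj, zero_smul]
    · simp
  -- The quadratic $x_ax_{b'}$ carries $\partial_a$ to $\partial_b$.
  have step : ∀ a b : Fin 8, a.val % 4 ≠ b.val % 4 → partialD k a ∈ V → partialD k b ∈ V := by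
    have fin : ∀ a b : Fin 8, a.val % 4 ≠ b.val % 4 →
        a.val % 4 ≠ (b + 4).val % 4 ∧ a ≠ b + 4 ∧ b + 4 + 4 = b := by decide
    intro a b h ha
    obtain ⟨hmod, hab, hb⟩ := fin a b h
    have h1 := hV _ (quadratic_mem_scriptH a (b + 4) hmod) _ ha
    have h2 := lie_quadratic_constant (k := k) a (b + 4) hab (Pi.single a 1)
    rw [hsingle, one_smul, Pi.single_eq_same, Pi.single_eq_of_ne hab.symm, one_smul, zero_smul, add_zero,
      hb] at h2
    rwa [h2] at h1
  -- Bracketing with $x_px_q$ leaves $c_p\partial_{q'}+c_q\partial_{p'}$. Then $x_{q'}x_s$ with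
  -- $s\ne p'$ kills the second term and leaves $c_p\partial_{s'}$, with $c_p\ne 0$.
  have hsome : ∃ a, partialD k a ∈ V := by
    have fin : ∀ p : Fin 8, ∃ q s : Fin 8, p.val % 4 ≠ q.val % 4 ∧
        (q + 4).val % 4 ≠ s.val % 4 ∧ p + 4 ≠ s := by decide
    obtain ⟨q, s, hpq, hqs, n4⟩ := fin p
    have n1 : p ≠ q := fun h => hpq (by rw [h])
    have n2 : q + 4 ≠ s := fun h => hqs (by rw [h])
    have n3 : p + 4 ≠ q + 4 := fun h => n1 (add_right_cancel h)
    have h1 := hV _ (quadratic_mem_scriptH p q hpq) _ hcV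
    have e : ∑ i, (Pi.single (q + 4) (c p) + Pi.single (p + 4) (c q) : Fin 8 → k) i • partialD k i =
        c p • partialD k (q + 4) + c q • partialD k (p + 4) := by
      simp only [Pi.add_apply, add_smul, Finset.sum_add_distrib, hsingle]
    rw [lie_quadratic_constant p q n1, ← e] at h1
    have h2 := hV _ (quadratic_mem_scriptH (q + 4) s hqs) _ h1
    rw [lie_quadratic_constant _ _ n2] at h2
    simp only [Pi.add_apply, Pi.single_eq_same, Pi.single_eq_of_ne n3.symm,
      Pi.single_eq_of_ne n2.symm, Pi.single_eq_of_ne n4.symm, add_zero, zero_smul] at h2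
    exact ⟨_, (V.smul_mem_iff hp).1 h2⟩
  obtain ⟨a, ha⟩ := hsome
  have fin : ∀ a i : Fin 8, ∃ b : Fin 8, a.val % 4 ≠ b.val % 4 ∧ b.val % 4 ≠ i.val % 4 := by decide
  obtain ⟨b, hab, hbi⟩ := fin a i
  exact step b i hbi (step a b hab ha)

/-- A nonzero subspace of `W(8; 1)` which is stable under `𝓗(8; 1)` contains `𝓗(8; 1)`. -/
theorem scriptH_le_of_invariant (V : Submodule k (Witt k))
    (hV : ∀ D ∈ scriptH k, ∀ E ∈ V, ⁅D, E⁆ ∈ V) (hne : V ≠ ⊥) {D : Witt k} (hD : D ∈ scriptH k) :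
    D ∈ V := by
  have hd := partialD_mem_of_invariant V hV hne
  -- The intersection of $V$ with $\mathcal H(8;\underline 1)$ is a subalgebra, so only the
  -- generators have to be found in it.
  let K : LieSubalgebra k (Witt k) :=
    { V ⊓ (scriptH k).toSubmodule with
      lie_mem' := fun {x y} hx hy => ⟨hV x hx.2 y hy.1, (scriptH k).lie_mem hx.2 hy.2⟩ }
  have hderiv : ∀ (i : Fin 8) (l : List ℕ), hamList k l ∈ scriptH k → hamList k (derivList i l) ∈ V := by
    intro i l hl
    rw [← lie_partialD_hamList, witt_lie_comm]
    exact hV _ hl _ (hd i)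
  -- Differentiating the quintic $f_c$ by $x_c,x_d,x_{d'}$ gives a sum of two products $x_ax_{a'}$;
  -- a suitable one fixes $f_i$ under the Poisson bracket. Its field is a bracket with some
  -- $\partial_m$, hence already in $V$.
  have key : ∀ i : Fin 8, ∃ c d : Fin 8, mask (poissonList (quinticNums i)
      (derivList (d + 4 : Fin 8) (derivList d (derivList c (quinticNums c))))) =
        mask (quinticNums i) := by decide +kernel
  have hK : scriptH k ≤ K := by
    refine (scriptH_le_iff K).2 ⟨fun i => ⟨hd i, partialD_mem_scriptH i⟩, fun i => ⟨?_,
      hamList_quintic_mem_scriptH i⟩⟩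
    obtain ⟨c, d, h⟩ := key i
    rw [← hamList_eq_of_mask h, ← lie_hamList]
    exact hV _ (hamList_quintic_mem_scriptH i) _ (hderiv _ _ (derivList_mem_scriptH _
      (derivList_mem_scriptH _ (hamList_quintic_mem_scriptH c))))
  exact (hK hD).1

theorem isSimple_scriptH : LieAlgebra.IsSimple k (scriptH k) where
  eq_bot_or_eq_top I := by
    by_contra! h
    refine h.2 (eq_top_iff.2 fun x _ => ?_)
    let V : Submodule k (Witt k) := (I : Submodule k (scriptH k)).map (scriptH k).toSubmodule.subtype
    have hV : ∀ D ∈ scriptH k, ∀ E ∈ V, ⁅D, E⁆ ∈ V := by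
      rintro D hD _ ⟨y, hy, rfl⟩
      exact ⟨⁅(⟨D, hD⟩ : scriptH k), y⁆, LieSubmodule.lie_mem I hy, rfl⟩
    have hne : V ≠ ⊥ := by
      refine fun hb => h.1 ((LieSubmodule.eq_bot_iff I).2 fun y hy => Subtype.ext ?_)
      exact (Submodule.eq_bot_iff V).1 hb y ⟨y, hy, rfl⟩
    obtain ⟨y, hy, hyx⟩ := scriptH_le_of_invariant V hV hne x.2
    rwa [← show y = x from Subtype.ext hyx]
  non_abelian := fun h => by
    have h1 := hamList_quintic_mem_scriptH (k := k) 0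
    -- With variables indexed from 0, the bracket of $\partial_1$ with the field of $x_1x_2$ is
    -- $\partial_6\ne 0$.
    have h0 := h.trivial ⟨_, partialD_mem_scriptH (k := k) 1⟩ ⟨_, quadratic_mem_scriptH 1 2 (by decide)⟩
    have h2 : ⁅partialD k 1, hamList k [2 ^ (1 : Fin 8).val ||| 2 ^ (2 : Fin 8).val]⁆ = 0 :=
      congrArg Subtype.val h0
    have h3 : derivList (1 : Fin 8) [2 ^ (1 : Fin 8).val ||| 2 ^ (2 : Fin 8).val] =
        [2 ^ ((6 + 4 : Fin 8) : ℕ)] := by decide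
    rw [lie_partialD_hamList, h3, hamList_two_pow] at h2
    have h4 := partialD_var k 6 6
    rw [h2, if_pos rfl] at h4
    have h5 := congrArg (originValue k) h4
    rw [Derivation.zero_apply, map_zero, map_one] at h5
    exact zero_ne_one h5

end ScriptH

/-! ### Hamiltonian functions attached to the elements of `[e, 𝔤]` -/

section Functions

/-- The numbers of the four simple root vectors whose sum is the representative of the orbit. -/
def repNums : List ℕ := [185, 326, 341, 400]

/-- The monomials of the functions attached to the basis vectors: up to three monomials, eight
binary digits each, for each number below `429`. -/
@[irreducible] def functionTable : ℕ :=
  0x4422110000008822110000008844118844220000000000520000000000000000000000006e5d3b00000000000000000000001c00000000000000894500ca53000000000000000004000012000086000025665533000000000000000000000000000000000000000081000000000000000003000000000000cdab67000000000000000000008c1500000000000000000e00000000002000005000000000001000000000000000000000000900000000000000000000000000000000000000c8620000000000000000000000000000000000000064310000000000240098320000000000070000000000000000c000000000008000000000000000a965ead973000000aa99330000000098540000000000140000c1000000000000000000000000000000000000000002000000000048cc995500000800000000000000000000000000000000000000000000000000000000000000004900000000000000003000000000000500461300000000000600000000000000000000000000000000000000000000a83100d872000000008b4700000000000000000000000000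00000000000000000000000000000000000000000000a0000000000000000000000000000000ecb9750000000000000000000000340000000000000000a100e2d100000000000000000000009000000000000000000000002800ac35dcba7600000000000000000000000000000000004000c491000000000000008a13000029006a59000000000000000000000018008c26000000000041000000000000000000000000000000000082000000000000000000004c19008d27ce9b570000000000e000000000001600000000000000008300000000000000000000000000b87400000000000000000000000a008e170000000000000000d000000000000000000000006800000000000000000000000000000b00000000000000000000000000000000000000000000000000000000000000e4b1000000000058ccaa660000000000000000000000000000000000000000000000c2000061000000000000000000000000000000000000000000000000009a56006c3900000000000000000000000000000000000000002100625100c5a300000000004a000000000084000000000000000000000000000000ae9d370000000000000000000000000000b000000100008500c693000000000000000000004d2b00000000000000000000000c00006000000000000000004300000000000000000000000000000000000000003800000000000d004e1b00000000000000000000000000000000c4a2000000000000000000000000000000000000000000000000000000009c36000000000000000000000000000000000000000000000092000000000000000000004c2a00000000000000000000000000000000000000000000004200000000000000000000000000000000000000000000a69500000000001a000000000000000000000000000000000000000000000000000000004523000000000000000000000000000000000000000000000000000000002e1d00000000000000007000000000000000000000000000000000000000000000000000000000000000000000000000e8710000000000000000000000000000a400d4b2000000000000000000000000000000000000000000000000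000000000000000000000000e6d5b300000000000000000000009400000000000000000000002c005c3a00000000000000c963000000000000000000000000

/-- The monomials of the function attached to the basis vector with number `i`. -/
def funNums (i : ℕ) : List ℕ :=
  [Nat.shiftRight functionTable (24 * i) % 256, Nat.shiftRight functionTable (24 * i + 8) % 256,
    Nat.shiftRight functionTable (24 * i + 16) % 256].filter fun S => S != 0

/-- The monomials of the function attached to a sum of basis vectors. -/
def funList (l : List ℕ) : List ℕ := l.flatMap funNums

/-- The numbers of basis vectors `x₀, …, x₇, y₀, …, y₇` such that the function of `[e, xᵢ]` is the
`i`-th variable and the function of `[e, yᵢ]` is the `i`-th quintic. -/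
def genNums : ℕ → ℕ := fun n =>
  [162, 144, 78, 405, 34, 193, 274, 6, 61, 43, 383, 230, 354, 92, 158, 252].getD n 0

/-- The bracket of `e` with the basis vectors of the preceding definition. -/
def genList (n : ℕ) : List ℕ := listBracket repNums [genNums n]

/-- Words in the generators: an entry `(w, i, p)` stands for the result of applying the operators
`ad [e, xₘ]` with `m ∈ w` to `yᵢ`. The monomials in `p` single it out from the others. -/
def words : List (List ℕ × ℕ × List ℕ) :=
  [([], 0, [103]), ([], 1, [87]), ([], 2, [55]), ([], 3, [59]), ([], 4, [118]), ([], 5,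
    [117]), ([], 6, [115]), ([], 7, [179]), ([1], 0, [71]), ([2], 0, [39]), ([3], 0, [43]),
    ([5], 0, [101]), ([6], 0, [99]), ([7], 0, [163]), ([2], 1, [23]), ([3], 1, [27]), ([4], 1,
    [86]), ([6], 1, [83]), ([7], 1, [147]), ([3], 2, [29]), ([4], 2, [54]), ([5], 2, [53]),
    ([7], 2, [149]), ([4], 3, [58]), ([5], 3, [57]), ([6], 3, [89]), ([5], 4, [116]), ([6], 4,
    [114]), ([7], 4, [178]), ([6], 5, [113]), ([7], 5, [177]), ([7], 6, [209]), ([4], 0, [204]),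
    ([6], 2, [153]), ([7], 3, [85]), ([1, 2], 0, [7]), ([1, 3], 0, [11]), ([1, 6], 0, [67]),
    ([1, 7], 0, [131]), ([2, 3], 0, [13]), ([2, 5], 0, [37]), ([2, 7], 0, [133]), ([3, 5], 0,
    [41]), ([3, 6], 0, [73]), ([5, 6], 0, [97]), ([5, 7], 0, [161]), ([6, 7], 0, [193]), ([2,
    3], 1, [14]), ([2, 4], 1, [22]), ([2, 7], 1, [134]), ([3, 4], 1, [26]), ([3, 6], 1, [74]),
    ([4, 6], 1, [82]), ([4, 7], 1, [146]), ([6, 7], 1, [194]), ([3, 4], 2, [28]), ([3, 5], 2,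
    [44]), ([4, 5], 2, [52]), ([4, 7], 2, [148]), ([5, 7], 2, [164]), ([4, 5], 3, [56]), ([4,
    6], 3, [88]), ([5, 6], 3, [104]), ([5, 6], 4, [112]), ([5, 7], 4, [176]), ([6, 7], 4,
    [208]), ([6, 7], 5, [224]), ([5, 1], 0, [69]), ([6, 2], 0, [35]), ([4, 0], 1, [70]), ([6,
    2], 1, [19]), ([4, 0], 2, [38]), ([5, 1], 2, [21]), ([4, 0], 3, [42]), ([5, 1], 3, [25]),
    ([5, 1], 4, [84]), ([6, 2], 4, [50]), ([4, 0], 5, [100]), ([6, 2], 5, [49]), ([4, 0], 6,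
    [98]), ([5, 1], 6, [81]), ([4, 0], 7, [162]), ([5, 1], 7, [145]), ([6, 2, 1], 0, [3]), ([5,
    1, 2], 0, [5]), ([5, 1, 3], 0, [9]), ([6, 2, 5], 0, [33]), ([5, 1, 6], 0, [65]), ([5, 1, 7],
    0, [129]), ([4, 0, 2], 1, [6]), ([4, 0, 3], 1, [10]), ([6, 2, 4], 1, [18]), ([4, 0, 6], 1,
    [66]), ([4, 0, 7], 1, [130]), ([4, 0, 3], 2, [12]), ([5, 1, 4], 2, [20]), ([4, 0, 5], 2,
    [36]), ([4, 0, 7], 2, [132]), ([5, 1, 4], 3, [24]), ([4, 0, 5], 3, [40]), ([4, 0, 6], 3,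
    [72]), ([6, 2, 5], 4, [48]), ([5, 1, 6], 4, [80]), ([5, 1, 7], 4, [144]), ([4, 0, 6], 5,
    [96]), ([4, 0, 7], 5, [160]), ([4, 0, 7], 6, [192]), ([6, 7, 3], 2, [34, 68, 136]), ([4, 7,
    3], 0, [17, 34, 136]), ([4, 6, 2], 0, [17, 34, 68]), ([5, 1, 6, 2], 0, [1]), ([4, 0, 6, 2],
    1, [2]), ([4, 0, 5, 1], 2, [4]), ([4, 0, 5, 1], 3, [8]), ([5, 1, 6, 2], 4, [16]), ([4, 0, 6,
    2], 5, [32]), ([4, 0, 5, 1], 6, [64]), ([4, 0, 5, 1], 7, [128])]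

/-- The basis vectors with sum `b j`; the elements `b j` for `j < 119` form a basis of a complement
of the normaliser of the line through `e`. -/
def complList (j : ℕ) : List ℕ :=
  match words[j]? with
  | some (w, i, _) => w.foldr (fun m l => listBracket (genList m) l) [genNums (8 + i)]
  | none => [95]

/-- The monomials which detect `b j`. -/
def pivots (j : ℕ) : List ℕ :=
  match words[j]? with
  | some (_, _, p) => p
  | none => [17, 34, 68, 136]

/-- The parity of the number of entries of `l` which belong to `p`. -/
def pivotParity (p l : List ℕ) : Bool := l.foldr (fun S b => p.contains S ^^ b) false

/-! ### Finite verifications in the tables -/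

theorem functionTable_shiftRight : functionTable >>> 10296 = 0 := by decide +kernel

theorem funNums_eq_nil {i : ℕ} (hi : i ∉ basisNums) : funNums i = [] := by
  by_cases h : i < 429
  · have key : ∀ i < 429, i ∈ basisNums ∨ funNums i = [] := by decide +kernel
    exact (key i h).resolve_left hi
  · have key : ∀ n, 10296 ≤ n → Nat.shiftRight functionTable n = 0 := fun n hn => by
      obtain ⟨m, rfl⟩ := Nat.exists_eq_add_of_le hn
      change functionTable >>> (10296 + m) = 0
      rw [Nat.shiftRight_add, functionTable_shiftRight, Nat.zero_shiftRight]
    rw [funNums, key _ (by omega), key _ (by omega), key _ (by omega)]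
    rfl

theorem funNums_lt {i S : ℕ} (h : S ∈ funNums i) : S < 256 := by
  have h1 := (List.mem_filter.1 h).1
  simp only [List.mem_cons, List.not_mem_nil, or_false] at h1
  omega

theorem words_length : words.length = 118 := by decide +kernel

/-- The table omits constant terms, so the Poisson bracket is matched only up to the monomial
numbered 0, which is the constant 1. Only the sixteen generators are tested against $[e,\mathfrak
g]$. -/
theorem function_bracket : ∀ i ∈ basisNums, ∀ n < 16,
    mask (funList (listBracket (genList n) (listBracket repNums [i]))) =
      mask (poissonList (funList (genList n)) (funList (listBracket repNums [i]))) ∨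
    mask (funList (listBracket (genList n) (listBracket repNums [i]))) =
      mask (0 :: poissonList (funList (genList n)) (funList (listBracket repNums [i]))) := by
  decide +kernel

/-- The pivots read off which of the elements $b_j$ must be added to a basis vector to bring it into
the normaliser. -/
theorem complement_spans : ∀ i ∈ basisNums,
    mask (listBracket repNums ([i] ++ ((List.range 119).filter fun j =>
        pivotParity (pivots j) (funList (listBracket repNums [i]))).flatMap complList)) ∈
      [0, mask repNums] := by
  decide +kernel

/-- The four commuting root vectors contribute $(\mathrm{ad}\,e_\alpha)^2\in 2\,\mathrm{End}$ and
mixed terms that occur twice. -/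
theorem bracket_bracket : ∀ i ∈ basisNums,
    mask (listBracket repNums (listBracket repNums [i])) = 0 := by
  decide +kernel

theorem mask_funList_repNums : mask (funList repNums) = 0 := by decide +kernel

theorem function_var : ∀ n < 8, mask (funList (genList n)) = mask [2 ^ n] := by decide +kernel

theorem function_quintic : ∀ n < 8, mask (funList (genList (8 + n))) = mask (quinticNums n) := by
  decide +kernel

theorem pivots_pos_lt : ∀ j < 119, ∀ S ∈ pivots j, 0 < S ∧ S < 256 := by decide +kernel

theorem pivots_nodup : ∀ j < 119, (pivots j).Nodup := by decide +kernel

theorem words_bounds : ∀ x ∈ words, (∀ m ∈ x.1, m < 16) ∧ x.2.1 < 8 := by decide +kernel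

theorem pivots_dual : ∀ i < 119, ∀ j < 119,
    pivotParity (pivots j) (funList (listBracket repNums (complList i))) = decide (i = j) := by
  decide +kernel

/-- The last pivots are the four monomials $x_ix_{i'}$. The sum of their coefficients is the linear
condition which separates $\mathcal H(8;\underline 1)$ from the larger space of all symbols. -/
theorem last_pivots_bracket : ∀ n < 16, ∀ j < 118, pivotParity (pivots 118)
    (funList (listBracket (genList n) (listBracket repNums (complList j)))) = false := by
  decide +kernel

theorem last_pivots_gen : ∀ n < 16, pivotParity (pivots 118) (funList (genList n)) = false := by
  decide +kernel

/-- The Poisson brackets of the corresponding functions cancel: each product of two $x_bx_{b'}$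
appears for two values of $a$. What remains of the sum in $\mathfrak g$ is $e$ itself, which is how
$e$ enters the generated algebra. -/
theorem mask_rep_eq : mask ((List.range 4).flatMap fun a =>
    listBracket (genList a) (genList (12 + a))) = mask repNums := by
  decide +kernel

/-- The words 107, 108 and 109 have functions of the form $x_ax_{a'}+x_bx_{b'}$; every generator is
fixed under the bracket by one of them. -/
theorem gen_perfect : ∀ n < 16, ∃ j < 118,
    mask (listBracket (listBracket repNums (complList j)) (genList n)) = mask (genList n) := by
  have key : ∀ n < 16, ∃ j ∈ [107, 108, 109],
      mask (listBracket (listBracket repNums (complList j)) (genList n)) = mask (genList n) := by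
    decide +kernel
  intro n hn
  obtain ⟨j, hj, h⟩ := key n hn
  refine ⟨j, ?_, h⟩
  simp only [List.mem_cons, List.not_mem_nil, or_false] at hj
  omega

/-- Although its symbol lies outside $\mathcal H(8;\underline 1)$, the last element acts diagonally
on the generators, so it normalises the algebra they generate. -/
theorem last_bracket_gen : ∀ n < 16,
    mask (listBracket (listBracket repNums (complList 118)) (genList n)) ∈ [0, mask (genList n)] := by
  decide +kernel

/-- That is, $b_{118}=[x_0,y_4]$. This forces the last dimension into any subalgebra containing the
$x_i$ and $y_i$. -/
theorem mask_complList_last : mask (listBracket [genNums 0] [genNums 12]) = mask (complList 118) := by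
  decide +kernel

/-- The numbers of eight root vectors in the centraliser of `e`. -/
def extraNums : List ℕ := [128, 372, 225, 399, 293, 49, 196, 22]

theorem extraNums_subset : ∀ i ∈ extraNums, i ∈ basisNums := by decide +kernel

theorem extraNums_nodup : extraNums.Nodup := by decide

theorem bracket_extra : ∀ i ∈ extraNums, mask (listBracket repNums [i]) = 0 := by decide +kernel

theorem extra_not_mem_bracket : ∀ i ∈ basisNums, ∀ j ∈ extraNums, j ∉ listBracket repNums [i] := by
  decide +kernel

theorem extra_not_mem_bracket_extra : ∀ i ∈ extraNums, ∀ i' ∈ extraNums, ∀ j ∈ extraNums,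
    j ∉ listBracket [i] [i'] := by
  decide +kernel

/-- The numbers 424 and 428 are the coroots of $\alpha_4$ and $\alpha_8$. Their sum pairs oddly with
each of $\alpha_2,\alpha_3,\alpha_5,\alpha_7$. -/
theorem bracket_coroot : mask (listBracket repNums [424, 428]) = mask repNums := by decide +kernel

end Functions

/-! ### The basis of `𝔤` moved by an automorphism -/

section Vectors

variable {k : Type*} [Field k] (σ : LieE8 k ≃ₗ⁅k⁆ LieE8 k)

/-- The image under `σ` of the sum of the basis vectors with numbers in `l`. -/
def vec (l : List ℕ) : LieE8 k := σ (comb (numVec k) l)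

theorem vec_eq_comb (l : List ℕ) : vec σ l = comb (fun i => vec σ [i]) l := by
  rw [vec, map_comb]
  exact comb_congr fun i _ => by rw [vec, comb_cons, comb_nil, add_zero]

theorem vec_append (l l' : List ℕ) : vec σ (l ++ l') = vec σ l + vec σ l' := by
  rw [vec, vec, vec, comb_append, map_add]

theorem vec_flatMap (f : ℕ → List ℕ) (l : List ℕ) :
    vec σ (l.flatMap f) = comb (fun i => vec σ (f i)) l := by
  rw [vec, comb_flatMap, map_comb]
  rfl

/-- The image under `σ` of the standard basis. -/
def movedBasis : Module.Basis (Fin 8 ⊕ Root) k (LieE8 k) := (stdBasis k).map σ.toLinearEquiv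

theorem movedBasis_apply (a : Fin 8 ⊕ Root) : movedBasis σ a = σ (stdBasis k a) := rfl

theorem span_vec_eq_top (V : Submodule k (LieE8 k)) (h : ∀ i ∈ basisNums, vec σ [i] ∈ V) : V = ⊤ := by
  rw [eq_top_iff, ← (movedBasis σ).span_eq, Submodule.span_le]
  rintro _ ⟨a, rfl⟩
  obtain ⟨i, hi, ha⟩ := exists_numVec (k := k) a
  have := h i hi
  rwa [vec, comb_cons, comb_nil, add_zero, ha] at this

/-- The number of a basis vector. -/
def indexNum : Fin 8 ⊕ Root → ℕ
  | Sum.inl l => 421 + l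
  | Sum.inr α => (number α.1 % 421).toNat

/-- The linear map with prescribed values on the basis vectors. -/
def extendLinear {V : Type*} [AddCommGroup V] [Module k V] (φ : ℕ → V) : LieE8 k →ₗ[k] V :=
  (movedBasis σ).constr k fun a => φ (indexNum a)

theorem numVec_eq_zero {i : ℕ} (hi : i ∉ basisNums) : numVec k i = 0 := by
  rw [mem_basisNums] at hi
  by_cases h : i < 421
  · refine numVec_of_code_eq_zero h ?_
    by_contra hc
    exact hi ⟨by omega, fun _ => hc⟩
  · refine numVec_of_ge ?_
    by_contra hc
    exact hi ⟨by omega, fun h1 => absurd h1 h⟩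

theorem extendLinear_vec {V : Type*} [AddCommGroup V] [Module k V] {φ : ℕ → V}
    (hφ : ∀ i ∉ basisNums, φ i = 0) (l : List ℕ) : extendLinear σ φ (vec σ l) = comb φ l := by
  have hb : ∀ a, extendLinear σ φ (σ (stdBasis k a)) = φ (indexNum a) := fun a => by
    rw [← movedBasis_apply, extendLinear, Module.Basis.constr_basis]
  rw [vec_eq_comb, map_comb]
  refine comb_congr fun i _ => ?_
  rw [vec, comb_cons, comb_nil, add_zero]
  by_cases hi : i ∈ basisNums
  · rcases numVec_eq_of_mem (k := k) hi with ⟨l, rfl, h⟩ | ⟨α, hi', -, hn, h⟩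
    · rw [h, hb]
      rfl
    · rw [h, hb, indexNum, hn, Int.toNat_natCast]
  · rw [numVec_eq_zero hi, map_zero, map_zero, hφ i hi]

variable [CharP k 2]

theorem lie_vec (l l' : List ℕ) : ⁅vec σ l, vec σ l'⁆ = vec σ (listBracket l l') := by
  rw [vec, vec, vec, ← LieEquiv.map_lie, lie_comb_numVec]

theorem vec_eq_of_mask {l l' : List ℕ} (h : mask l = mask l') : vec σ l = vec σ l' :=
  congrArg σ (comb_eq_of_mask lieE8_add_self _ h)

theorem vec_eq_zero {l : List ℕ} (h : mask l = 0) : vec σ l = 0 := by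
  have h0 : mask l = mask [] := h
  rw [vec_eq_of_mask σ h0, vec, comb_nil, map_zero]

end Vectors

/-! ### The symbol map and its kernel, the normaliser -/

section Normaliser

variable {k : Type*} [Field k] (σ : LieE8 k ≃ₗ⁅k⁆ LieE8 k)

/-- The representative of the orbit, moved by `σ`. -/
def rep : LieE8 k := vec σ repNums

/-- The operator `ad e`. -/
def adRep : LieE8 k →ₗ[k] LieE8 k := bracketMap k (rep σ)

theorem adRep_apply (x : LieE8 k) : adRep σ x = ⁅rep σ, x⁆ := rfl

theorem mem_normaliser_rep {x : LieE8 k} :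
    x ∈ normaliser k (rep σ) ↔ adRep σ x ∈ Submodule.span k {rep σ} := by
  rw [mem_normaliser, adRep_apply, ← lie_skew, Submodule.neg_mem_iff]

/-- The Hamiltonian function of an element of `[e, 𝔤]`, extended linearly to `𝔤`. -/
def function : LieE8 k →ₗ[k] TruncPoly k := extendLinear σ fun i => comb (mono k) (funNums i)

theorem function_vec (l : List ℕ) : function σ (vec σ l) = comb (mono k) (funList l) := by
  rw [function, extendLinear_vec σ fun i hi => by rw [funNums_eq_nil hi, comb_nil], funList,
    comb_flatMap]

variable [CharP k 2]

theorem adRep_vec (l : List ℕ) : adRep σ (vec σ l) = vec σ (listBracket repNums l) :=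
  lie_vec σ _ _

/-- The Hamiltonian vector field of an element of `[e, 𝔤]`, extended linearly to `𝔤`. -/
def field : LieE8 k →ₗ[k] Witt k := hamMap k ∘ₗ function σ

theorem field_vec (l : List ℕ) : field σ (vec σ l) = hamList k (funList l) := by
  rw [field, LinearMap.comp_apply, function_vec]
  rfl

theorem field_rep : field σ (rep σ) = 0 := by
  rw [rep, field_vec, hamList_eq_of_mask (l' := []) mask_funList_repNums, hamList, comb_nil,
    ← hamMap_apply, map_zero]

/-- The generator `[e, xₙ]` or `[e, yₙ₋₈]`. -/
def gen (n : ℕ) : LieE8 k := vec σ (genList n)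

/-- The basis of a complement of the normaliser. -/
def compl (j : ℕ) : LieE8 k := vec σ (complList j)

theorem adRep_adRep (x : LieE8 k) : adRep σ (adRep σ x) = 0 := by
  have h : LinearMap.ker (adRep σ ∘ₗ adRep σ) = ⊤ := span_vec_eq_top σ _ fun i hi => by
    rw [LinearMap.mem_ker, LinearMap.comp_apply, adRep_vec, adRep_vec]
    exact vec_eq_zero σ (bracket_bracket i hi)
  have hx : x ∈ LinearMap.ker (adRep σ ∘ₗ adRep σ) := h ▸ Submodule.mem_top
  exact hx

theorem adRep_mem_span_of_mask {l : List ℕ} (h : mask (listBracket repNums l) ∈ [0, mask repNums]) :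
    adRep σ (vec σ l) ∈ Submodule.span k {rep σ} := by
  rw [adRep_vec]
  rcases List.mem_cons.1 h with h | h
  · rw [vec_eq_zero σ h]
    exact Submodule.zero_mem _
  · rw [vec_eq_of_mask σ (List.mem_singleton.1 h)]
    exact Submodule.mem_span_singleton_self _

/-- The span of the elements `b j`. -/
def complSpan : Submodule k (LieE8 k) := Submodule.span k (Set.range fun j : Fin 119 => compl σ j)

/-- Each basis vector plus the correction of `complement_spans` normalises the line, and in
characteristic two the correction can be added again. -/
theorem normaliser_sup_complSpan : (normaliser k (rep σ)).toSubmodule ⊔ complSpan σ = ⊤ := by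
  refine span_vec_eq_top σ _ fun i hi => ?_
  set s := (List.range 119).filter fun j =>
    pivotParity (pivots j) (funList (listBracket repNums [i])) with hs
  have h1 : vec σ ([i] ++ s.flatMap complList) ∈ (normaliser k (rep σ)).toSubmodule :=
    (mem_normaliser_rep σ).2 (adRep_mem_span_of_mask σ (complement_spans i hi))
  have h2 : vec σ (s.flatMap complList) ∈ complSpan σ := by
    rw [vec_flatMap]
    refine comb_mem _ _ _ fun j hj => Submodule.subset_span ⟨⟨j, ?_⟩, rfl⟩
    rw [hs] at hj
    exact List.mem_range.1 (List.mem_filter.1 hj).1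
  have h3 : vec σ [i] = vec σ ([i] ++ s.flatMap complList) + vec σ (s.flatMap complList) := by
    rw [vec_append, add_assoc, lieE8_add_self, add_zero]
  rw [h3]
  exact Submodule.add_mem_sup h1 h2

/-- The functional which detects `b j`. -/
def pivotCoeff (k : Type*) [Field k] [CharP k 2] (j : ℕ) : TruncPoly k →ₗ[k] k :=
  comb (coefficient k) (pivots j)

theorem pivotCoeff_apply (j : ℕ) (f : TruncPoly k) :
    pivotCoeff k j f = comb (fun S => coefficient k S f) (pivots j) :=
  map_comb (LinearMap.applyₗ f) (coefficient k) (pivots j)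

theorem pivotCoeff_mono {j S : ℕ} (hj : j < 119) (hS : S < 256) :
    pivotCoeff k j (mono k S) = if (pivots j).contains S then 1 else 0 := by
  have h : ∀ p : List ℕ, p.Nodup → comb (fun P => if S = P then (1 : k) else 0) p =
      if p.contains S then 1 else 0 := by
    intro p hp
    induction p with
    | nil => rfl
    | cons P p ih =>
      obtain ⟨hP, hp⟩ := List.nodup_cons.1 hp
      rw [comb_cons, ih hp]
      by_cases hSP : S = P
      · subst hSP
        simp [hP]
      · simp [hSP]
  rw [pivotCoeff_apply, ← h _ (pivots_nodup j hj)]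
  exact comb_congr fun P hP => coefficient_mono (pivots_pos_lt j hj P hP).2 hS

theorem pivotCoeff_comb {j : ℕ} (hj : j < 119) {l : List ℕ} (hl : ∀ S ∈ l, S < 256) :
    pivotCoeff k j (comb (mono k) l) = if pivotParity (pivots j) l then 1 else 0 := by
  induction l with
  | nil => rw [comb_nil, map_zero]; rfl
  | cons S l ih =>
    rw [comb_cons, map_add, ih fun T hT => hl T (List.mem_cons_of_mem _ hT),
      pivotCoeff_mono hj (hl S List.mem_cons_self)]
    have h : pivotParity (pivots j) (S :: l) =
      ((pivots j).contains S ^^ pivotParity (pivots j) l) := rfl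
    rw [h]
    cases (pivots j).contains S <;> cases pivotParity (pivots j) l <;> simp [CharTwo.add_self_eq_zero]

theorem pivotCoeff_function {j : ℕ} (hj : j < 119) (l : List ℕ) :
    pivotCoeff k j (function σ (vec σ l)) = if pivotParity (pivots j) (funList l) then 1 else 0 := by
  rw [function_vec]
  refine pivotCoeff_comb hj fun S hS => ?_
  obtain ⟨i, -, hi⟩ := List.mem_flatMap.1 hS
  exact funNums_lt hi

/-- No pivot is the constant monomial. Hence these functionals depend only on the Hamiltonian field
of a function. -/
theorem pivotCoeff_algebraMap {j : ℕ} (hj : j < 119) (c : k) :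
    pivotCoeff k j (algebraMap k (TruncPoly k) c) = 0 := by
  rw [pivotCoeff_apply]
  have h : comb (fun _ => (0 : k)) (pivots j) = 0 := by simp [comb]
  rw [← h]
  refine comb_congr fun S hS => ?_
  obtain ⟨h0, h1⟩ := pivots_pos_lt j hj S hS
  exact coefficient_algebraMap h1 h0.ne' c

theorem function_rep : function σ (rep σ) = 0 := by
  have h : mask (funList repNums) = mask [] := mask_funList_repNums
  rw [rep, function_vec, comb_eq_of_mask (truncPoly_add_self k) _ h, comb_nil]

theorem function_of_mem_span {x : LieE8 k} (hx : x ∈ Submodule.span k {rep σ}) :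
    function σ x = 0 := by
  obtain ⟨c, rfl⟩ := Submodule.mem_span_singleton.1 hx
  rw [map_smul, function_rep, smul_zero]

/-- The functionals on `𝔤` which vanish on the normaliser and are dual to the elements `b j`. -/
def complCoord (j : ℕ) : LieE8 k →ₗ[k] k := pivotCoeff k j ∘ₗ function σ ∘ₗ adRep σ

theorem complCoord_compl (i j : Fin 119) : complCoord σ j (compl σ i) = if i = j then 1 else 0 := by
  rw [complCoord, LinearMap.comp_apply, LinearMap.comp_apply, compl, adRep_vec,
    pivotCoeff_function σ j.2, pivots_dual i i.2 j j.2]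
  simp [Fin.ext_iff]

theorem complCoord_sum (c : Fin 119 → k) (j : Fin 119) :
    complCoord σ j (∑ i, c i • compl σ i) = c j := by
  rw [map_sum]
  simp only [map_smul, complCoord_compl, smul_eq_mul, mul_ite, mul_one, mul_zero,
    Finset.sum_ite_eq', Finset.mem_univ, if_true]

theorem complCoord_of_mem {x : LieE8 k} (hx : x ∈ normaliser k (rep σ)) (j : ℕ) :
    complCoord σ j x = 0 := by
  rw [complCoord, LinearMap.comp_apply, LinearMap.comp_apply,
    function_of_mem_span σ ((mem_normaliser_rep σ).1 hx), map_zero]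

theorem exists_decomposition (x : LieE8 k) : ∃ n ∈ normaliser k (rep σ),
    x = n + ∑ j : Fin 119, complCoord σ j x • compl σ j := by
  have hx : x ∈ (normaliser k (rep σ)).toSubmodule ⊔ complSpan σ :=
    normaliser_sup_complSpan σ ▸ Submodule.mem_top
  obtain ⟨n, hn, y, hy, rfl⟩ := Submodule.mem_sup.1 hx
  obtain ⟨c, rfl⟩ := (Submodule.mem_span_range_iff_exists_fun k).1 hy
  refine ⟨n, hn, congrArg (n + ·) (Finset.sum_congr rfl fun j _ => ?_)⟩
  rw [map_add, complCoord_of_mem σ hn, zero_add, complCoord_sum]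

/-- The composition of `field` with `ad e`. -/
def symbol : LieE8 k →ₗ[k] Witt k := field σ ∘ₗ adRep σ

theorem symbol_apply (x : LieE8 k) : symbol σ x = hamVec (function σ (adRep σ x)) := rfl

theorem symbol_of_mem {x : LieE8 k} (hx : x ∈ normaliser k (rep σ)) : symbol σ x = 0 := by
  rw [symbol_apply, function_of_mem_span σ ((mem_normaliser_rep σ).1 hx), ← hamMap_apply, map_zero]

theorem complCoord_of_symbol_eq_zero {x : LieE8 k} (hx : symbol σ x = 0) (j : Fin 119) :
    complCoord σ j x = 0 := by
  rw [complCoord, LinearMap.comp_apply, LinearMap.comp_apply, hamVec_eq_zero hx,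
    pivotCoeff_algebraMap j.2]

theorem mem_normaliser_of_complCoord {x : LieE8 k} (hx : ∀ j : Fin 119, complCoord σ j x = 0) :
    x ∈ normaliser k (rep σ) := by
  obtain ⟨n, hn, h⟩ := exists_decomposition σ x
  simp only [hx, zero_smul, Finset.sum_const_zero, add_zero] at h
  rwa [h]

/-- A zero symbol means that the function of $[e,x]$ is constant, so all 119 dual coordinates vanish
and the decomposition of $x$ has no part in the complement. -/
theorem mem_normaliser_iff {x : LieE8 k} : x ∈ normaliser k (rep σ) ↔ symbol σ x = 0 :=
  ⟨symbol_of_mem σ, fun h => mem_normaliser_of_complCoord σ (complCoord_of_symbol_eq_zero σ h)⟩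

theorem symbol_eq_iff {x y : LieE8 k} : symbol σ x = symbol σ y ↔ x + y ∈ normaliser k (rep σ) := by
  rw [mem_normaliser_iff, map_add]
  constructor
  · intro h
    rw [h, witt_add_self k]
  · intro h
    rw [← add_zero (symbol σ x), ← witt_add_self k (symbol σ y), ← add_assoc, h, zero_add]

theorem symbol_eq_sum (x : LieE8 k) :
    symbol σ x = ∑ j : Fin 119, complCoord σ j x • symbol σ (compl σ j) := by
  obtain ⟨n, hn, h⟩ := exists_decomposition σ x
  conv_lhs => rw [h]
  rw [map_add, symbol_of_mem σ hn, zero_add, map_sum]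
  simp only [map_smul]

end Normaliser

/-! ### The dimension of the normaliser -/

section Dimension

variable {k : Type*} [Field k]

instance : Module.Finite k (LieE8 k) := Module.Finite.of_basis (stdBasis k)

theorem finrank_lieE8 : Module.finrank k (LieE8 k) = 248 := by
  rw [Module.finrank_eq_card_basis (stdBasis k), Fintype.card_sum, Fintype.card_fin, card_root]

variable [CharP k 2] (σ : LieE8 k ≃ₗ⁅k⁆ LieE8 k)

/-- The 119 dual functionals form a surjection whose kernel is the normaliser, and $248-119=129$. -/
theorem finrank_normaliser : Module.finrank k (normaliser k (rep σ)) = 129 := by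
  let C : LieE8 k →ₗ[k] Fin 119 → k := LinearMap.pi fun j => complCoord σ j
  have h1 : LinearMap.range C = ⊤ := LinearMap.range_eq_top.2 fun c =>
    ⟨∑ i, c i • compl σ i, funext fun j => complCoord_sum σ c j⟩
  have h2 : LinearMap.ker C = (normaliser k (rep σ)).toSubmodule := by
    ext x
    exact ⟨fun h => mem_normaliser_of_complCoord σ fun j => congrFun h j,
      fun h => funext fun j => complCoord_of_mem σ h j⟩
  have h3 := C.finrank_range_add_finrank_ker
  rw [h1, h2, finrank_lieE8, finrank_top, Module.finrank_fin_fun] at h3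
  have h4 : Module.finrank k (normaliser k (rep σ)) =
    Module.finrank k (normaliser k (rep σ)).toSubmodule := rfl
  omega

end Dimension

/-! ### Subspaces stable under generators -/

section LieSpan

variable {k L : Type*} [Field k] [LieRing L] [LieAlgebra k L]

/-- The stabiliser of $W$ is a subalgebra, so stability under the generators extends to the algebra
they generate; as $W$ lies inside that algebra, $W$ is itself a subalgebra. -/
theorem lieSpan_le_of_lie_mem (s : Set L) (W : Submodule k L) (hs : s ⊆ W)
    (hW : W ≤ (LieSubalgebra.lieSpan k L s).toSubmodule) (h : ∀ g ∈ s, ∀ w ∈ W, ⁅g, w⁆ ∈ W) :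
    (LieSubalgebra.lieSpan k L s).toSubmodule ≤ W := by
  let T : LieSubalgebra k L :=
    { carrier := {u | ∀ w ∈ W, ⁅u, w⁆ ∈ W}
      add_mem' := fun ha hb w hw => by
        rw [add_lie]
        exact W.add_mem (ha w hw) (hb w hw)
      zero_mem' := fun w _ => by
        rw [zero_lie]
        exact W.zero_mem
      smul_mem' := fun c u hu w hw => by
        rw [smul_lie]
        exact W.smul_mem c (hu w hw)
      lie_mem' := fun {u v} hu hv w hw => by
        rw [lie_lie]
        exact W.sub_mem (hu _ (hv w hw)) (hv _ (hu w hw)) }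
  have hT : LieSubalgebra.lieSpan k L s ≤ T := LieSubalgebra.lieSpan_le.2 fun g hg w hw => h g hg w hw
  let K : LieSubalgebra k L := { W with lie_mem' := fun hx hy => hT (hW hx) _ hy }
  have hK : LieSubalgebra.lieSpan k L s ≤ K := LieSubalgebra.lieSpan_le.2 hs
  exact hK

/-- The operator $\mathrm{ad}\,u$ is a derivation, so it is enough that it maps generators into the
generated algebra. -/
theorem lie_mem_lieSpan_of_forall {s : Set L} {u : L}
    (hu : ∀ g ∈ s, ⁅u, g⁆ ∈ LieSubalgebra.lieSpan k L s) {x : L}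
    (hx : x ∈ LieSubalgebra.lieSpan k L s) : ⁅u, x⁆ ∈ LieSubalgebra.lieSpan k L s := by
  induction hx using LieSubalgebra.lieSpan_induction with
  | mem x hx => exact hu x hx
  | zero => rw [lie_zero]; exact zero_mem _
  | add x y _ _ hx hy => rw [lie_add]; exact add_mem hx hy
  | smul c x _ hx => rw [lie_smul]; exact LieSubalgebra.smul_mem _ c hx
  | lie x y hx hy hux huy =>
    rw [leibniz_lie]
    exact add_mem (LieSubalgebra.lie_mem _ hux hy) (LieSubalgebra.lie_mem _ hx huy)

end LieSpan

theorem witt_lie_add {k : Type*} [Field k] (D E F : Witt k) : ⁅D, E + F⁆ = ⁅D, E⁆ + ⁅D, F⁆ :=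
  map_add (LieAlgebra.ad k (Witt k) D) E F

theorem witt_lie_lie {k : Type*} [Field k] [CharP k 2] (D E F : Witt k) :
    ⁅⁅D, E⁆, F⁆ = ⁅D, ⁅E, F⁆⁆ + ⁅E, ⁅D, F⁆⁆ := by
  rw [← witt_neg ⁅E, ⁅D, F⁆⁆]
  exact (lie_lie D E F).trans (sub_eq_add_neg _ _)

/-! ### The algebra generated by the elements `[e, xᵢ]` and `[e, yᵢ]` -/

section Generators

variable {k : Type*} [Field k] (σ : LieE8 k ≃ₗ⁅k⁆ LieE8 k)

/-- The range of `ad e`. -/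
def image : Submodule k (LieE8 k) := LinearMap.range (adRep σ)

/-- The subalgebra generated by the elements `[e, xᵢ]` and `[e, yᵢ]`. -/
def genAlgebra : LieSubalgebra k (LieE8 k) :=
  LieSubalgebra.lieSpan k (LieE8 k) (Set.range fun n : Fin 16 => gen σ n)

theorem gen_mem_genAlgebra {n : ℕ} (hn : n < 16) : gen σ n ∈ genAlgebra σ :=
  LieSubalgebra.subset_lieSpan ⟨⟨n, hn⟩, rfl⟩

theorem genAlgebra_le_iff (K : LieSubalgebra k (LieE8 k)) :
    genAlgebra σ ≤ K ↔ ∀ n < 16, gen σ n ∈ K := by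
  rw [genAlgebra, LieSubalgebra.lieSpan_le, Set.range_subset_iff]
  exact ⟨fun h n hn => h ⟨n, hn⟩, fun h n => h n n.2⟩

theorem adRep_lie {u : LieE8 k} (hu : adRep σ u = 0) (x : LieE8 k) :
    adRep σ ⁅u, x⁆ = ⁅u, adRep σ x⁆ := by
  rw [adRep_apply] at hu
  rw [adRep_apply, leibniz_lie, hu, zero_lie, zero_add, adRep_apply]

theorem lie_mem_image {u v : LieE8 k} (hu : adRep σ u = 0) (hv : v ∈ image σ) : ⁅u, v⁆ ∈ image σ := by
  obtain ⟨x, rfl⟩ := hv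
  exact ⟨⁅u, x⁆, adRep_lie σ hu x⟩

variable [CharP k 2]

theorem gen_eq (n : ℕ) : gen σ n = adRep σ (vec σ [genNums n]) := (adRep_vec σ _).symm

theorem gen_mem_image (n : ℕ) : gen σ n ∈ image σ := ⟨_, (gen_eq σ n).symm⟩

theorem adRep_of_mem_image {u : LieE8 k} (hu : u ∈ image σ) : adRep σ u = 0 := by
  obtain ⟨x, rfl⟩ := hu
  exact adRep_adRep σ x

/-- Both sides are linear in a preimage of $v$ under $\mathrm{ad}\,e$, so `function_bracket` on
basis vectors suffices; $D_H$ removes the possible constant. -/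
theorem field_lie_gen {n : ℕ} (hn : n < 16) {v : LieE8 k} (hv : v ∈ image σ) :
    field σ ⁅gen σ n, v⁆ = ⁅field σ (gen σ n), field σ v⁆ := by
  obtain ⟨x, rfl⟩ := hv
  let A : LieE8 k →ₗ[k] Witt k := field σ ∘ₗ bracketMap k (gen σ n) ∘ₗ adRep σ
  let B : LieE8 k →ₗ[k] Witt k :=
    (LieAlgebra.ad k (Witt k) (field σ (gen σ n)) : Witt k →ₗ[k] Witt k) ∘ₗ field σ ∘ₗ adRep σ
  have h0 : ∀ l, hamList k (0 :: l) = hamList k l := by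
    intro l
    have h1 : hamVec (mono k 0) = 0 := by
      rw [mono_zero]
      refine witt_ext fun j => ?_
      rw [hamVec_apply]
      simp
    rw [hamList, comb_cons, ← hamMap_apply, map_add, hamMap_apply, h1, zero_add]
    rfl
  have h : LinearMap.eqLocus A B = ⊤ := span_vec_eq_top σ _ fun i hi => by
    change field σ ⁅gen σ n, adRep σ (vec σ [i])⁆ = ⁅field σ (gen σ n), field σ (adRep σ (vec σ [i]))⁆
    rw [adRep_vec, gen, lie_vec, field_vec, field_vec, field_vec, lie_hamList]
    rcases function_bracket i hi n hn with h | h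
    · exact hamList_eq_of_mask h
    · rw [hamList_eq_of_mask h, h0]
  have hx : x ∈ LinearMap.eqLocus A B := h ▸ Submodule.mem_top
  exact hx

/-- The elements of $[e,\mathfrak g]$ with this compatibility form a subalgebra: they centralise
$e$, so they preserve $[e,\mathfrak g]$, and the Jacobi identity handles brackets. -/
theorem genAlgebra_spec {u : LieE8 k} (hu : u ∈ genAlgebra σ) : u ∈ image σ ∧
    ∀ v ∈ image σ, field σ ⁅u, v⁆ = ⁅field σ u, field σ v⁆ := by
  let K : LieSubalgebra k (LieE8 k) :=
    { carrier := {u | u ∈ image σ ∧ ∀ v ∈ image σ, field σ ⁅u, v⁆ = ⁅field σ u, field σ v⁆}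
      add_mem' := fun {a b} ha hb => ⟨(image σ).add_mem ha.1 hb.1, fun v hv => by
        rw [add_lie, map_add, map_add, ha.2 v hv, hb.2 v hv, witt_lie_comm (_ + _), witt_lie_add,
          witt_lie_comm (field σ v), witt_lie_comm (field σ v)]⟩
      zero_mem' := ⟨(image σ).zero_mem, fun v _ => by
        rw [zero_lie, map_zero, witt_lie_comm, witt_lie_zero]⟩
      smul_mem' := fun c a ha => ⟨(image σ).smul_mem c ha.1, fun v hv => by
        rw [smul_lie, map_smul, map_smul, ha.2 v hv, witt_lie_comm (c • _), witt_lie_smul,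
          witt_lie_comm (field σ v)]⟩
      lie_mem' := fun {a b} ha hb => by
        have h0 : ∀ {u}, u ∈ image σ → adRep σ u = 0 := adRep_of_mem_image σ
        refine ⟨lie_mem_image σ (h0 ha.1) hb.1, fun v hv => ?_⟩
        rw [lie_lie, sub_eq_add_neg, lieE8_neg, map_add, ha.2 _ (lie_mem_image σ (h0 hb.1) hv),
          hb.2 _ (lie_mem_image σ (h0 ha.1) hv), ha.2 v hv, hb.2 v hv, ha.2 b hb.1,
          witt_lie_lie] }
  exact (genAlgebra_le_iff σ K).2 (fun n hn => ⟨gen_mem_image σ n, fun v hv => field_lie_gen σ hn hv⟩) hu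

theorem field_gen (n : Fin 8) : field σ (gen σ n) = hamVec (var k n) := by
  rw [gen, field_vec, hamList_eq_of_mask (function_var n n.2), hamList, comb_cons, comb_nil, add_zero,
    mono_two_pow]

theorem field_gen_add (n : Fin 8) : field σ (gen σ (8 + n)) = hamVec (quintic k n) := by
  rw [gen, field_vec, hamList_eq_of_mask (function_quintic n n.2), hamList, quintic_eq]

theorem field_gen_mem_scriptH {n : ℕ} (hn : n < 16) : field σ (gen σ n) ∈ scriptH k := by
  by_cases h : n < 8
  · have h8 : ∀ n : Fin 8, n + 4 + 4 = n := by decide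
    have h1 : field σ (gen σ n) = partialD k (⟨n, h⟩ + 4) := by
      rw [← hamVec_var, h8]
      exact field_gen σ ⟨n, h⟩
    rw [h1]
    exact partialD_mem_scriptH _
  · obtain ⟨m, rfl⟩ := Nat.exists_eq_add_of_le (not_lt.1 h)
    rw [field_gen_add σ ⟨m, by omega⟩]
    exact LieSubalgebra.subset_lieSpan (Or.inr ⟨_, rfl⟩)

theorem field_mem_scriptH {u : LieE8 k} (hu : u ∈ genAlgebra σ) : field σ u ∈ scriptH k := by
  let K : LieSubalgebra k (LieE8 k) :=
    { (scriptH k).toSubmodule.comap (field σ) ⊓ (genAlgebra σ).toSubmodule with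
      lie_mem' := fun {a b} ha hb => by
        refine ⟨?_, (genAlgebra σ).lie_mem ha.2 hb.2⟩
        change field σ ⁅a, b⁆ ∈ scriptH k
        rw [(genAlgebra_spec σ ha.2).2 b (genAlgebra_spec σ hb.2).1]
        exact (scriptH k).lie_mem ha.1 hb.1 }
  exact ((genAlgebra_le_iff σ K).2
    (fun n hn => ⟨field_gen_mem_scriptH σ hn, gen_mem_genAlgebra σ hn⟩) hu).1

/-- The operators in a word centralise $e$, so $\mathrm{ad}\,e$ passes through the word to the
innermost $y_i$ and turns it into a generator. -/
theorem adRep_compl_mem_genAlgebra {j : ℕ} (hj : j < 118) : adRep σ (compl σ j) ∈ genAlgebra σ := by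
  have key : ∀ (w : List ℕ) (i : ℕ), (∀ m ∈ w, m < 16) → i < 8 →
      adRep σ (vec σ (w.foldr (fun m l => listBracket (genList m) l) [genNums (8 + i)])) ∈
        genAlgebra σ := by
    intro w i hw hi
    induction w with
    | nil => exact gen_eq σ (8 + i) ▸ gen_mem_genAlgebra σ (by omega)
    | cons m w ih =>
      rw [List.foldr_cons, ← lie_vec, ← gen, adRep_lie σ (adRep_of_mem_image σ (gen_mem_image σ m))]
      exact (genAlgebra σ).lie_mem (gen_mem_genAlgebra σ (hw m List.mem_cons_self))
        (ih fun n hn => hw n (List.mem_cons_of_mem _ hn))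
  have h : words[j]? = some (words[j]'(words_length ▸ hj)) :=
    List.getElem?_eq_getElem (words_length ▸ hj)
  have hb := words_bounds _ (List.getElem_mem (words_length ▸ hj))
  rw [compl, complList, h]
  exact key _ _ hb.1 hb.2

theorem exists_adRep_eq (x : LieE8 k) : ∃ a : k,
    adRep σ x = a • rep σ + ∑ j : Fin 119, complCoord σ j x • adRep σ (compl σ j) := by
  obtain ⟨n, hn, h⟩ := exists_decomposition σ x
  obtain ⟨a, ha⟩ := Submodule.mem_span_singleton.1 ((mem_normaliser_rep σ).1 hn)
  refine ⟨a, ?_⟩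
  conv_lhs => rw [h]
  rw [map_add, ← ha, map_sum]
  simp only [map_smul]

theorem field_mem_span {v : LieE8 k} (hv : v ∈ image σ) (h : pivotCoeff k 118 (function σ v) = 0) :
    field σ v ∈ Submodule.span k (Set.range fun j : Fin 118 => symbol σ (compl σ j)) := by
  obtain ⟨x, rfl⟩ := hv
  have h1 : symbol σ x ∈ Submodule.span k (Set.range fun j : Fin 118 => symbol σ (compl σ j)) := by
    rw [symbol_eq_sum, Fin.sum_univ_castSucc]
    have h2 : complCoord σ (Fin.last 118 : Fin 119) x = 0 := h
    rw [h2, zero_smul, add_zero]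
    exact Submodule.sum_mem _ fun j _ => Submodule.smul_mem _ _ (Submodule.subset_span ⟨j, rfl⟩)
  exact h1

/-- The span of the 118 symbols contains the generators and is stable under them: brackets stay
among the symbols of $\mathfrak g$, and the last pivot functional stays zero on them. -/
theorem toSubmodule_scriptH : (scriptH k).toSubmodule =
    Submodule.span k (Set.range fun j : Fin 118 => symbol σ (compl σ j)) := by
  have hle : Submodule.span k (Set.range fun j : Fin 118 => symbol σ (compl σ j)) ≤
      (scriptH k).toSubmodule := by
    refine Submodule.span_le.2 ?_
    rintro _ ⟨j, rfl⟩
    exact field_mem_scriptH σ (adRep_compl_mem_genAlgebra σ j.2)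
  have hgen : ∀ D ∈ Set.range (partialD k) ∪ Set.range fun i => hamVec (quintic k i),
      ∃ n < 16, field σ (gen σ n) = D := by
    rintro _ (⟨i, rfl⟩ | ⟨i, rfl⟩)
    · exact ⟨(i + 4 : Fin 8), by omega, by rw [field_gen, hamVec_var]⟩
    · exact ⟨8 + i, by omega, field_gen_add σ i⟩
  refine le_antisymm (lieSpan_le_of_lie_mem _ _ ?_ hle ?_) hle
  · intro D hD
    obtain ⟨n, hn, rfl⟩ := hgen D hD
    refine field_mem_span σ (gen_mem_image σ n) ?_
    rw [gen, pivotCoeff_function σ (by norm_num), last_pivots_gen n hn]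
    rfl
  · intro D hD E hE
    obtain ⟨n, hn, rfl⟩ := hgen D hD
    induction hE using Submodule.span_induction with
    | zero => rw [witt_lie_zero]; exact Submodule.zero_mem _
    | add E F _ _ hE hF => rw [witt_lie_add]; exact Submodule.add_mem _ hE hF
    | smul c E _ hE => rw [witt_lie_smul]; exact Submodule.smul_mem _ c hE
    | mem E hE =>
      obtain ⟨j, rfl⟩ := hE
      have hj : adRep σ (compl σ j) ∈ image σ := ⟨_, rfl⟩
      change ⁅field σ (gen σ n), field σ (adRep σ (compl σ j))⁆ ∈ _
      rw [← field_lie_gen σ hn hj]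
      refine field_mem_span σ (lie_mem_image σ (adRep_of_mem_image σ (gen_mem_image σ n)) hj) ?_
      rw [gen, compl, adRep_vec, lie_vec, pivotCoeff_function σ (by norm_num),
        last_pivots_bracket n hn j j.2]
      rfl

theorem exists_field_eq {D : Witt k} (hD : D ∈ scriptH k) : ∃ u ∈ genAlgebra σ, field σ u = D := by
  have h : (scriptH k).toSubmodule ≤ (genAlgebra σ).toSubmodule.map (field σ) := by
    rw [toSubmodule_scriptH σ, Submodule.span_le]
    rintro _ ⟨j, rfl⟩
    exact ⟨_, adRep_compl_mem_genAlgebra σ j.2, rfl⟩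
  exact h hD

theorem symbol_compl_mem_scriptH (j : Fin 118) : symbol σ (compl σ j) ∈ scriptH k :=
  field_mem_scriptH σ (adRep_compl_mem_genAlgebra σ j.2)

theorem finrank_scriptH (σ : LieE8 k ≃ₗ⁅k⁆ LieE8 k) : Module.finrank k (scriptH k) = 118 := by
  let g : (Fin 118 → k) →ₗ[k] LieE8 k := Fintype.linearCombination k fun j : Fin 118 => compl σ j
  have hg : ∀ c, g c = ∑ j : Fin 118, c j • compl σ j := fun c => Fintype.linearCombination_apply _ _ _
  have hs : ∀ c, symbol σ (g c) = ∑ j : Fin 118, c j • symbol σ (compl σ j) := fun c => by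
    rw [hg, map_sum]
    simp only [map_smul]
  have hb : ∀ c, symbol σ (g c) ∈ (scriptH k).toSubmodule := fun c => by
    rw [hs, toSubmodule_scriptH σ]
    exact (Submodule.mem_span_range_iff_exists_fun k).2 ⟨c, rfl⟩
  let f : (Fin 118 → k) →ₗ[k] (scriptH k).toSubmodule := (symbol σ ∘ₗ g).codRestrict _ hb
  have hinj : Function.Injective f := by
    intro c d h
    have h1 : symbol σ (g c) = symbol σ (g d) := congrArg Subtype.val h
    -- Extension by 0 at the last index makes the 119 dual functionals applicable.
    have h2 : ∀ c : Fin 118 → k,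
        g c = ∑ j : Fin 119, (Fin.snoc c 0 : Fin 119 → k) j • compl σ j := by
      intro c
      rw [hg, Fin.sum_univ_castSucc (n := 118), Fin.snoc_last, zero_smul, add_zero]
      exact Finset.sum_congr rfl fun j _ => by rw [Fin.snoc_castSucc]; rfl
    rw [symbol_eq_iff, h2, h2] at h1
    funext j
    have h3 := complCoord_of_mem σ h1 (Fin.castSucc j : Fin 119)
    rw [map_add, complCoord_sum, complCoord_sum, Fin.snoc_castSucc, Fin.snoc_castSucc] at h3
    rw [eq_neg_of_add_eq_zero_left h3, CharTwo.neg_eq]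
  have hsurj : Function.Surjective f := by
    rintro ⟨D, hD⟩
    have hD' := hD
    rw [toSubmodule_scriptH σ] at hD'
    obtain ⟨c, hc⟩ := (Submodule.mem_span_range_iff_exists_fun k).1 hD'
    exact ⟨c, Subtype.ext ((hs c).trans hc)⟩
  have h := (LinearEquiv.ofBijective f ⟨hinj, hsurj⟩).finrank_eq
  rw [Module.finrank_fin_fun] at h
  exact h.symm

end Generators

/-! ### The centraliser of `e` -/

section Centraliser

variable {k : Type*} [Field k] (σ : LieE8 k ≃ₗ⁅k⁆ LieE8 k)

/-- The coordinate at the basis vector with number `i`. -/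
def numCoord (i : ℕ) : LieE8 k →ₗ[k] k := extendLinear σ fun j => if j = i then 1 else 0

theorem numCoord_vec {i : ℕ} (hi : i ∈ basisNums) (l : List ℕ) :
    numCoord σ i (vec σ l) = comb (fun j => if j = i then 1 else 0) l :=
  extendLinear_vec σ (fun j hj => if_neg fun h : j = i => hj (h ▸ hi)) l

theorem numCoord_vec_of_not_mem {i : ℕ} (hi : i ∈ basisNums) {l : List ℕ} (hl : i ∉ l) :
    numCoord σ i (vec σ l) = 0 := by
  have h : comb (fun j => if j = i then (1 : k) else 0) l = comb (fun _ => 0) l :=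
    comb_congr fun j hj => if_neg fun h : j = i => hl (h ▸ hj)
  rw [numCoord_vec σ hi, h]
  simp [comb]

theorem numCoord_vec_singleton {i : ℕ} (hi : i ∈ basisNums) (j : ℕ) :
    numCoord σ i (vec σ [j]) = if j = i then 1 else 0 := by
  rw [numCoord_vec σ hi, comb_cons, comb_nil, add_zero]

theorem rep_ne_zero : rep σ ≠ 0 := by
  intro h
  have hi : 185 ∈ basisNums := by decide +kernel
  have h1 := numCoord_vec σ hi repNums
  rw [← rep, h, map_zero] at h1
  simp [repNums] at h1

/-- The numbers of eight root vectors which commute with `e`. -/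
def extraNum (i : Fin 8) : ℕ := extraNums.get i

theorem extraNum_mem (i : Fin 8) : extraNum i ∈ extraNums := List.get_mem _ _

theorem extraNum_mem_basisNums (i : Fin 8) : extraNum i ∈ basisNums :=
  extraNums_subset _ (extraNum_mem i)

theorem extraNum_injective : Function.Injective extraNum :=
  List.nodup_iff_injective_get.1 extraNums_nodup

/-- The root vectors with these numbers. -/
def extra (i : Fin 8) : LieE8 k := vec σ [extraNum i]

/-- The coordinates at these root vectors. -/
def extraCoord : LieE8 k →ₗ[k] Fin 8 → k := LinearMap.pi fun i => numCoord σ (extraNum i)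

theorem extraCoord_apply (x : LieE8 k) (i : Fin 8) :
    extraCoord σ x i = numCoord σ (extraNum i) x := rfl

theorem extraCoord_sum (c : Fin 8 → k) : extraCoord σ (∑ i, c i • extra σ i) = c := by
  funext j
  rw [extraCoord_apply, map_sum]
  simp only [map_smul, extra, numCoord_vec_singleton σ (extraNum_mem_basisNums j),
    extraNum_injective.eq_iff, smul_eq_mul, mul_ite, mul_one, mul_zero, Finset.sum_ite_eq',
    Finset.mem_univ, if_true]

/-- The centraliser of `e`. -/
def centraliser : Submodule k (LieE8 k) := LinearMap.ker (adRep σ)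

theorem centraliser_le_normaliser : centraliser σ ≤ (normaliser k (rep σ)).toSubmodule := by
  intro x hx
  refine (mem_normaliser_rep σ).2 ?_
  rw [show adRep σ x = 0 from hx]
  exact Submodule.zero_mem _

variable [CharP k 2]

theorem extraCoord_of_mem_image {x : LieE8 k} (hx : x ∈ image σ) : extraCoord σ x = 0 := by
  obtain ⟨x, rfl⟩ := hx
  have h : LinearMap.ker (extraCoord σ ∘ₗ adRep σ) = ⊤ := span_vec_eq_top σ _ fun i hi => by
    refine funext fun j => ?_
    change numCoord σ (extraNum j) (adRep σ (vec σ [i])) = 0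
    rw [adRep_vec]
    exact numCoord_vec_of_not_mem σ (extraNum_mem_basisNums j)
      (extra_not_mem_bracket i hi _ (extraNum_mem j))
  have hx : x ∈ LinearMap.ker (extraCoord σ ∘ₗ adRep σ) := h ▸ Submodule.mem_top
  exact hx

theorem image_le_centraliser : image σ ≤ centraliser σ := fun _ h => adRep_of_mem_image σ h

theorem extra_mem_centraliser (i : Fin 8) : extra σ i ∈ centraliser σ := by
  change adRep σ (vec σ _) = 0
  rw [adRep_vec]
  exact vec_eq_zero σ (bracket_extra _ (extraNum_mem i))

theorem centraliser_lt_normaliser : centraliser σ < (normaliser k (rep σ)).toSubmodule := by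
  refine lt_of_le_of_ne (centraliser_le_normaliser σ) fun h => ?_
  have h1 : adRep σ (vec σ [424, 428]) = rep σ := by
    rw [adRep_vec, rep, vec_eq_of_mask σ bracket_coroot]
  have h2 : vec σ [424, 428] ∈ (normaliser k (rep σ)).toSubmodule :=
    (mem_normaliser_rep σ).2 (h1 ▸ Submodule.mem_span_singleton_self _)
  rw [← h] at h2
  exact rep_ne_zero σ (h1.symm.trans h2)

/-- Dimension count: if $c$ is the dimension of the centraliser, then $c\le 128$, as it is proper in
the normaliser. The image of $\mathrm{ad}\,e$ has dimension $248-c\ge c-8$ and lies in a space of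
dimension $c-8$, so the two coincide. -/
theorem mem_image_of_extraCoord {x : LieE8 k} (hx : x ∈ centraliser σ) (h : extraCoord σ x = 0) :
    x ∈ image σ := by
  let E : centraliser σ →ₗ[k] Fin 8 → k := extraCoord σ ∘ₗ (centraliser σ).subtype
  have hE : LinearMap.range E = ⊤ := LinearMap.range_eq_top.2 fun c =>
    ⟨⟨∑ i, c i • extra σ i, Submodule.sum_mem _ fun i _ =>
      Submodule.smul_mem _ _ (extra_mem_centraliser σ i)⟩, extraCoord_sum σ c⟩
  have hle : image σ ≤ (LinearMap.ker E).map (centraliser σ).subtype := fun y hy =>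
    ⟨⟨y, image_le_centraliser σ hy⟩, extraCoord_of_mem_image σ hy, rfl⟩
  have h1 := E.finrank_range_add_finrank_ker
  rw [hE, finrank_top, Module.finrank_fin_fun] at h1
  have h2 := (adRep σ).finrank_range_add_finrank_ker
  rw [finrank_lieE8] at h2
  have h3 := Submodule.finrank_lt_finrank_of_lt (centraliser_lt_normaliser σ)
  have h4 : Module.finrank k (normaliser k (rep σ)).toSubmodule = 129 := finrank_normaliser σ
  have h5 : Module.finrank k ((LinearMap.ker E).map (centraliser σ).subtype) =
      Module.finrank k (LinearMap.ker E) := Submodule.finrank_map_subtype_eq _ _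
  have heq : image σ = (LinearMap.ker E).map (centraliser σ).subtype := by
    refine Submodule.eq_of_le_of_finrank_le hle ?_
    rw [h5]
    change _ + Module.finrank k (centraliser σ) = 248 at h2
    change _ ≤ Module.finrank k (LinearMap.range (adRep σ))
    omega
  rw [heq]
  exact ⟨⟨x, hx⟩, h, rfl⟩

/-- The normaliser acts on the line through $e$ by scalars, and scalars commute. -/
theorem lie_mem_centraliser_of_normaliser {x y : LieE8 k} (hx : x ∈ normaliser k (rep σ))
    (hy : y ∈ normaliser k (rep σ)) : ⁅x, y⁆ ∈ centraliser σ := by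
  obtain ⟨a, ha⟩ := Submodule.mem_span_singleton.1 ((mem_normaliser_rep σ).1 hx)
  obtain ⟨b, hb⟩ := Submodule.mem_span_singleton.1 ((mem_normaliser_rep σ).1 hy)
  rw [adRep_apply] at ha hb
  change ⁅rep σ, ⁅x, y⁆⁆ = 0
  rw [leibniz_lie, ← ha, ← hb, smul_lie, lie_smul, ← hb, ← lie_skew, ← ha, lieE8_neg, smul_smul,
    smul_smul, mul_comm, lieE8_add_self]

theorem lie_mem_centraliser {x y : LieE8 k} (hx : x ∈ centraliser σ) (hy : y ∈ centraliser σ) :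
    ⁅x, y⁆ ∈ centraliser σ :=
  lie_mem_centraliser_of_normaliser σ (centraliser_le_normaliser σ hx) (centraliser_le_normaliser σ hy)

/-- The centraliser is $[e,\mathfrak g]$ plus the span of the eight extra root vectors. It preserves
$[e,\mathfrak g]$, and brackets of the extra vectors have no extra coordinates. -/
theorem lie_mem_image_of_centraliser {x y : LieE8 k} (hx : x ∈ centraliser σ)
    (hy : y ∈ centraliser σ) : ⁅x, y⁆ ∈ image σ := by
  have hdec : ∀ x ∈ centraliser σ, ∃ n ∈ image σ, x = n + ∑ i, extraCoord σ x i • extra σ i := by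
    intro x hx
    have hz : ∑ i, extraCoord σ x i • extra σ i ∈ centraliser σ := Submodule.sum_mem _ fun i _ =>
      Submodule.smul_mem _ _ (extra_mem_centraliser σ i)
    refine ⟨x - ∑ i, extraCoord σ x i • extra σ i,
      mem_image_of_extraCoord σ (Submodule.sub_mem _ hx hz) ?_, (sub_add_cancel _ _).symm⟩
    rw [map_sub, extraCoord_sum, sub_self]
  have hextra : ∀ i j, ⁅extra σ i, extra σ j⁆ ∈ image σ := fun i j => by
    refine mem_image_of_extraCoord σ
      (lie_mem_centraliser σ (extra_mem_centraliser σ i) (extra_mem_centraliser σ j))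
      (funext fun l => ?_)
    rw [extraCoord_apply, extra, extra, lie_vec]
    exact numCoord_vec_of_not_mem σ (extraNum_mem_basisNums l) (extra_not_mem_bracket_extra _
      (extraNum_mem i) _ (extraNum_mem j) _ (extraNum_mem l))
  have hleft : ∀ {n z}, n ∈ image σ → z ∈ centraliser σ → ⁅n, z⁆ ∈ image σ := fun hn hz => by
    rw [← lie_skew]
    exact Submodule.neg_mem _ (lie_mem_image σ hz hn)
  obtain ⟨n, hn, h⟩ := hdec x hx
  obtain ⟨n', hn', h'⟩ := hdec y hy
  rw [h, add_lie]
  refine Submodule.add_mem _ (hleft hn hy) ?_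
  rw [sum_lie]
  refine Submodule.sum_mem _ fun i _ => ?_
  rw [smul_lie, h', lie_add, lie_sum]
  refine Submodule.smul_mem _ _ (Submodule.add_mem _
    (lie_mem_image σ (extra_mem_centraliser σ i) hn') (Submodule.sum_mem _ fun j _ => ?_))
  rw [lie_smul]
  exact Submodule.smul_mem _ _ (hextra i j)

theorem rep_mem_genAlgebra : rep σ ∈ genAlgebra σ := by
  rw [rep, ← vec_eq_of_mask σ mask_rep_eq, vec_flatMap]
  refine comb_mem _ _ _ fun a ha => ?_
  have h4 : a < 4 := List.mem_range.1 ha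
  rw [← lie_vec]
  exact (genAlgebra σ).lie_mem (gen_mem_genAlgebra σ (n := a) (by omega))
    (gen_mem_genAlgebra σ (n := 12 + a) (by omega))

theorem genAlgebra_le_centraliser {u : LieE8 k} (hu : u ∈ genAlgebra σ) : u ∈ centraliser σ :=
  image_le_centraliser σ (genAlgebra_spec σ hu).1

/-- Write $u=[e,x]$. Then $x$ has zero symbol, so it normalises the line. -/
theorem mem_span_rep_of_field_eq_zero {u : LieE8 k} (hu : u ∈ genAlgebra σ) (h : field σ u = 0) :
    u ∈ Submodule.span k {rep σ} := by
  obtain ⟨x, rfl⟩ := (genAlgebra_spec σ hu).1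
  exact (mem_normaliser_rep σ).1 ((mem_normaliser_iff σ).2 h)

theorem lie_last_mem_genAlgebra {s : LieE8 k} (hs : s ∈ genAlgebra σ) :
    ⁅adRep σ (compl σ 118), s⁆ ∈ genAlgebra σ := by
  refine lie_mem_lieSpan_of_forall ?_ hs
  rintro _ ⟨⟨n, hn⟩, rfl⟩
  change ⁅adRep σ (compl σ 118), gen σ n⁆ ∈ genAlgebra σ
  rw [compl, gen, adRep_vec, lie_vec]
  rcases List.mem_cons.1 (last_bracket_gen n hn) with h | h
  · rw [vec_eq_zero σ h]
    exact (genAlgebra σ).zero_mem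
  · rw [vec_eq_of_mask σ (List.mem_singleton.1 h)]
    exact gen_mem_genAlgebra σ hn

/-- The space $[e,\mathfrak g]$ is the generated algebra plus the line through $[e,b_{118}]$, which
normalises it and brackets to zero with itself. -/
theorem lie_mem_genAlgebra {x y : LieE8 k} (hx : x ∈ image σ) (hy : y ∈ image σ) :
    ⁅x, y⁆ ∈ genAlgebra σ := by
  have hdec : ∀ x ∈ image σ, ∃ s ∈ genAlgebra σ, ∃ c : k, x = s + c • adRep σ (compl σ 118) := by
    rintro _ ⟨x, rfl⟩
    obtain ⟨a, h⟩ := exists_adRep_eq σ x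
    rw [Fin.sum_univ_castSucc (n := 118), ← add_assoc] at h
    refine ⟨_, (genAlgebra σ).add_mem ((genAlgebra σ).smul_mem a (rep_mem_genAlgebra σ))
      (Submodule.sum_mem (genAlgebra σ).toSubmodule fun j _ => (genAlgebra σ).smul_mem _ ?_), _, h⟩
    exact adRep_compl_mem_genAlgebra σ j.2
  obtain ⟨s, hs, c, rfl⟩ := hdec x hx
  obtain ⟨t, ht, d, rfl⟩ := hdec y hy
  rw [add_lie, lie_add, lie_add, smul_lie, smul_lie, lie_smul, lie_smul, lie_self, smul_zero,
    smul_zero, add_zero, ← lie_skew s (adRep σ (compl σ 118)), lieE8_neg]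
  exact (genAlgebra σ).add_mem ((genAlgebra σ).add_mem ((genAlgebra σ).lie_mem hs ht)
    ((genAlgebra σ).smul_mem _ (lie_last_mem_genAlgebra σ hs)))
    ((genAlgebra σ).smul_mem _ (lie_last_mem_genAlgebra σ ht))

end Centraliser

/-! ### The derived series of the normaliser -/

section DerivedSeries

theorem derivedSeries_succ_subset {k L : Type*} [Field k] [LieRing L] [LieAlgebra k L]
    (N : LieSubalgebra k L) (A B : Submodule k L) (hAB : ∀ x ∈ A, ∀ y ∈ A, ⁅x, y⁆ ∈ B) (n : ℕ)
    (h : ∀ y ∈ LieAlgebra.derivedSeries k N n, (y : L) ∈ A) :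
    ∀ y ∈ LieAlgebra.derivedSeries k N (n + 1), (y : L) ∈ B := by
  intro y hy
  rw [LieAlgebra.derivedSeries_def, LieAlgebra.derivedSeriesOfIdeal_succ, ← LieAlgebra.derivedSeries_def,
    ← LieSubmodule.mem_toSubmodule, LieSubmodule.lieIdeal_oper_eq_linear_span'] at hy
  have hle : Submodule.span k {m | ∃ x ∈ LieAlgebra.derivedSeries k N n,
      ∃ z ∈ LieAlgebra.derivedSeries k N n, ⁅x, z⁆ = m} ≤ B.comap N.toSubmodule.subtype := by
    refine Submodule.span_le.2 ?_
    rintro _ ⟨x, hx, z, hz, rfl⟩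
    exact hAB _ (h x hx) _ (h z hz)
  exact hle hy

variable {k : Type*} [Field k] [CharP k 2] (σ : LieE8 k ≃ₗ⁅k⁆ LieE8 k)

theorem mem_genAlgebra_of_mem_derivedSeries {y : normaliser k (rep σ)}
    (hy : y ∈ LieAlgebra.derivedSeries k (normaliser k (rep σ)) 3) : (y : LieE8 k) ∈ genAlgebra σ := by
  have h1 := derivedSeries_succ_subset (normaliser k (rep σ)) (normaliser k (rep σ)).toSubmodule
    (centraliser σ) (fun x hx y hy => lie_mem_centraliser_of_normaliser σ hx hy) 0 fun y _ => y.2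
  have h2 := derivedSeries_succ_subset (normaliser k (rep σ)) (centraliser σ) (image σ)
    (fun x hx y hy => lie_mem_image_of_centraliser σ hx hy) 1 h1
  exact derivedSeries_succ_subset (normaliser k (rep σ)) (image σ) (genAlgebra σ).toSubmodule
    (fun x hx y hy => lie_mem_genAlgebra σ hx hy) 2 h2 y hy

/-- The generated algebra is perfect, since each generator is a bracket of itself with another
element; hence it lies in every term of the derived series. -/
theorem mem_derivedSeries_of_mem_genAlgebra (m : ℕ) {u : LieE8 k} (hu : u ∈ genAlgebra σ) :
    ∃ h : u ∈ normaliser k (rep σ),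
      (⟨u, h⟩ : normaliser k (rep σ)) ∈ LieAlgebra.derivedSeries k (normaliser k (rep σ)) m := by
  induction m generalizing u with
  | zero => exact ⟨centraliser_le_normaliser σ (genAlgebra_le_centraliser σ hu), LieSubmodule.mem_top _⟩
  | succ m ih =>
    let K : LieSubalgebra k (LieE8 k) :=
      (LieAlgebra.derivedSeries k (normaliser k (rep σ)) (m + 1)).toLieSubalgebra.map
        (normaliser k (rep σ)).incl
    have hK : genAlgebra σ ≤ K := by
      refine (genAlgebra_le_iff σ K).2 fun n hn => ?_
      obtain ⟨j, hj, h⟩ := gen_perfect n hn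
      obtain ⟨h1, h1'⟩ := ih (adRep_compl_mem_genAlgebra σ hj)
      obtain ⟨h2, h2'⟩ := ih (gen_mem_genAlgebra σ hn)
      refine ⟨⁅(⟨_, h1⟩ : normaliser k (rep σ)), (⟨_, h2⟩ : normaliser k (rep σ))⁆,
        ?_, ?_⟩
      · have h3 := LieSubmodule.lie_mem_lie h1' h2'
        rw [LieAlgebra.derivedSeries_def, ← LieAlgebra.derivedSeriesOfIdeal_succ] at h3
        exact h3
      change ⁅adRep σ (compl σ j), gen σ n⁆ = gen σ n
      rw [compl, gen, adRep_vec, lie_vec, vec_eq_of_mask σ h]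
    obtain ⟨y, hy, rfl⟩ := hK hu
    exact ⟨y.2, hy⟩

/-- The map from the third derived subalgebra of the normaliser to `𝓗(8; 1)`. -/
def derivedMap : LieAlgebra.derivedSeries k (normaliser k (rep σ)) 3 →ₗ⁅k⁆ scriptH k where
  toFun y := ⟨field σ (y.1 : LieE8 k),
    field_mem_scriptH σ (mem_genAlgebra_of_mem_derivedSeries σ y.2)⟩
  map_add' _ _ := Subtype.ext (map_add (field σ) _ _)
  map_smul' c _ := Subtype.ext (map_smul (field σ) c _)
  map_lie' {x y} := Subtype.ext ((genAlgebra_spec σ (mem_genAlgebra_of_mem_derivedSeries σ x.2)).2 _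
    (genAlgebra_spec σ (mem_genAlgebra_of_mem_derivedSeries σ y.2)).1)

theorem derivedMap_surjective : Function.Surjective (derivedMap σ) := by
  rintro ⟨D, hD⟩
  obtain ⟨u, hu, rfl⟩ := exists_field_eq σ hD
  obtain ⟨h, h'⟩ := mem_derivedSeries_of_mem_genAlgebra σ 3 hu
  exact ⟨⟨⟨u, h⟩, h'⟩, rfl⟩

theorem ker_derivedMap : (derivedMap σ).ker =
    lineIdeal (rep σ) (LieAlgebra.derivedSeries k (normaliser k (rep σ)) 3) := by
  ext y
  rw [LieHom.mem_ker]
  constructor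
  · intro h
    exact mem_span_rep_of_field_eq_zero σ (mem_genAlgebra_of_mem_derivedSeries σ y.2)
      (congrArg Subtype.val h)
  · intro h
    obtain ⟨c, hc⟩ := Submodule.mem_span_singleton.1 h
    refine Subtype.ext ?_
    change field σ ((y : normaliser k (rep σ)) : LieE8 k) = 0
    rw [← hc, map_smul, field_rep, smul_zero]

theorem nonempty_quotient_equiv :
    Nonempty ((LieAlgebra.derivedSeries k (normaliser k (rep σ)) 3 ⧸
        lineIdeal (rep σ) (LieAlgebra.derivedSeries k (normaliser k (rep σ)) 3))
      ≃ₗ⁅k⁆ scriptH k) := by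
  rw [← ker_derivedMap]
  have h : (derivedMap σ).range = ⊤ := (LieHom.range_eq_top _).2 (derivedMap_surjective σ)
  exact ⟨(LieHom.quotKerEquivRange (derivedMap σ)).trans
    ((LieEquiv.ofEq _ _ (congrArg _ h)).trans LieSubalgebra.topEquiv)⟩

/-- The normaliser of the line through `e` is a maximal subalgebra. -/
theorem isCoatom_normaliser : IsCoatom (normaliser k (rep σ)) := by
  refine ⟨fun h => ?_, fun M hM => ?_⟩
  · have h1 := finrank_normaliser σ
    have h2 : Module.finrank k (normaliser k (rep σ)).toSubmodule = 129 := h1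
    rw [h, LieSubalgebra.top_toSubmodule, finrank_top, finrank_lieE8] at h2
    omega
  · obtain ⟨hle, x, hxM, hx⟩ := SetLike.lt_iff_le_and_exists.1 hM
    -- The symbols of $M$ are stable under $\mathcal H(8;\underline 1)$, because $M$ contains the
    -- normaliser and so the generated algebra, whose elements commute with $\mathrm{ad}\,e$.
    let V : Submodule k (Witt k) := M.toSubmodule.map (symbol σ)
    have hne : V ≠ ⊥ := fun h => hx ((mem_normaliser_iff σ).2
      ((Submodule.eq_bot_iff V).1 h _ ⟨x, hxM, rfl⟩))
    have hV : ∀ D ∈ scriptH k, ∀ E ∈ V, ⁅D, E⁆ ∈ V := by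
      rintro D hD _ ⟨m, hm, rfl⟩
      obtain ⟨u, hu, rfl⟩ := exists_field_eq σ hD
      have hc := genAlgebra_le_centraliser σ hu
      refine ⟨⁅u, m⁆, M.lie_mem (hle (centraliser_le_normaliser σ hc)) hm, ?_⟩
      change field σ (adRep σ ⁅u, m⁆) = ⁅field σ u, field σ (adRep σ m)⁆
      rw [adRep_lie σ hc, (genAlgebra_spec σ hu).2 _ ⟨m, rfl⟩]
    -- An element of $M$ with the same symbol as $b$ differs from $b$ by an element of the
    -- normaliser.
    have hmem : ∀ b, symbol σ b ∈ scriptH k → b ∈ M := by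
      intro b hb
      obtain ⟨m, hm, h⟩ := scriptH_le_of_invariant V hV hne hb
      have h1 := hle ((symbol_eq_iff σ).1 h)
      have h2 : b = m + (m + b) := by rw [← add_assoc, lieE8_add_self, zero_add]
      rw [h2]
      exact M.add_mem hm h1
    have hgen : ∀ n < 16, vec σ [genNums n] ∈ M := fun n hn => hmem _ (by
      rw [symbol, LinearMap.comp_apply, ← gen_eq]
      exact field_gen_mem_scriptH σ hn)
    -- The symbol of $b_{118}$ is not in $\mathcal H(8;\underline 1)$, so $b_{118}$ is obtained as
    -- the bracket $[x_0,y_4]$ instead.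
    have hlast : compl σ 118 ∈ M := by
      rw [compl, ← vec_eq_of_mask σ mask_complList_last, ← lie_vec]
      exact M.lie_mem (hgen 0 (by norm_num)) (hgen 12 (by norm_num))
    have hcompl : complSpan σ ≤ M.toSubmodule := by
      refine Submodule.span_le.2 ?_
      rintro _ ⟨j, rfl⟩
      by_cases hj : j.val < 118
      · exact hmem _ (symbol_compl_mem_scriptH σ ⟨j, hj⟩)
      · have h1 : j.val = 118 := by omega
        change compl σ j ∈ M
        rwa [h1]
    rw [← LieSubalgebra.toSubmodule_inj, LieSubalgebra.top_toSubmodule, eq_top_iff,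
      ← normaliser_sup_complSpan σ]
    exact sup_le hle hcompl

/-! ### Reduction from the orbit to the standard representative -/

theorem nilpotentRep_eq {k : Type*} [Field k] : nilpotentRep k = comb (numVec k) repNums := by
  have h1 : decode (code 185) = (simpleRoot 1).1 := by decide +kernel
  have h2 : decode (code 326) = (simpleRoot 2).1 := by decide +kernel
  have h3 : decode (code 341) = (simpleRoot 4).1 := by decide +kernel
  have h4 : decode (code 400) = (simpleRoot 6).1 := by decide +kernel
  rw [nilpotentRep, ← h1, ← h2, ← h3, ← h4, ← numVec_of_lt (by norm_num), ← numVec_of_lt (by norm_num),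
    ← numVec_of_lt (by norm_num), ← numVec_of_lt (by norm_num)]
  simp only [repNums, comb_cons, comb_nil, add_zero, add_assoc]

theorem exists_rep_eq {k : Type*} [Field k] {e : LieE8 k} (he : e ∈ orbitA1pow4 k) :
    ∃ σ : LieE8 k ≃ₗ⁅k⁆ LieE8 k, rep σ = e := by
  obtain ⟨g, hg, rfl⟩ := he
  refine ⟨groupE8LieEquiv hg, ?_⟩
  rw [nilpotentRep_eq]
  rfl

end DerivedSeries

end E8Char2

end

theorem mainTheorem11 (k : Type*) [Field k] [IsAlgClosed k] [CharP k 2]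
    (e : E8Char2.LieE8 k) (he : e ∈ E8Char2.orbitA1pow4 k) :
    -- the normaliser has dimension `129` and is a maximal subalgebra
    Module.finrank k (E8Char2.normaliser k e) = 129 ∧
    IsCoatom (E8Char2.normaliser k e) ∧
    -- the simple subalgebra of dimension `118` of the derived Hamiltonian algebra
    E8Char2.scriptH k ≤ E8Char2.hamiltonianDerived k ∧
    LieAlgebra.IsSimple k (E8Char2.scriptH k) ∧
    Module.finrank k (E8Char2.scriptH k) = 118 ∧
    -- the line `k e` lies in the third derived subalgebra, and the quotient by it
    (∃ y ∈ LieAlgebra.derivedSeries k (E8Char2.normaliser k e) 3, (y : E8Char2.LieE8 k) = e) ∧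
    Nonempty ((LieAlgebra.derivedSeries k (E8Char2.normaliser k e) 3 ⧸
        E8Char2.lineIdeal e (LieAlgebra.derivedSeries k (E8Char2.normaliser k e) 3))
      ≃ₗ⁅k⁆ E8Char2.scriptH k) := by
  obtain ⟨σ, rfl⟩ := E8Char2.exists_rep_eq he
  obtain ⟨h, h'⟩ := E8Char2.mem_derivedSeries_of_mem_genAlgebra σ 3 (E8Char2.rep_mem_genAlgebra σ)
  exact ⟨E8Char2.finrank_normaliser σ, E8Char2.isCoatom_normaliser σ,
    E8Char2.scriptH_le_hamiltonianDerived, E8Char2.isSimple_scriptH, E8Char2.finrank_scriptH σ,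
    ⟨_, h', rfl⟩, E8Char2.nonempty_quotient_equiv σ⟩
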